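/- Let $E_1,E_3\in\mathbb C$ satisfy $\operatorname{Im}E_1>0$, $\operatorname{Im}E_3>0$ and $\operatorname{Re}E_1>\operatorname{Re}E_3$, and let $\alpha\in\mathbb R$. For $\epsilon>0$ put $E_2=E_3+\epsilon$ and $E_{-j}=\overline{E_j}$, and let $\overline\Gamma$ be the polygonal line with successive vertices $E_{-3},E_{-2},E_{-1},E_1,E_2,E_3$, oriented in this order. Let $\theta(z;x,t)=2tz^2+xz$, $\sigma_2=\begin{pmatrix}0&-i\\ i&0\end{pmatrix}$, $\sigma_3=\begin{pmatrix}1&0\\0&-1\end{pmatrix}$. For $\beta\in\mathbb R$ and $(x,t)\in\mathbb R^2$ consider the Riemann–Hilbert problem of finding $\Psi:\mathbb C\setminus\overline\Gamma\to\mathrm{Mat}(2\times2,\mathbb C)$ such that: (i) $\Psi$ is analytic; (ii) on each of the five open segments of $\overline\Gamma$, $\Psi$ has continuous boundary values $\Psi_+$ from the left and $\Psi_-$ from the right, with $\Psi_+(z)=\Psi_-(z)M(z)$, where $$M(z)=\begin{cases}e^{-i[\theta(z;x,t)+\alpha/2]\sigma_3}(-i\sigma_2)e^{i[\theta(z;x,t)+\alpha/2]\sigma_3},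 & z\in(E_2,E_3)\cup(E_{-3},E_{-2}),\\ e^{-i\beta\sigma_3}, & z\in(E_1,E_2)\cup(E_{-2},E_{-1}),\\ e^{-i\theta(z;x,t)\sigma_3}(-i\sigma_2)e^{i\theta(z;x,t)\sigma_3}, & z\in(E_{-1},E_1);\end{cases}$$ (iii) $\Psi(z)=\mathbf 1+\mathcal O(1/z)$ as $z\to\infty$; (iv) $\Psi(z)=\mathcal O(|z-E_j|^{-1/4})$ as $z\to E_j$, for $j=\pm1,\pm2,\pm3$. When this problem has a unique solution $\Psi(z;\epsilon)$, the two-phase solution of the focusing NLS equation $iq_t+q_{xx}+2|q|^2q=0$ is given by $q(x,t;\epsilon)=-2\lim_{z\to\infty}z\,\Psi_{12}(z;\epsilon)$. **Theorem.** Let $\beta\in(-\pi,\pi)$. There is a complex number $c_2$ with $|c_2|=1$, independent of $x$ and $t$, such that, for every compact subset $K$ of the $(x,t)$-plane, $q(x,t;\epsilon)$ is well defined for all $(x,t)\in K$ when $\epsilon>0$ is sufficiently small (the problem has exactly one solution and the limit exists), and, as $\epsilon\to0^+$, $q(x,t;\epsilon)$ converges, uniformly on $K$, to the plane wave $$-A\,c_2\,e^{-iEx+iNt},\qquad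 A=\operatorname{Im}E_1,\quad E=2\operatorname{Re}E_1,\quad N=-2\left[2(\operatorname{Re}E_1)^2-(\operatorname{Im}E_1)^2\right].$$ -/

import Mathlib

open Filter Topology Bornology Asymptotics

noncomputable section

namespace TwoPhase

/-- Complex `2 × 2` matrices. -/
abbrev Mat := Matrix (Fin 2) (Fin 2) ℂ

/-- The phase `θ(z; x, t) = 2 t z² + x z`. -/
def theta (z : ℂ) (x t : ℝ) : ℂ := 2 * (t : ℂ) * z ^ 2 + (x : ℂ) * z

/-- The second Pauli matrix. -/
def sigma2 : Mat := !![0, -Complex.I; Complex.I, 0]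

/-- The matrix `exp (s σ₃)`, where `σ₃ = diag(1, -1)`. -/
def expSigma3 (s : ℂ) : Mat := !![Complex.exp s, 0; 0, Complex.exp (-s)]

/-- The matrix `e^{-iφσ₃} (-iσ₂) e^{iφσ₃}`. -/
def twist (φ : ℂ) : Mat :=
  expSigma3 (-(Complex.I * φ)) * (-(Complex.I • sigma2)) * expSigma3 (Complex.I * φ)

/-- The open half-plane to the left of the line through `a` and `b`, oriented from `a` to `b`. -/
def leftSide (a b : ℂ) : Set ℂ := {w | 0 < ((w - a) * (starRingEnd ℂ) (b - a)).im}

/-- The open half-plane to the right of the line through `a` and `b`, oriented from `a` to `b`. -/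
def rightSide (a b : ℂ) : Set ℂ := {w | ((w - a) * (starRingEnd ℂ) (b - a)).im < 0}

/-- On the open segment oriented from `a` to `b` the function `Ψ` has boundary values `Ψ₊` from the
left and `Ψ₋` from the right, with `Ψ₊ = Ψ₋ M`. The limits are taken over the whole of
a one-sided neighbourhood of each point, so that the boundary values are taken continuously.
(If only limits inside cones at each point were asked for, the boundary values would not
determine a function up to analytic continuation.) -/
def HasJump (Ψ : ℂ → Mat) (a b : ℂ) (M : ℂ → Mat) : Prop :=
  ∀ z ∈ openSegment ℝ a b, ∃ Ψp Ψm : Mat,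
    Tendsto Ψ (𝓝[leftSide a b] z) (𝓝 Ψp) ∧
    Tendsto Ψ (𝓝[rightSide a b] z) (𝓝 Ψm) ∧
    Ψp = Ψm * M z

/-- The point `E₂ = E₃ + ε`. -/
def E2 (E₃ : ℂ) (ε : ℝ) : ℂ := E₃ + (ε : ℂ)

/-- The point `E₋ⱼ`, the complex conjugate of `Eⱼ`. -/
abbrev bar (z : ℂ) : ℂ := (starRingEnd ℂ) z

/-- The closure of the contour: the polygonal line `E₋₃, E₋₂, E₋₁, E₁, E₂, E₃`. -/
def closedContour (E₁ E₃ : ℂ) (ε : ℝ) : Set ℂ :=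
  segment ℝ (bar E₃) (bar (E2 E₃ ε)) ∪ segment ℝ (bar (E2 E₃ ε)) (bar E₁) ∪
    segment ℝ (bar E₁) E₁ ∪ segment ℝ E₁ (E2 E₃ ε) ∪ segment ℝ (E2 E₃ ε) E₃

/-- The six endpoints `E_{±1}, E_{±2}, E_{±3}`. -/
def endpoints (E₁ E₃ : ℂ) (ε : ℝ) : Set ℂ :=
  {E₁, bar E₁, E2 E₃ ε, bar (E2 E₃ ε), E₃, bar E₃}

/-- `Ψ` solves the Riemann-Hilbert problem with parameters `E₁, E₃, α, β, ε, x, t`. The values of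
`Ψ` on the closed contour are irrelevant. -/
structure IsRHSolution (E₁ E₃ : ℂ) (α β ε x t : ℝ) (Ψ : ℂ → Mat) : Prop where
  /-- `Ψ` is analytic off the closed contour. -/
  analytic : ∀ i j, DifferentiableOn ℂ (fun z => Ψ z i j) (closedContour E₁ E₃ ε)ᶜ
  /-- The jump relation on `(E₂, E₃)`. -/
  jump23 : HasJump Ψ (E2 E₃ ε) E₃ (fun z => twist (theta z x t + (α : ℂ) / 2))
  /-- The jump relation on `(E₁, E₂)`. -/
  jump12 : HasJump Ψ E₁ (E2 E₃ ε) (fun _ => expSigma3 (-(Complex.I * (β : ℂ))))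
  /-- The jump relation on `(E₋₁, E₁)`. -/
  jump11 : HasJump Ψ (bar E₁) E₁ (fun z => twist (theta z x t))
  /-- The jump relation on `(E₋₂, E₋₁)`. -/
  jump21 : HasJump Ψ (bar (E2 E₃ ε)) (bar E₁) (fun _ => expSigma3 (-(Complex.I * (β : ℂ))))
  /-- The jump relation on `(E₋₃, E₋₂)`. -/
  jump32 : HasJump Ψ (bar E₃) (bar (E2 E₃ ε)) (fun z => twist (theta z x t + (α : ℂ) / 2))
  /-- `Ψ(z) = 1 + O(1/z)` at infinity. -/
  atInfinity : ∀ i j,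
    (fun z : ℂ => Ψ z i j - (1 : Mat) i j) =O[cobounded ℂ] (fun z : ℂ => z⁻¹)
  /-- `Ψ(z) = O(|z - Eⱼ|^{-1/4})` at each of the endpoints. -/
  growth : ∀ e ∈ endpoints E₁ E₃ ε, ∀ i j,
    (fun z : ℂ => Ψ z i j) =O[𝓝[(closedContour E₁ E₃ ε)ᶜ] e]
      (fun z : ℂ => ‖z - e‖ ^ (-(1 / 4) : ℝ))

/-- The Riemann-Hilbert problem has one and only one solution `Ψ`, the limit of
`-2 z Ψ₁₂(z)` for `z → ∞` exists, and it equals `q`. -/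
def IsTwoPhaseValue (E₁ E₃ : ℂ) (α β ε x t : ℝ) (q : ℂ) : Prop :=
  ∃ Ψ : ℂ → Mat, IsRHSolution E₁ E₃ α β ε x t Ψ ∧
    (∀ Ψ' : ℂ → Mat, IsRHSolution E₁ E₃ α β ε x t Ψ' →
      Set.EqOn Ψ' Ψ (closedContour E₁ E₃ ε)ᶜ) ∧
    Tendsto (fun z : ℂ => -2 * (z * Ψ z 0 1)) (cobounded ℂ) (𝓝 q)

/-- The two-phase solution `q(x, t; ε) = -2 lim_{z → ∞} z Ψ₁₂(z; ε)`. It carries this meaning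
wherever `IsTwoPhaseValue` holds for some value. -/
def twoPhaseSolution (E₁ E₃ : ℂ) (α β ε x t : ℝ) : ℂ :=
  Classical.epsilon (fun q : ℂ => IsTwoPhaseValue E₁ E₃ α β ε x t q)

/-- The plane wave `-A c e^{-iEx + iNt}` with `A = Im E₁`, `E = 2 Re E₁` and
`N = -2 (2 (Re E₁)² - (Im E₁)²)`. -/
def planeWave (E₁ c : ℂ) (x t : ℝ) : ℂ :=
  -((E₁.im : ℂ) * c * Complex.exp (-(Complex.I * ((2 * E₁.re : ℝ) : ℂ) * (x : ℂ)) +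
    Complex.I * ((-2 * (2 * E₁.re ^ 2 - E₁.im ^ 2) : ℝ) : ℂ) * (t : ℂ)))

end TwoPhase

end

/-! As `ε → 0` the arc from `E₂` to `E₃` and its mirror image shrink to points. What remains is a
problem with the cut from `bar E₁` to `E₁` and two constant diagonal jumps, and it is solved
explicitly by `outer`, with `κ = β / (2π)`. There `rot` of a logarithm that jumps by `2πi` across
the cut produces the factor `-iσ₂`. The scalar exponent, assembled from `gTheta` and two copies of
`szegoLog`, has boundary values adding up to `2iθ` on the cut and jumps by `-iβ` on the attached
arcs. The `1/z` coefficient of `outer` is the plane wave, up to a unimodular constant.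

`outer` ignores the short arcs and has powers `(z - E₂)^{±κ}` at their ends. In discs of fixed
radius around `E₃` and `bar E₃` it is therefore replaced by `inner`, built in the same way from the
short cut. On an annulus in each disc `inner = (1 + Δ) * outer`, where `Δ` is `parametrixError`. Its
off-diagonal part, before conjugation by the bounded matrix `frame`, is of size `ε` (the length of
the short arc) times at most `ε^{-2|κ|}` (the power that matches the constants). So `Δ → 0`,
uniformly for `(x, t)` in a compact set, precisely because `|κ| < 1/2`, that is `|β| < π`
(`eventually_norm_mismatch_le`, `exists_bound_frame`).

For small `Δ` the factorization `R = S * (1 + Δ)` on the annuli, with `R` holomorphic outside and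
`S` inside, is obtained from Cauchy integrals over circles and a Neumann series
(`exists_small_norm_solution`). Then `R * outer` outside and `S * inner` inside agree on the annuli
and glue to an exact solution, since left multiplication by holomorphic factors preserves jumps and
growth (`Admissible.isRHSolution_of_parametrices`). No singular integral on the contour itself is
needed. The factor `R` changes the `1/z` coefficient only by `O(Δ)`.

Uniqueness is Liouville's theorem for `Ψ' * adjugate Ψ`: the jumps have determinant one and cancel,
and the singularities of order `-1/2` at the endpoints are removable (`Admissible.eq_const`,
`Admissible.mul_adjugate_eq`). -/

namespace TwoPhase

/-! ### Additive splitting of a holomorphic function on an annulus -/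

/-- The Cauchy integral of `F` over the circle of centre `c` and radius `r`. -/
noncomputable def cauchyInt (c : ℂ) (r : ℝ) (F : ℂ → ℂ) (z : ℂ) : ℂ :=
  (2 * Real.pi * Complex.I : ℂ)⁻¹ • ∮ s in C(c, r), (s - z)⁻¹ * F s

lemma cauchyInt_differentiableOn {c : ℂ} {r : ℝ} (hr : 0 < r) {F : ℂ → ℂ}
    (hF : ContinuousOn F (Metric.sphere c r)) :
    DifferentiableOn ℂ (cauchyInt c r F) (Metric.sphere c r)ᶜ := by
  intro z₀ hz₀
  apply DifferentiableAt.differentiableWithinAt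
  refine DifferentiableAt.const_mul ?_ _
  obtain ⟨δ, hδ, hball⟩ := Metric.isOpen_iff.1 Metric.isClosed_sphere.isOpen_compl z₀ hz₀
  have hmem : ∀ t, circleMap c r t ∈ Metric.sphere c r := fun t => circleMap_mem_sphere c hr.le t
  have hcont : Continuous fun t => F (circleMap c r t) :=
    hF.comp_continuous (continuous_circleMap c r) hmem
  obtain ⟨M, hM⟩ := (isCompact_sphere c r).exists_bound_of_continuousOn hF
  -- Halving the radius keeps the kernel away from its pole uniformly, which gives the constant
  -- dominating function for differentiation under the integral sign.
  have hdist : ∀ x ∈ Metric.ball z₀ (δ / 2), ∀ t, δ / 2 ≤ ‖circleMap c r t - x‖ := by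
    intro x hx t
    by_contra! h
    refine hball (?_ : circleMap c r t ∈ Metric.ball z₀ δ) (hmem t)
    rw [Metric.mem_ball] at hx ⊢
    rw [← dist_eq_norm] at h
    linarith [dist_triangle (circleMap c r t) x z₀]
  have hne : ∀ x ∈ Metric.ball z₀ (δ / 2), ∀ t, circleMap c r t - x ≠ 0 := by
    intro x hx t h
    have := hdist x hx t
    rw [h, norm_zero] at this
    linarith
  have hz₀b : z₀ ∈ Metric.ball z₀ (δ / 2) := Metric.mem_ball_self (by linarith)
  have hcd : Continuous fun t => deriv (circleMap c r) t := by
    simp only [deriv_circleMap]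
    exact (continuous_circleMap 0 r).mul continuous_const
  have hc1 : ∀ x ∈ Metric.ball z₀ (δ / 2),
      Continuous fun t => deriv (circleMap c r) t • ((circleMap c r t - x)⁻¹ * F (circleMap c r t))
      :=
    fun x hx => hcd.smul ((((continuous_circleMap c r).sub continuous_const).inv₀
      (hne x hx)).mul hcont)
  have key := intervalIntegral.hasDerivAt_integral_of_dominated_loc_of_deriv_le
    (μ := MeasureTheory.volume) (a := 0) (b := 2 * Real.pi)
    (F := fun x t => deriv (circleMap c r) t • ((circleMap c r t - x)⁻¹ * F (circleMap c r t)))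
    (F' := fun x t => deriv (circleMap c r) t •
      (((circleMap c r t - x) ^ 2)⁻¹ * F (circleMap c r t)))
    (x₀ := z₀) (s := Metric.ball z₀ (δ / 2)) (bound := fun _ => r * (((δ / 2) ^ 2)⁻¹ * M))
    (Metric.ball_mem_nhds _ (by linarith))
    (by
      filter_upwards [Metric.ball_mem_nhds z₀ (by linarith : (0 : ℝ) < δ / 2)] with x hx
      exact (hc1 x hx).aestronglyMeasurable)
    ((hc1 z₀ hz₀b).intervalIntegrable _ _)
    (by
      apply Continuous.aestronglyMeasurable
      exact hcd.smul (((((continuous_circleMap c r).sub continuous_const).pow 2).inv₀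
        (fun t => pow_ne_zero 2 (hne z₀ hz₀b t))).mul hcont))
    (by
      refine Filter.Eventually.of_forall fun t _ x hx => ?_
      rw [norm_smul, norm_mul, norm_inv, norm_pow, deriv_circleMap, norm_mul, norm_circleMap_zero,
        Complex.norm_I, mul_one, abs_of_pos hr]
      have h1 := hdist x hx t
      have h2 := hM _ (hmem t)
      gcongr)
    (by simp)
    (by
      refine Filter.Eventually.of_forall fun t _ x hx => ?_
      have h1 : HasDerivAt (fun x : ℂ => circleMap c r t - x) (-1) x := by
        simpa using (hasDerivAt_id x).const_sub (circleMap c r t)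
      have h2 := ((h1.inv (hne x hx t)).mul_const (F (circleMap c r t))).const_smul
        (deriv (circleMap c r) t)
      rw [neg_neg, one_div] at h2
      exact h2)
  exact key.2.differentiableAt

lemma norm_cauchyInt_le {c : ℂ} {r M d : ℝ} (hr : 0 ≤ r) (hd : 0 < d) {F : ℂ → ℂ} {z : ℂ}
    (hF : ∀ s ∈ Metric.sphere c r, ‖F s‖ ≤ M) (hz : ∀ s ∈ Metric.sphere c r, d ≤ ‖s - z‖) :
    ‖cauchyInt c r F z‖ ≤ r * (d⁻¹ * M) := by
  apply circleIntegral.norm_two_pi_i_inv_smul_integral_le_of_norm_le_const hr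
  intro s hs
  rw [norm_mul, norm_inv]
  have h1 := hF s hs
  have h2 := hz s hs
  gcongr

/-- Cauchy's theorem on the annulus is applied to `dslope F z`, which has no pole at `z`. The term
`F z` appears because the integral of `(s - z)⁻¹` is `2πi` over the outer circle and `0` over the
inner one. -/
lemma cauchyInt_sub_cauchyInt {c : ℂ} {r₁ r₂ : ℝ} (h₁ : 0 < r₁) {F : ℂ → ℂ} {U : Set ℂ}
    (hU : IsOpen U) (hF : DifferentiableOn ℂ F U)
    (hsub : Metric.closedBall c r₂ \ Metric.ball c r₁ ⊆ U) {z : ℂ}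
    (hz₁ : r₁ < ‖z - c‖) (hz₂ : ‖z - c‖ < r₂) :
    cauchyInt c r₂ F z - cauchyInt c r₁ F z = F z := by
  have h12 : r₁ ≤ r₂ := by linarith
  have hs1 : Metric.sphere c r₁ ⊆ U := fun s hs => hsub (by
    rw [mem_sphere_iff_norm] at hs
    simp [Metric.mem_closedBall, dist_eq_norm, hs, h12])
  have hs2 : Metric.sphere c r₂ ⊆ U := fun s hs => hsub (by
    rw [mem_sphere_iff_norm] at hs
    simp [Metric.mem_closedBall, dist_eq_norm, hs, h12])
  have hne1 : ∀ s ∈ Metric.sphere c r₁, s ≠ z := by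
    rintro s hs rfl
    rw [mem_sphere_iff_norm] at hs; linarith
  have hne2 : ∀ s ∈ Metric.sphere c r₂, s ≠ z := by
    rintro s hs rfl
    rw [mem_sphere_iff_norm] at hs; linarith
  have hzU : z ∈ U := hsub (by simp [dist_eq_norm, hz₁.le, hz₂.le])
  have hds : DifferentiableOn ℂ (dslope F z) U :=
    (Complex.differentiableOn_dslope (hU.mem_nhds hzU)).2 hF
  have heq := Complex.circleIntegral_eq_of_differentiable_on_annulus_off_countable h₁ h12
    (f := dslope F z) (s := ∅) Set.countable_empty (hds.continuousOn.mono hsub) (by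
      intro w hw
      refine hds.differentiableAt (hU.mem_nhds (hsub ?_))
      exact ⟨Metric.ball_subset_closedBall hw.1.1, fun h => hw.1.2 (Metric.ball_subset_closedBall
        h)⟩)
  have hsplit : ∀ r, 0 < r → Metric.sphere c r ⊆ U → (∀ s ∈ Metric.sphere c r, s ≠ z) →
      (∮ s in C(c, r), dslope F z s) =
        (∮ s in C(c, r), (s - z)⁻¹ * F s) - (∮ s in C(c, r), (s - z)⁻¹) * F z := by
    intro r hr hs hne
    have hi : ContinuousOn (fun s => (s - z)⁻¹) (Metric.sphere c r) :=
      (continuousOn_id.sub continuousOn_const).inv₀ fun s hs' => sub_ne_zero.2 (hne s hs')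
    rw [← smul_eq_mul (∮ s in C(c, r), (s - z)⁻¹), ← circleIntegral.integral_smul_const,
      ← circleIntegral.integral_sub]
    · refine circleIntegral.integral_congr hr.le fun s hs' => ?_
      simp only [dslope_of_ne _ (hne s hs'), slope, vsub_eq_sub, smul_eq_mul]
      ring
    · exact (hi.mul (hF.continuousOn.mono hs)).circleIntegrable hr.le
    · exact (hi.smul continuousOn_const).circleIntegrable hr.le
  rw [hsplit r₂ (h₁.trans_le h12) hs2 hne2, hsplit r₁ h₁ hs1 hne1,
    circleIntegral.integral_sub_inv_of_mem_ball (by simpa [dist_eq_norm] using hz₂)] at heq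
  have h0 : (∮ s in C(c, r₁), (s - z)⁻¹) = 0 := by
    refine Complex.circleIntegral_eq_zero_of_differentiable_on_off_countable h₁.le
      Set.countable_empty ?_ ?_
    · refine (continuousOn_id.sub continuousOn_const).inv₀ fun s hs h => ?_
      rw [sub_eq_zero.1 (show s - z = 0 from h), mem_closedBall_iff_norm] at hs
      linarith
    · intro s hs
      refine (differentiableAt_id.sub_const z).inv fun h => ?_
      have hs' := hs.1
      rw [sub_eq_zero.1 (show s - z = 0 from h), mem_ball_iff_norm] at hs'
      linarith
  rw [h0, zero_mul, sub_zero] at heq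
  unfold cauchyInt
  rw [← heq, smul_eq_mul, smul_eq_mul]
  field_simp
  ring

/-- The open annulus `ρ₁ < |z - c| < ρ₂`. -/
def annulus (c : ℂ) (ρ₁ ρ₂ : ℝ) : Set ℂ := {z | ρ₁ < ‖z - c‖ ∧ ‖z - c‖ < ρ₂}

lemma isOpen_lt_norm_sub (c : ℂ) (ρ : ℝ) : IsOpen {z : ℂ | ρ < ‖z - c‖} :=
  isOpen_lt continuous_const (by fun_prop)

lemma isOpen_norm_sub_lt (c : ℂ) (ρ : ℝ) : IsOpen {z : ℂ | ‖z - c‖ < ρ} :=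
  isOpen_lt (by fun_prop) continuous_const

lemma isOpen_annulus (c : ℂ) (ρ₁ ρ₂ : ℝ) : IsOpen (annulus c ρ₁ ρ₂) :=
  (isOpen_lt_norm_sub c ρ₁).inter (isOpen_norm_sub_lt c ρ₂)

/-- A holomorphic function on an annulus is the difference of a function holomorphic outside and a
function holomorphic inside, with sup norms controlled up to the boundary. -/
lemma exists_splitting (c : ℂ) {ρ₁ ρ₂ : ℝ} (h₁ : 0 < ρ₁) (h₂ : ρ₁ < ρ₂) :
    ∃ C : ℝ, 0 < C ∧ ∀ F : ℂ → ℂ, DifferentiableOn ℂ F (annulus c ρ₁ ρ₂) → ∃ G H : ℂ → ℂ,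
      DifferentiableOn ℂ G {z | ρ₁ < ‖z - c‖} ∧ DifferentiableOn ℂ H {z | ‖z - c‖ < ρ₂} ∧
      (∀ z ∈ annulus c ρ₁ ρ₂, F z = G z - H z) ∧
      ∀ M, (∀ z ∈ annulus c ρ₁ ρ₂, ‖F z‖ ≤ M) →
        (∀ z, ρ₁ < ‖z - c‖ → ‖G z‖ ≤ C * M * ‖z - c‖⁻¹) ∧
        ∀ z, ‖z - c‖ < ρ₂ → ‖H z‖ ≤ C * M := by
  -- With a quarter of the width, `r₁ + l = r₂ - l` is the middle radius. Every point is then at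
  -- distance at least `l` from one of the two circles, so one of the two formulas for `G` (or `H`)
  -- is always safe to estimate.
  obtain ⟨l, hl⟩ : ∃ l, l = (ρ₂ - ρ₁) / 4 := ⟨_, rfl⟩
  have hl0 : 0 < l := by linarith
  have hρ₂ : 0 < ρ₂ := h₁.trans h₂
  refine ⟨(ρ₂ + 1) * (1 + ρ₂ * l⁻¹), by positivity, fun F hF => ?_⟩
  obtain ⟨r₁, hr₁⟩ : ∃ r₁, r₁ = ρ₁ + l := ⟨_, rfl⟩
  obtain ⟨r₂, hr₂⟩ : ∃ r₂, r₂ = ρ₂ - l := ⟨_, rfl⟩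
  have hsub : Metric.closedBall c r₂ \ Metric.ball c r₁ ⊆ annulus c ρ₁ ρ₂ := by
    intro z hz
    simp only [Set.mem_sdiff, Metric.mem_closedBall, Metric.mem_ball, dist_eq_norm, not_lt] at hz
    exact ⟨by linarith, by linarith⟩
  have hs1 : Metric.sphere c r₁ ⊆ annulus c ρ₁ ρ₂ := by
    intro z hz
    rw [mem_sphere_iff_norm] at hz
    exact ⟨by linarith, by linarith⟩
  have hs2 : Metric.sphere c r₂ ⊆ annulus c ρ₁ ρ₂ := by
    intro z hz
    rw [mem_sphere_iff_norm] at hz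
    exact ⟨by linarith, by linarith⟩
  have hr₁0 : 0 < r₁ := by linarith
  have hr₂0 : 0 < r₂ := by linarith
  have hrep : ∀ z, r₁ < ‖z - c‖ → ‖z - c‖ < r₂ →
      cauchyInt c r₂ F z - cauchyInt c r₁ F z = F z := fun z hz1 hz2 =>
    cauchyInt_sub_cauchyInt hr₁0 (isOpen_annulus c ρ₁ ρ₂) hF hsub hz1 hz2
  have hd1 := cauchyInt_differentiableOn hr₁0 (hF.continuousOn.mono hs1)
  have hd2 := cauchyInt_differentiableOn hr₂0 (hF.continuousOn.mono hs2)
  have hd1' : ∀ z, r₁ < ‖z - c‖ → DifferentiableAt ℂ (cauchyInt c r₁ F) z := fun z hz =>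
    hd1.differentiableAt (Metric.isClosed_sphere.isOpen_compl.mem_nhds (by
      simp [hz.ne']))
  have hd2' : ∀ z, ‖z - c‖ < r₂ → DifferentiableAt ℂ (cauchyInt c r₂ F) z := fun z hz =>
    hd2.differentiableAt (Metric.isClosed_sphere.isOpen_compl.mem_nhds (by
      simp [hz.ne]))
  have hF' : ∀ z, ρ₁ < ‖z - c‖ → ‖z - c‖ < ρ₂ → DifferentiableAt ℂ F z := fun z hz hz' =>
    hF.differentiableAt ((isOpen_annulus c ρ₁ ρ₂).mem_nhds ⟨hz, hz'⟩)
  -- Each function is a Cauchy integral continued across its own circle by means of the other one.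
  -- The two formulas agree between the circles by `hrep`.
  refine ⟨fun z => if r₁ < ‖z - c‖ then -cauchyInt c r₁ F z else F z - cauchyInt c r₂ F z,
    fun z => if ‖z - c‖ < r₂ then -cauchyInt c r₂ F z else -cauchyInt c r₁ F z - F z,
    ?_, ?_, ?_, ?_⟩
  · intro z hz
    apply DifferentiableAt.differentiableWithinAt
    by_cases h : r₁ < ‖z - c‖
    · refine (hd1' z h).neg.congr_of_eventuallyEq ?_
      filter_upwards [(isOpen_lt_norm_sub c r₁).mem_nhds h] with w hw
      exact if_pos hw
    · have h' : ‖z - c‖ < r₂ := by linarith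
      refine ((hF' z hz (by linarith)).sub (hd2' z h')).congr_of_eventuallyEq ?_
      filter_upwards [(isOpen_norm_sub_lt c r₂).mem_nhds h'] with w hw
      split_ifs with hw'
      · simp only [Pi.sub_apply, ← hrep w hw' hw]; ring
      · rfl
  · intro z hz
    apply DifferentiableAt.differentiableWithinAt
    by_cases h : ‖z - c‖ < r₂
    · refine (hd2' z h).neg.congr_of_eventuallyEq ?_
      filter_upwards [(isOpen_norm_sub_lt c r₂).mem_nhds h] with w hw
      exact if_pos hw
    · have h' : r₁ < ‖z - c‖ := by linarith
      refine ((hd1' z h').neg.sub (hF' z (by linarith) hz)).congr_of_eventuallyEq ?_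
      filter_upwards [(isOpen_lt_norm_sub c r₁).mem_nhds h'] with w hw
      split_ifs with hw'
      · simp only [Pi.sub_apply, Pi.neg_apply, ← hrep w hw hw']; ring
      · rfl
  · intro z hz
    by_cases h1 : r₁ < ‖z - c‖ <;> by_cases h2 : ‖z - c‖ < r₂
    · simp only [h1, h2, if_true, ← hrep z h1 h2]; ring
    · simp only [h1, h2, if_true, if_false]; ring
    · simp only [h1, h2, if_true, if_false]; ring
    · linarith
  · intro M hM
    have hM0 : 0 ≤ M := (norm_nonneg _).trans (hM (c + r₁) (hs1 (by simp [hr₁0.le])))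
    have hdist : ∀ r, ∀ z, ∀ s ∈ Metric.sphere c r, |r - ‖z - c‖| ≤ ‖s - z‖ := by
      intro r z s hs
      rw [mem_sphere_iff_norm] at hs
      rw [← hs]
      simpa using abs_norm_sub_norm_le (s - c) (z - c)
    have hb1 : ∀ z, r₁ + l ≤ ‖z - c‖ → ‖cauchyInt c r₁ F z‖ ≤ r₁ * ((‖z - c‖ - r₁)⁻¹ * M) :=
      fun z hz => norm_cauchyInt_le hr₁0.le (by linarith) (fun s hs => hM s (hs1 hs))
        fun s hs => le_trans (by rw [abs_sub_comm]; exact le_abs_self _) (hdist r₁ z s hs)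
    have hb2 : ∀ z, ‖z - c‖ ≤ r₂ - l → ‖cauchyInt c r₂ F z‖ ≤ r₂ * (l⁻¹ * M) :=
      fun z hz => norm_cauchyInt_le hr₂0.le hl0 (fun s hs => hM s (hs2 hs))
        fun s hs => le_trans (le_trans (by linarith) (le_abs_self _)) (hdist r₂ z s hs)
    have hil : 0 < l⁻¹ := inv_pos.2 hl0
    constructor
    · intro z hz
      have hz0 : 0 < ‖z - c‖ := h₁.trans hz
      rw [← div_eq_mul_inv, le_div_iff₀ hz0]
      by_cases h : r₁ + l ≤ ‖z - c‖
      · simp only [show r₁ < ‖z - c‖ by linarith, if_true, norm_neg]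
        have h3 : (‖z - c‖ - r₁)⁻¹ * ‖z - c‖ ≤ ρ₂ * l⁻¹ := by
          rw [inv_mul_eq_div, ← div_eq_mul_inv, div_le_div_iff₀ (by linarith) hl0]
          nlinarith
        have h5 : 0 ≤ (‖z - c‖ - r₁)⁻¹ := inv_nonneg.2 (by linarith)
        calc ‖cauchyInt c r₁ F z‖ * ‖z - c‖ ≤ r₁ * ((‖z - c‖ - r₁)⁻¹ * M) * ‖z - c‖ := by
              gcongr; exact hb1 z h
          _ = r₁ * M * ((‖z - c‖ - r₁)⁻¹ * ‖z - c‖) := by ring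
          _ ≤ ρ₂ * M * (ρ₂ * l⁻¹) := by
              refine mul_le_mul ?_ h3 (by positivity) (by positivity)
              gcongr; linarith
          _ ≤ (ρ₂ + 1) * M * (1 + ρ₂ * l⁻¹) := by gcongr <;> linarith
          _ = _ := by ring
      · have h' : ‖z - c‖ ≤ r₂ - l := by linarith
        have hval : (if r₁ < ‖z - c‖ then -cauchyInt c r₁ F z else F z - cauchyInt c r₂ F z) =
            F z - cauchyInt c r₂ F z := by
          split_ifs with hw
          · rw [← hrep z hw (by linarith)]; ring
          · rfl
        simp only [hval]
        have h4 : ‖F z - cauchyInt c r₂ F z‖ ≤ M + ρ₂ * (l⁻¹ * M) :=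
          (norm_sub_le _ _).trans (add_le_add (hM z ⟨hz, by linarith⟩)
            ((hb2 z h').trans (by gcongr; linarith)))
        calc _ ≤ (M + ρ₂ * (l⁻¹ * M)) * (ρ₂ + 1) := by gcongr; linarith
          _ = _ := by ring
    · intro z hz
      by_cases h : ‖z - c‖ ≤ r₂ - l
      · simp only [show ‖z - c‖ < r₂ by linarith, if_true, norm_neg]
        calc _ ≤ r₂ * (l⁻¹ * M) := hb2 z h
          _ ≤ 1 * (0 + ρ₂ * (l⁻¹)) * M := by
            rw [one_mul, zero_add, ← mul_assoc]; gcongr; linarith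
          _ ≤ _ := by gcongr <;> linarith
      · have h' : r₁ + l ≤ ‖z - c‖ := by linarith
        have hval : (if ‖z - c‖ < r₂ then -cauchyInt c r₂ F z else -cauchyInt c r₁ F z - F z) =
            -cauchyInt c r₁ F z - F z := by
          split_ifs with hw
          · rw [← hrep z (by linarith) hw]; ring
          · rfl
        simp only [hval]
        have h4 : ‖-cauchyInt c r₁ F z - F z‖ ≤ ρ₂ * (l⁻¹ * M) + M := by
          refine (norm_sub_le _ _).trans (add_le_add ?_ (hM z ⟨by linarith, hz⟩))
          rw [norm_neg]
          have h5 : 0 ≤ (‖z - c‖ - r₁)⁻¹ := inv_nonneg.2 (by linarith)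
          refine (hb1 z h').trans (mul_le_mul (by linarith) ?_ (by positivity) hρ₂.le)
          gcongr
          linarith
        calc _ ≤ _ := h4
          _ = 1 * (1 + ρ₂ * l⁻¹) * M := by ring
          _ ≤ _ := by gcongr; linarith

/-- Additive splitting relative to finitely many disjoint discs. -/
lemma exists_splitting_family {ι : Type} [Fintype ι] [DecidableEq ι] (c : ι → ℂ) {ρ₁ ρ₂ : ℝ}
    (h₁ : 0 < ρ₁) (h₂ : ρ₁ < ρ₂)
    (hsep : ∀ j k, j ≠ k → ∀ z, ‖z - c j‖ < ρ₂ → ρ₂ ≤ ‖z - c k‖) :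
    ∃ C : ℝ, 0 < C ∧ ∀ F : ι → ℂ → ℂ, ∃ (G : ℂ → ℂ) (H : ι → ℂ → ℂ),
      (∀ j, DifferentiableOn ℂ (F j) (annulus (c j) ρ₁ ρ₂)) →
      DifferentiableOn ℂ G {z | ∀ j, ρ₁ < ‖z - c j‖} ∧
      (∀ j, DifferentiableOn ℂ (H j) {z | ‖z - c j‖ < ρ₂}) ∧
      (∀ j, ∀ z ∈ annulus (c j) ρ₁ ρ₂, F j z = G z - H j z) ∧
      ∀ M, (∀ j, ∀ z ∈ annulus (c j) ρ₁ ρ₂, ‖F j z‖ ≤ M) →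
        (∀ z, (∀ j, ρ₁ < ‖z - c j‖) → ‖G z‖ ≤ C * M * ∑ j, ‖z - c j‖⁻¹) ∧
        ∀ j z, ‖z - c j‖ < ρ₂ → ‖H j z‖ ≤ C * M := by
  choose C hC hsplit using fun j => exists_splitting (c j) h₁ h₂
  have hρ₂ : 0 < ρ₂ := h₁.trans h₂
  have hCle : ∀ j, C j ≤ ∑ k, C k := fun j =>
    Finset.single_le_sum (fun k _ => (hC k).le) (Finset.mem_univ j)
  have hCs : 0 ≤ ∑ k, C k := Finset.sum_nonneg fun k _ => (hC k).le
  -- The term with `ρ₂⁻¹` pays for the exterior parts of the other discs, estimated at distance at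
  -- least `ρ₂` from their centres. The last `1` keeps the constant positive when there are no
  -- discs.
  refine ⟨(∑ j, C j) * (1 + ρ₂⁻¹) + 1, by positivity, fun F => ?_⟩
  by_cases hF : ∀ j, DifferentiableOn ℂ (F j) (annulus (c j) ρ₁ ρ₂)
  swap
  -- The existential precedes the differentiability hypothesis so that `G` and `H` can later be
  -- chosen as operators on arbitrary families. Zero is the default value.
  · exact ⟨0, 0, fun h => absurd h hF⟩
  choose G H hG hH hGH hb using fun j => hsplit j (F j) (hF j)
  -- Inside disc `j` the exterior parts belonging to the other discs are holomorphic and are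
  -- absorbed into `H j`.
  refine ⟨fun z => ∑ j, G j z, fun j z => H j z + ∑ k ∈ Finset.univ.erase j, G k z,
    fun _ => ⟨?_, ?_, ?_, ?_⟩⟩
  · exact DifferentiableOn.fun_sum fun j _ => (hG j).mono fun z hz => hz j
  · refine fun j => (hH j).add (DifferentiableOn.fun_sum fun k hk => (hG k).mono fun z hz => ?_)
    exact h₂.trans_le (hsep j k (Finset.ne_of_mem_erase hk).symm z hz)
  · intro j z hz
    simp only
    rw [hGH j z hz, ← Finset.add_sum_erase _ _ (Finset.mem_univ j)]
    ring
  · intro M hM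
    rcases isEmpty_or_nonempty ι with hι | ⟨⟨j₀⟩⟩
    · simp
    have hM0 : 0 ≤ M := (norm_nonneg _).trans (hM j₀ (c j₀ + ((ρ₁ + ρ₂) / 2 : ℝ)) (by
      have : ‖c j₀ + (((ρ₁ + ρ₂) / 2 : ℝ) : ℂ) - c j₀‖ = (ρ₁ + ρ₂) / 2 := by
        rw [add_sub_cancel_left, Complex.norm_real, Real.norm_of_nonneg (by linarith)]
      exact ⟨by rw [this]; linarith, by rw [this]; linarith⟩))
    have hρi : 0 < ρ₂⁻¹ := inv_pos.2 hρ₂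
    constructor
    · intro z hz
      rw [Finset.mul_sum]
      refine norm_sum_le_of_le _ fun j _ => ((hb j M (hM j)).1 z (hz j)).trans ?_
      have := hCle j
      gcongr
      nlinarith
    · intro j z hz
      refine (norm_add_le _ _).trans ?_
      have e1 : ‖H j z‖ ≤ (∑ k, C k) * M :=
        ((hb j M (hM j)).2 z hz).trans (by gcongr; exact hCle j)
      have e2 : ‖∑ k ∈ Finset.univ.erase j, G k z‖ ≤ (∑ k, C k) * ρ₂⁻¹ * M := by
        refine (norm_sum_le_of_le (f := fun k => G k z) (n := fun k => C k * ρ₂⁻¹ * M) _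
          fun k hk => ?_).trans ?_
        · have h3 := hsep j k (Finset.ne_of_mem_erase hk).symm z hz
          refine ((hb k M (hM k)).1 z (h₂.trans_le h3)).trans ?_
          have := (hC k).le
          rw [mul_right_comm]
          gcongr
        · rw [← Finset.sum_mul, ← Finset.sum_mul]
          gcongr
          · exact fun k _ _ => (hC k).le
          · exact Finset.subset_univ _
      nlinarith

/-- Solvability of a multiplicative splitting problem with jump `1 + Δ`, `Δ` small, on finitely many
annuli. -/
theorem exists_small_norm_solution {ι : Type} [Fintype ι] [DecidableEq ι] (c : ι → ℂ)
    {ρ₁ ρ₂ : ℝ} (h₁ : 0 < ρ₁) (h₂ : ρ₁ < ρ₂)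
    (hsep : ∀ j k, j ≠ k → ∀ z, ‖z - c j‖ < ρ₂ → ρ₂ ≤ ‖z - c k‖) :
    ∃ C δ₀ : ℝ, 0 < C ∧ 0 < δ₀ ∧ ∀ (δ : ℝ) (Δ : ι → ℂ → Mat), 0 ≤ δ → δ ≤ δ₀ →
      (∀ j a b, DifferentiableOn ℂ (fun z => Δ j z a b) (annulus (c j) ρ₁ ρ₂)) →
      (∀ j a b, ∀ z ∈ annulus (c j) ρ₁ ρ₂, ‖Δ j z a b‖ ≤ δ) →
      ∃ (R : ℂ → Mat) (S : ι → ℂ → Mat),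
        (∀ a b, DifferentiableOn ℂ (fun z => R z a b) {z | ∀ j, ρ₁ < ‖z - c j‖}) ∧
        (∀ j a b, DifferentiableOn ℂ (fun z => S j z a b) {z | ‖z - c j‖ < ρ₂}) ∧
        (∀ j, ∀ z ∈ annulus (c j) ρ₁ ρ₂, R z = S j z * (1 + Δ j z)) ∧
        ∀ z, (∀ j, ρ₁ < ‖z - c j‖) → ∀ a b,
          ‖R z a b - (1 : Mat) a b‖ ≤ C * δ * ∑ j, ‖z - c j‖⁻¹ := by
  obtain ⟨C, hC, hsplit⟩ := exists_splitting_family c h₁ h₂ hsep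
  choose G H hGH using hsplit
  -- With `C * δ ≤ 1/4` and a factor `2` from the matrix product, each iteration gains `1/2`.
  -- Summing the geometric series gives `2 * C`.
  refine ⟨2 * C, (4 * C)⁻¹, by positivity, by positivity, fun δ Δ hδ hδ₀ hΔ hΔb => ?_⟩
  -- Neumann series: `F (n + 1) = H (F n) * Δ`. For `R = 1 + ∑ G (F n)` and `S = 1 + ∑ H (F n)` one
  -- gets `S * (1 + Δ) = S + ∑ F n = R`.
  let F : ℕ → Fin 2 → Fin 2 → ι → ℂ → ℂ := fun n => Nat.rec (fun a b j z => Δ j z a b)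
    (fun _ f a b j z => ∑ k, H (f a k) j z * Δ j z k b) n
  have hF0 : ∀ a b j z, F 0 a b j z = Δ j z a b := fun _ _ _ _ => rfl
  have hFs : ∀ n a b j z, F (n + 1) a b j z = ∑ k, H (F n a k) j z * Δ j z k b :=
    fun _ _ _ _ _ => rfl
  have hann1 : ∀ j, annulus (c j) ρ₁ ρ₂ ⊆ {z | ‖z - c j‖ < ρ₂} := fun j z hz => hz.2
  have hann2 : ∀ j, annulus (c j) ρ₁ ρ₂ ⊆ {z | ∀ k, ρ₁ < ‖z - c k‖} := by
    intro j z hz k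
    by_cases hjk : j = k
    · exact hjk ▸ hz.1
    · exact h₂.trans_le (hsep j k hjk z hz.2)
  have hFd : ∀ n a b j, DifferentiableOn ℂ (F n a b j) (annulus (c j) ρ₁ ρ₂) := by
    intro n
    induction n with
    | zero => exact fun a b j => hΔ j a b
    | succ n ih =>
      intro a b j
      have : F (n + 1) a b j = fun z => ∑ k, H (F n a k) j z * Δ j z k b := by
        ext z; exact hFs n a b j z
      rw [this]
      exact DifferentiableOn.fun_sum fun k _ =>
        (((hGH (F n a k) (ih a k)).2.1 j).mono (hann1 j)).mul (hΔ j k b)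
  have hq : C * δ ≤ 1 / 4 := by
    calc C * δ ≤ C * (4 * C)⁻¹ := by gcongr
      _ = 1 / 4 := by field_simp
  have hFb : ∀ n a b j, ∀ z ∈ annulus (c j) ρ₁ ρ₂, ‖F n a b j z‖ ≤ δ * (1 / 2) ^ n := by
    intro n
    induction n with
    | zero => intro a b j z hz; rw [hF0]; simpa using hΔb j a b z hz
    | succ n ih =>
      intro a b j z hz
      rw [hFs]
      have hH : ∀ k, ‖H (F n a k) j z‖ ≤ C * (δ * (1 / 2) ^ n) := fun k =>
        ((hGH (F n a k) (hFd n a k)).2.2.2 _ (ih a k)).2 j z hz.2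
      calc ‖∑ k, H (F n a k) j z * Δ j z k b‖
          ≤ ∑ k : Fin 2, (C * (δ * (1 / 2) ^ n)) * δ := by
            refine norm_sum_le_of_le _ fun k _ => ?_
            rw [norm_mul]
            exact mul_le_mul (hH k) (hΔb j k b z hz) (norm_nonneg _) (by positivity)
        _ = 2 * (C * δ) * (δ * (1 / 2) ^ n) := by
            rw [Finset.sum_const, Finset.card_univ, Fintype.card_fin]; ring
        _ ≤ 2 * (1 / 4) * (δ * (1 / 2) ^ n) := by gcongr
        _ = δ * (1 / 2) ^ (n + 1) := by ring
  have hGd : ∀ n a b, DifferentiableOn ℂ (G (F n a b)) {z | ∀ j, ρ₁ < ‖z - c j‖} :=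
    fun n a b => (hGH _ (hFd n a b)).1
  have hHd : ∀ n a b j, DifferentiableOn ℂ (H (F n a b) j) {z | ‖z - c j‖ < ρ₂} :=
    fun n a b => (hGH _ (hFd n a b)).2.1
  have hGb : ∀ n a b z, (∀ j, ρ₁ < ‖z - c j‖) →
      ‖G (F n a b) z‖ ≤ (C * δ * ∑ j, ‖z - c j‖⁻¹) * (1 / 2) ^ n := by
    intro n a b z hz
    refine (((hGH _ (hFd n a b)).2.2.2 _ (hFb n a b)).1 z hz).trans (le_of_eq ?_)
    ring
  have hHb : ∀ n a b j z, ‖z - c j‖ < ρ₂ → ‖H (F n a b) j z‖ ≤ (C * δ) * (1 / 2) ^ n := by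
    intro n a b j z hz
    refine (((hGH _ (hFd n a b)).2.2.2 _ (hFb n a b)).2 j z hz).trans (le_of_eq ?_)
    ring
  have hgeo : Summable fun n : ℕ => ((1 : ℝ) / 2) ^ n := summable_geometric_two
  have hsH : ∀ a b j z, ‖z - c j‖ < ρ₂ → Summable fun n => H (F n a b) j z :=
    fun a b j z hz => (hgeo.mul_left _).of_norm_bounded fun n => hHb n a b j z hz
  have hopen : IsOpen {z | ∀ j, ρ₁ < ‖z - c j‖} := by
    rw [Set.ofPred_forall]
    exact isOpen_iInter_of_finite fun j => isOpen_lt_norm_sub (c j) ρ₁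
  refine ⟨fun z => Matrix.of fun a b => (1 : Mat) a b + ∑' n, G (F n a b) z,
    fun j z => Matrix.of fun a b => (1 : Mat) a b + ∑' n, H (F n a b) j z, ?_, ?_, ?_, ?_⟩
  · intro a b
    refine (DifferentiableOn.add (differentiableOn_const _)
      (Complex.differentiableOn_tsum_of_summable_norm
        (u := fun n => (C * δ * ∑ j : ι, ρ₁⁻¹) * (1 / 2) ^ n) (hgeo.mul_left _)
        (fun n => hGd n a b) hopen fun n z hz => (hGb n a b z hz).trans ?_))
    have : ∑ j, ‖z - c j‖⁻¹ ≤ ∑ j : ι, ρ₁⁻¹ :=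
      Finset.sum_le_sum fun j _ => inv_anti₀ h₁ (hz j).le
    gcongr
  · intro j a b
    exact DifferentiableOn.add (differentiableOn_const _)
      (Complex.differentiableOn_tsum_of_summable_norm (hgeo.mul_left (C * δ))
        (fun n => hHd n a b j) (isOpen_norm_sub_lt (c j) ρ₂) fun n z hz => hHb n a b j z hz)
  · intro j z hz
    ext a b
    have hz1 := hann1 j hz
    have hz2 := hann2 j hz
    have hFG : ∀ n, G (F n a b) z = H (F n a b) j z + F n a b j z := fun n => by
      rw [(hGH _ (hFd n a b)).2.2.1 j z hz]; ring
    have hsF : Summable fun n => F n a b j z :=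
      (hgeo.mul_left δ).of_norm_bounded fun n => hFb n a b j z hz
    have e1 : ∑' n, G (F n a b) z = ∑' n, H (F n a b) j z + ∑' n, F n a b j z := by
      rw [← (hsH a b j z hz1).tsum_add hsF]
      exact tsum_congr hFG
    have e2 : ∑' n, F n a b j z = Δ j z a b + ∑ k, (∑' n, H (F n a k) j z) * Δ j z k b := by
      rw [hsF.tsum_eq_zero_add, hF0]
      congr 1
      simp only [hFs]
      rw [Summable.tsum_finsetSum fun k _ => (hsH a k j z hz1).mul_right _]
      exact Finset.sum_congr rfl fun k _ => tsum_mul_right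
    rw [mul_add, mul_one]
    simp only [Matrix.add_apply, Matrix.mul_apply, Matrix.of_apply, add_mul,
      Finset.sum_add_distrib, e1, e2]
    have e3 : ∑ k, (1 : Mat) a k * Δ j z k b = Δ j z a b := by
      rw [← Matrix.mul_apply, one_mul]
    rw [e3]; ring
  · intro z hz a b
    simp only [Matrix.of_apply, add_sub_cancel_left]
    refine (tsum_of_norm_bounded (hgeo.mul_left _).hasSum fun n => hGb n a b z hz).trans
      (le_of_eq ?_)
    rw [tsum_mul_left, tsum_geometric_two]
    ring

/-! ### Removability of segments -/

/-- Morera's theorem. A rectangle meeting the real axis is cut along it. Cauchy's theorem holds for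
both halves, since it needs holomorphy only in the interior and continuity up to the boundary. -/
lemma differentiableOn_ball_of_off_real {g : ℂ → ℂ} {c : ℂ} {r : ℝ}
    (hc : ContinuousOn g (Metric.ball c r))
    (hd : ∀ z ∈ Metric.ball c r, z.im ≠ 0 → DifferentiableAt ℂ g z) :
    DifferentiableOn ℂ g (Metric.ball c r) := by
  refine (Complex.isConservativeOn_and_continuousOn_iff_isDifferentiableOn Metric.isOpen_ball).1
    ⟨fun z w hzw => ?_, hc⟩
  rw [← add_eq_zero_iff_eq_neg, Complex.wedgeIntegral_add_wedgeIntegral_eq]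
  have hzw' : Set.uIcc z.re w.re ×ℂ Set.uIcc z.im w.im ⊆ Metric.ball c r := hzw
  by_cases h0 : (0 : ℝ) ∈ Set.uIcc z.im w.im
  · have hs1 : Set.uIcc z.im 0 ⊆ Set.uIcc z.im w.im := Set.uIcc_subset_uIcc_left h0
    have hs2 : Set.uIcc 0 w.im ⊆ Set.uIcc z.im w.im := Set.uIcc_subset_uIcc_right h0
    have sub1 : Set.uIcc z.re w.re ×ℂ Set.uIcc z.im 0 ⊆ Metric.ball c r :=
      fun u hu => hzw' ⟨hu.1, hs1 hu.2⟩
    have sub2 : Set.uIcc z.re w.re ×ℂ Set.uIcc 0 w.im ⊆ Metric.ball c r :=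
      fun u hu => hzw' ⟨hu.1, hs2 hu.2⟩
    have e1 := Complex.integral_boundary_rect_eq_zero_of_continuousOn_of_differentiableOn g z
      ⟨w.re, 0⟩ (hc.mono sub1) (fun u hu => (hd u (sub1 ⟨Set.Ioo_subset_Icc_self hu.1,
        Set.Ioo_subset_Icc_self hu.2⟩) (by
          have h2 : u.im ∈ Set.Ioo (min z.im 0) (max z.im 0) := hu.2
          rcases le_total z.im 0 with h | h
          · rw [max_eq_right h] at h2; exact h2.2.ne
          · rw [min_eq_right h] at h2; exact h2.1.ne')).differentiableWithinAt)
    have e2 := Complex.integral_boundary_rect_eq_zero_of_continuousOn_of_differentiableOn g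
      ⟨z.re, 0⟩ w (hc.mono sub2) (fun u hu => (hd u (sub2 ⟨Set.Ioo_subset_Icc_self hu.1,
        Set.Ioo_subset_Icc_self hu.2⟩) (by
          have h2 : u.im ∈ Set.Ioo (min 0 w.im) (max 0 w.im) := hu.2
          rcases le_total w.im 0 with h | h
          · rw [max_eq_left h] at h2; exact h2.2.ne
          · rw [min_eq_left h] at h2; exact h2.1.ne')).differentiableWithinAt)
    have hint : ∀ x ∈ Set.uIcc z.re w.re, ∀ p q, Set.uIcc p q ⊆ Set.uIcc z.im w.im →
        IntervalIntegrable (fun y : ℝ => g (x + y * Complex.I)) MeasureTheory.volume p q := by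
      intro x hx p q hpq
      apply ContinuousOn.intervalIntegrable
      refine hc.comp (by fun_prop) fun y hy => hzw' ?_
      rw [Complex.mem_reProdIm]
      simpa using ⟨hx, hpq hy⟩
    rw [← intervalIntegral.integral_add_adjacent_intervals
        (hint w.re Set.right_mem_uIcc _ _ hs1) (hint w.re Set.right_mem_uIcc _ _ hs2),
      ← intervalIntegral.integral_add_adjacent_intervals
        (hint z.re Set.left_mem_uIcc _ _ hs1) (hint z.re Set.left_mem_uIcc _ _ hs2)]
    simp only [smul_eq_mul] at e1 e2 ⊢
    linear_combination e1 + e2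
  · refine Complex.integral_boundary_rect_eq_zero_of_continuousOn_of_differentiableOn g z w
      (hc.mono hzw') fun u hu => (hd u (hzw' ⟨Set.Ioo_subset_Icc_self hu.1,
        Set.Ioo_subset_Icc_self hu.2⟩) fun hu0 => h0 ?_).differentiableWithinAt
    have h2 := Set.Ioo_subset_Icc_self hu.2
    rw [hu0] at h2
    exact h2

/-- The points off the line through `a` and `b`. -/
def offLine (a b : ℂ) : Set ℂ := {w | ((w - a) * (starRingEnd ℂ) (b - a)).im ≠ 0}

lemma offLine_eq (a b : ℂ) : offLine a b = leftSide a b ∪ rightSide a b := by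
  ext w
  simp only [offLine, leftSide, rightSide, Set.mem_ofPred_eq, Set.mem_union, ne_iff_lt_or_gt]
  exact or_comm

lemma isOpen_leftSide (a b : ℂ) : IsOpen (leftSide a b) :=
  isOpen_lt continuous_const (by fun_prop)

lemma isOpen_rightSide (a b : ℂ) : IsOpen (rightSide a b) :=
  isOpen_lt (by fun_prop) continuous_const

lemma isOpen_offLine (a b : ℂ) : IsOpen (offLine a b) := by
  rw [offLine_eq]; exact (isOpen_leftSide a b).union (isOpen_rightSide a b)

lemma im_shift (a b w : ℂ) (t : ℝ) :
    ((w + t * (Complex.I * (b - a)) - a) * (starRingEnd ℂ) (b - a)).im =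
      ((w - a) * (starRingEnd ℂ) (b - a)).im + t * Complex.normSq (b - a) := by
  simp only [Complex.mul_im, Complex.sub_re, Complex.sub_im, Complex.add_re, Complex.add_im,
    Complex.conj_re, Complex.conj_im, Complex.mul_re, Complex.ofReal_re, Complex.ofReal_im,
    Complex.I_re, Complex.I_im, Complex.normSq_apply]
  ring

lemma dense_offLine {a b : ℂ} (hab : a ≠ b) : Dense (offLine a b) := by
  intro w
  have hn : 0 < Complex.normSq (b - a) := Complex.normSq_pos.2 (sub_ne_zero.2 hab.symm)
  by_cases hw : w ∈ offLine a b
  · exact subset_closure hw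
  have hw0 : ((w - a) * (starRingEnd ℂ) (b - a)).im = 0 := by simpa [offLine] using hw
  have ht : Tendsto (fun t : ℝ => w + (t : ℂ) * (Complex.I * (b - a))) (𝓝[>] 0) (𝓝 w) := by
    have : Continuous fun t : ℝ => w + (t : ℂ) * (Complex.I * (b - a)) := by fun_prop
    simpa using (this.tendsto 0).mono_left nhdsWithin_le_nhds
  refine mem_closure_of_tendsto ht ?_
  filter_upwards [self_mem_nhdsWithin] with t ht
  rw [offLine, Set.mem_ofPred_eq, im_shift, hw0, zero_add]
  exact (mul_pos ht hn).ne'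

lemma segment_subset_compl_offLine (a b : ℂ) : segment ℝ a b ⊆ (offLine a b)ᶜ := by
  rw [segment_eq_image']
  rintro _ ⟨t, -, rfl⟩
  simp only [offLine, Set.mem_compl_iff, Set.mem_ofPred_eq, not_not, add_sub_cancel_left,
    Complex.real_smul, mul_assoc, Complex.mul_conj, ← Complex.ofReal_mul, Complex.ofReal_im]

/-- The affine map `u ↦ a + (b - a) * u` carries the real axis to the line and reduces the claim to
the previous case. -/
lemma differentiableOn_ball_of_off_line {f : ℂ → ℂ} {a b z₀ : ℂ} {r : ℝ} (hab : a ≠ b)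
    (hc : ContinuousOn f (Metric.ball z₀ r))
    (hd : ∀ z ∈ Metric.ball z₀ r, z ∈ offLine a b → DifferentiableAt ℂ f z) :
    DifferentiableOn ℂ f (Metric.ball z₀ r) := by
  have hba : b - a ≠ 0 := sub_ne_zero.2 hab.symm
  have hn : 0 < ‖b - a‖ := norm_pos_iff.2 hba
  have hmaps : ∀ u ∈ Metric.ball ((z₀ - a) / (b - a)) (r / ‖b - a‖),
      a + (b - a) * u ∈ Metric.ball z₀ r := by
    intro u hu
    rw [mem_ball_iff_norm] at hu ⊢
    have : a + (b - a) * u - z₀ = (b - a) * (u - (z₀ - a) / (b - a)) := by field_simp; ring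
    rw [this, norm_mul]
    rwa [lt_div_iff₀' hn] at hu
  have key : DifferentiableOn ℂ (fun u => f (a + (b - a) * u))
      (Metric.ball ((z₀ - a) / (b - a)) (r / ‖b - a‖)) := by
    refine differentiableOn_ball_of_off_real (hc.comp (by fun_prop) hmaps) fun u hu hu0 => ?_
    refine (hd _ (hmaps u hu) ?_).comp u (by fun_prop)
    have : (a + (b - a) * u - a) * (starRingEnd ℂ) (b - a) = (Complex.normSq (b - a) : ℂ) * u := by
      rw [← Complex.mul_conj]; ring
    rw [offLine, Set.mem_ofPred_eq, this, Complex.im_ofReal_mul]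
    exact mul_ne_zero (Complex.normSq_pos.2 hba).ne' hu0
  have hcomp : DifferentiableOn ℂ (fun z => f (a + (b - a) * ((z - a) / (b - a))))
      (Metric.ball z₀ r) := by
    refine key.comp (f := fun z => (z - a) / (b - a)) (by fun_prop) fun z hz => ?_
    rw [mem_ball_iff_norm] at hz ⊢
    rw [← sub_div, norm_div, sub_sub_sub_cancel_right]
    gcongr
  refine hcomp.congr fun z _ => ?_
  congr 1
  field_simp
  ring

/-- `h` agrees off `Γ` with a function holomorphic near `z₀`. -/
def RemovableAt (Γ : Set ℂ) (h : ℂ → ℂ) (z₀ : ℂ) : Prop :=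
  ∃ r > 0, ∃ G : ℂ → ℂ, DifferentiableOn ℂ G (Metric.ball z₀ r) ∧
    ∀ w ∈ Metric.ball z₀ r, w ∉ Γ → h w = G w

/-- The values of `h` on `Γ` are arbitrary. The holomorphic extension is recovered from limits along
the dense complement, so all the local extensions are one function, `extendFrom Γᶜ h`. -/
lemma RemovableAt.differentiableAt_extendFrom {Γ : Set ℂ} (hΓ : Dense Γᶜ) {h : ℂ → ℂ} {z₀ : ℂ}
    (H : RemovableAt Γ h z₀) : ∀ᶠ z in 𝓝 z₀, DifferentiableAt ℂ (extendFrom Γᶜ h) z := by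
  obtain ⟨r, hr, G, hG, hGh⟩ := H
  have heq : ∀ w ∈ Metric.ball z₀ r, extendFrom Γᶜ h w = G w := by
    intro w hw
    refine extendFrom_eq (hΓ w) ?_
    have h1 : Tendsto G (𝓝[Γᶜ] w) (𝓝 (G w)) :=
      ((hG.continuousOn.continuousAt (Metric.isOpen_ball.mem_nhds hw)).tendsto).mono_left
        nhdsWithin_le_nhds
    refine h1.congr' ?_
    filter_upwards [self_mem_nhdsWithin, mem_nhdsWithin_of_mem_nhds
      (Metric.isOpen_ball.mem_nhds hw)] with u hu hu'
    exact (hGh u hu' hu).symm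
  filter_upwards [Metric.ball_mem_nhds z₀ hr] with z hz
  refine (hG.differentiableAt (Metric.isOpen_ball.mem_nhds hz)).congr_of_eventuallyEq ?_
  filter_upwards [Metric.isOpen_ball.mem_nhds hz] with w hw using heq w hw

/-- Two-sided limits make the extension from off the line continuous on the whole disc, and then the
Morera argument applies. -/
lemma removableAt_of_mem_line {Γ : Set ℂ} {h : ℂ → ℂ} {a b z₀ : ℂ} {r : ℝ} (hab : a ≠ b)
    (hr : 0 < r) (hd : DifferentiableOn ℂ h Γᶜ) (hΓ : IsClosed Γ)
    (hΓl : ∀ w ∈ Metric.ball z₀ r, w ∈ Γ → w ∉ offLine a b)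
    (hlim : ∀ w ∈ Metric.ball z₀ r, w ∉ offLine a b → ∃ y, Tendsto h (𝓝[offLine a b] w) (𝓝 y)) :
    RemovableAt Γ h z₀ := by
  have hdiff : ∀ w ∈ Metric.ball z₀ r, w ∈ offLine a b → DifferentiableAt ℂ h w :=
    fun w hw hw' => hd.differentiableAt (hΓ.isOpen_compl.mem_nhds fun h => hΓl w hw h hw')
  have hlim' : ∀ w ∈ Metric.ball z₀ r, ∃ y, Tendsto h (𝓝[offLine a b] w) (𝓝 y) := by
    intro w hw
    by_cases hw' : w ∈ offLine a b
    · exact ⟨_, (hdiff w hw hw').continuousAt.continuousWithinAt⟩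
    · exact hlim w hw hw'
  have hext : ∀ w ∈ Metric.ball z₀ r, w ∈ offLine a b → extendFrom (offLine a b) h w = h w :=
    fun w hw hw' => extendFrom_eq (dense_offLine hab w)
      (hdiff w hw hw').continuousAt.continuousWithinAt
  have hG : DifferentiableOn ℂ (extendFrom (offLine a b) h) (Metric.ball z₀ r) := by
    refine differentiableOn_ball_of_off_line hab
      (continuousOn_extendFrom (fun w _ => dense_offLine hab w) hlim') fun z hz hz' => ?_
    refine (hdiff z hz hz').congr_of_eventuallyEq ?_
    filter_upwards [Metric.isOpen_ball.mem_nhds hz, (isOpen_offLine a b).mem_nhds hz'] with w h1 h2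
    exact hext w h1 h2
  refine ⟨r, hr, extendFrom (offLine a b) h, hG, fun w hw hwΓ => ?_⟩
  by_cases hw' : w ∈ offLine a b
  · exact (hext w hw hw').symm
  · refine (extendFrom_eq (dense_offLine hab w) ?_).symm
    exact (hd.differentiableAt (hΓ.isOpen_compl.mem_nhds hwΓ)).continuousAt.continuousWithinAt

/-- Riemann's removable singularity theorem: the exponent `-1/2` is above `-1`, so the extension is
`o((z - e)⁻¹)`. The bound on `Γ` itself comes from the bound off `Γ` by continuity. -/
lemma removableAt_of_isBigO {Γ : Set ℂ} (hΓ : Dense Γᶜ) {h : ℂ → ℂ} {e : ℂ} (he : e ∈ Γ)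
    (hloc : ∀ᶠ z in 𝓝[≠] e, RemovableAt Γ h z)
    (hO : h =O[𝓝[Γᶜ] e] fun z => ‖z - e‖ ^ (-(1 / 2) : ℝ)) : RemovableAt Γ h e := by
  obtain ⟨C, hC⟩ := hO.bound
  rw [eventually_nhdsWithin_iff] at hC hloc
  obtain ⟨r, hr, hball⟩ := Metric.eventually_nhds_iff_ball.1 (hC.and hloc)
  set H := extendFrom Γᶜ h
  have hdH : ∀ z ∈ Metric.ball e r, z ≠ e → DifferentiableAt ℂ H z := fun z hz hze =>
    (((hball z hz).2 hze).differentiableAt_extendFrom hΓ).self_of_nhds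
  have hHeq : ∀ z ∈ Metric.ball e r, z ∉ Γ → h z = H z := by
    intro z hz hzΓ
    have hze : z ≠ e := fun h => hzΓ (h ▸ he)
    obtain ⟨r', hr', G, hG, hGh⟩ := (hball z hz).2 hze
    refine (extendFrom_eq (subset_closure hzΓ) ?_).symm
    rw [hGh z (Metric.mem_ball_self hr') hzΓ]
    have h1 : Tendsto G (𝓝[Γᶜ] z) (𝓝 (G z)) :=
      ((hG.continuousOn.continuousAt (Metric.ball_mem_nhds z hr')).tendsto).mono_left
        nhdsWithin_le_nhds
    refine h1.congr' ?_
    filter_upwards [self_mem_nhdsWithin, mem_nhdsWithin_of_mem_nhds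
      (Metric.ball_mem_nhds z hr')] with u hu hu'
    exact (hGh u hu' hu).symm
  have hHb : ∀ z ∈ Metric.ball e r, z ≠ e → ‖H z‖ ≤ C * ‖z - e‖ ^ (-(1 / 2) : ℝ) := by
    intro z hz hze
    have hneb : (𝓝[Γᶜ] z).NeBot := mem_closure_iff_nhdsWithin_neBot.1 (hΓ z)
    have h1 : Tendsto (fun w => ‖H w‖) (𝓝[Γᶜ] z) (𝓝 ‖H z‖) :=
      ((hdH z hz hze).continuousAt.norm.tendsto).mono_left nhdsWithin_le_nhds
    have h2 : Tendsto (fun w => C * ‖w - e‖ ^ (-(1 / 2) : ℝ)) (𝓝[Γᶜ] z)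
        (𝓝 (C * ‖z - e‖ ^ (-(1 / 2) : ℝ))) := by
      refine Tendsto.mono_left (ContinuousAt.tendsto ?_) nhdsWithin_le_nhds
      refine continuousAt_const.mul (ContinuousAt.rpow_const (by fun_prop) (Or.inl ?_))
      exact norm_ne_zero_iff.2 (sub_ne_zero.2 hze)
    refine le_of_tendsto_of_tendsto h1 h2 ?_
    filter_upwards [self_mem_nhdsWithin, mem_nhdsWithin_of_mem_nhds
      (Metric.isOpen_ball.mem_nhds hz)] with w hw hw'
    rw [← hHeq w hw' hw]
    refine ((hball w hw').1 hw).trans (le_of_eq ?_)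
    rw [Real.norm_of_nonneg (Real.rpow_nonneg (norm_nonneg _) _)]
  have ho : (fun z => H z - H e) =o[𝓝[≠] e] fun z => (z - e)⁻¹ := by
    have hinv : Tendsto (fun z : ℂ => ‖z - e‖) (𝓝[≠] e) (𝓝[>] 0) := by
      refine tendsto_nhdsWithin_iff.2 ⟨?_, ?_⟩
      · have : Continuous fun z : ℂ => ‖z - e‖ := by fun_prop
        simpa using (this.tendsto e).mono_left nhdsWithin_le_nhds
      · filter_upwards [self_mem_nhdsWithin] with z hz
        exact norm_pos_iff.2 (sub_ne_zero.2 hz)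
    refine IsLittleO.sub ?_ ?_
    · have hb : H =O[𝓝[≠] e] fun z => ‖z - e‖ ^ (-(1 / 2) : ℝ) := by
        refine IsBigO.of_bound C ?_
        filter_upwards [self_mem_nhdsWithin, mem_nhdsWithin_of_mem_nhds
          (Metric.ball_mem_nhds e hr)] with z hz hz'
        rw [Real.norm_of_nonneg (Real.rpow_nonneg (norm_nonneg _) _)]
        exact hHb z hz' hz
      refine hb.trans_isLittleO (IsLittleO.of_norm_right ?_)
      rw [isLittleO_iff_tendsto']
      · have hsq : Tendsto (fun z : ℂ => ‖z - e‖ ^ (1 / 2 : ℝ)) (𝓝[≠] e) (𝓝 0) := by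
          have := (Real.continuousAt_rpow_const 0 (1 / 2 : ℝ) (Or.inr (by norm_num))).tendsto
          rw [Real.zero_rpow (by norm_num)] at this
          exact (this.mono_left nhdsWithin_le_nhds).comp hinv
        refine hsq.congr' ?_
        filter_upwards [self_mem_nhdsWithin] with z hz
        have hz0 : 0 < ‖z - e‖ := norm_pos_iff.2 (sub_ne_zero.2 hz)
        rw [norm_inv, div_inv_eq_mul]
        nth_rewrite 3 [← Real.rpow_one ‖z - e‖]
        rw [← Real.rpow_add hz0]
        norm_num
      · filter_upwards [self_mem_nhdsWithin] with z hz hz'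
        exact absurd (inv_eq_zero.1 (norm_eq_zero.1 hz')) (sub_ne_zero.2 hz)
    · rw [isLittleO_const_left]
      right
      simp only [Function.comp_def, norm_inv]
      exact tendsto_inv_nhdsGT_zero.comp hinv
  refine ⟨r, hr, Function.update H e (limUnder (𝓝[≠] e) H),
    Complex.differentiableOn_update_limUnder_of_isLittleO (Metric.ball_mem_nhds e hr)
      (fun z hz => (hdH z hz.1 hz.2).differentiableWithinAt) ho, fun w hw hwΓ => ?_⟩
  rw [Function.update_of_ne (fun hwe => hwΓ (by rw [hwe]; exact he))]
  exact hHeq w hw hwΓ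

lemma eq_of_forall_removableAt {Γ : Set ℂ} (hΓ : Dense Γᶜ) (hΓo : IsOpen Γᶜ) (hΓb : IsBounded Γ)
    {h : ℂ → ℂ} (hd : DifferentiableOn ℂ h Γᶜ) (H : ∀ z, RemovableAt Γ h z) {L : ℂ}
    (hL : Tendsto h (cobounded ℂ) (𝓝 L)) : ∀ z ∉ Γ, h z = L := by
  have hext : ∀ z ∉ Γ, extendFrom Γᶜ h z = h z := fun z hz =>
    extendFrom_eq (subset_closure hz)
      (hd.differentiableAt (hΓo.mem_nhds hz)).continuousAt.continuousWithinAt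
  have hdiff : Differentiable ℂ (extendFrom Γᶜ h) := fun z =>
    ((H z).differentiableAt_extendFrom hΓ).self_of_nhds
  have hlim : Tendsto (extendFrom Γᶜ h) (cocompact ℂ) (𝓝 L) := by
    rw [← Metric.cobounded_eq_cocompact]
    refine hL.congr' ?_
    filter_upwards [isBounded_def.1 hΓb] with z hz using (hext z hz).symm
  intro z hz
  rw [← hext z hz]
  exact hdiff.apply_eq_of_tendsto_cocompact z hlim

/-! ### Geometry of the contour -/

/-- The conditions on the endpoints under which the contour is a simple polygonal line. -/
structure Admissible (E₁ E₃ : ℂ) (ε : ℝ) : Prop where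
  im₁ : 0 < E₁.im
  im₃ : 0 < E₃.im
  pos : 0 < ε
  re : E₃.re + ε < E₁.re

/-- The five oriented arcs of the contour. -/
def arcs (E₁ E₃ : ℂ) (ε : ℝ) : List (ℂ × ℂ) :=
  [(bar E₃, bar (E2 E₃ ε)), (bar (E2 E₃ ε), bar E₁), (bar E₁, E₁), (E₁, E2 E₃ ε), (E2 E₃ ε, E₃)]

lemma mem_closedContour {E₁ E₃ : ℂ} {ε : ℝ} {z : ℂ} :
    z ∈ closedContour E₁ E₃ ε ↔ ∃ s ∈ arcs E₁ E₃ ε, z ∈ segment ℝ s.1 s.2 := by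
  simp [closedContour, arcs, or_assoc]

lemma mem_endpoints {E₁ E₃ : ℂ} {ε : ℝ} {z : ℂ} :
    z ∈ endpoints E₁ E₃ ε ↔ ∃ s ∈ arcs E₁ E₃ ε, z = s.1 ∨ z = s.2 := by
  simp only [endpoints, arcs, Set.mem_insert_iff, Set.mem_singleton_iff, List.mem_cons,
    List.not_mem_nil, or_false, exists_eq_or_imp, exists_eq_left]
  tauto

lemma isCompact_segment' (a b : ℂ) : IsCompact (segment ℝ a b) := by
  rw [segment_eq_image']
  exact isCompact_Icc.image (by fun_prop)

lemma isCompact_closedContour (E₁ E₃ : ℂ) (ε : ℝ) : IsCompact (closedContour E₁ E₃ ε) :=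
  ((((isCompact_segment' _ _).union (isCompact_segment' _ _)).union
    (isCompact_segment' _ _)).union (isCompact_segment' _ _)).union (isCompact_segment' _ _)

lemma re_im_of_mem_segment {a b z : ℂ} (hz : z ∈ segment ℝ a b) :
    ∃ p q : ℝ, 0 ≤ p ∧ 0 ≤ q ∧ p + q = 1 ∧ z.re = p * a.re + q * b.re ∧
      z.im = p * a.im + q * b.im := by
  obtain ⟨p, q, hp, hq, hpq, rfl⟩ := hz
  exact ⟨p, q, hp, hq, hpq, by simp, by simp⟩

lemma re_mem_of_mem_segment {a b z : ℂ} {l u : ℝ} (hz : z ∈ segment ℝ a b) (h1 : l ≤ a.re)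
    (h2 : l ≤ b.re) (h3 : a.re ≤ u) (h4 : b.re ≤ u) : l ≤ z.re ∧ z.re ≤ u := by
  obtain ⟨p, q, hp, hq, hpq, h, -⟩ := re_im_of_mem_segment hz
  obtain rfl : q = 1 - p := by linarith
  constructor <;> nlinarith

lemma re_mem_of_mem_openSegment {a b z : ℂ} (hz : z ∈ openSegment ℝ a b) (h : a.re < b.re) :
    a.re < z.re ∧ z.re < b.re := by
  obtain ⟨p, q, hp, hq, hpq, rfl⟩ := hz
  obtain rfl : q = 1 - p := by linarith
  simp only [Complex.add_re, Complex.real_smul, Complex.mul_re, Complex.ofReal_re,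
    Complex.ofReal_im, zero_mul, sub_zero]
  constructor <;> nlinarith

lemma im_pos_of_mem_segment {a b z : ℂ} (hz : z ∈ segment ℝ a b) (h1 : 0 < a.im)
    (h2 : 0 < b.im) : 0 < z.im :=
  (convex_halfSpace_im_gt 0).segment_subset h1 h2 hz

lemma im_neg_of_mem_segment {a b z : ℂ} (hz : z ∈ segment ℝ a b) (h1 : a.im < 0)
    (h2 : b.im < 0) : z.im < 0 :=
  (convex_halfSpace_im_lt 0).segment_subset h1 h2 hz

section
variable {E₁ E₃ : ℂ} {ε : ℝ}

lemma E2_re : (E2 E₃ ε).re = E₃.re + ε := by simp [E2]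
lemma E2_im : (E2 E₃ ε).im = E₃.im := by simp [E2]

lemma Admissible.arcs_ne (A : Admissible E₁ E₃ ε) : ∀ s ∈ arcs E₁ E₃ ε, s.1 ≠ s.2 := by
  have h1 := A.im₁
  have h2 := A.im₃
  have h3 := A.pos
  have h4 := A.re
  simp only [arcs, List.mem_cons, List.not_mem_nil, or_false]
  rintro s (rfl | rfl | rfl | rfl | rfl) h
  all_goals
    have hr := congrArg Complex.re h
    have hi := congrArg Complex.im h
    simp only [Complex.conj_re, Complex.conj_im, E2_re, E2_im] at hr hi
    linarith

/-- An interior point of one arc lies on no other arc. -/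
lemma Admissible.notMem_segment (A : Admissible E₁ E₃ ε) {s : ℂ × ℂ} (hs : s ∈ arcs E₁ E₃ ε)
    {z : ℂ} (hz : z ∈ openSegment ℝ s.1 s.2) {s' : ℂ × ℂ} (hs' : s' ∈ arcs E₁ E₃ ε)
    (hne : s' ≠ s) : z ∉ segment ℝ s'.1 s'.2 := by
  have h1 := A.im₁
  have h2 := A.im₃
  have h3 := A.pos
  have h4 := A.re
  intro hz'
  have hzs := openSegment_subset_segment ℝ _ _ hz
  -- The sign of the imaginary part and the position of the real part relative to `Re E₂` and `Re
  -- E₁` separate the arcs in all cases but two, which involve the vertical arc and its neighbours.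
  have b32 : ∀ w ∈ segment ℝ (bar E₃) (bar (E2 E₃ ε)), w.im < 0 ∧ w.re ≤ E₃.re + ε := fun w hw =>
    ⟨im_neg_of_mem_segment hw (by simpa) (by simpa [E2_im]),
      (re_mem_of_mem_segment (l := E₃.re) hw (by simp) (by simp [E2_re, h3.le])
        (by simp [h3.le]) (by simp [E2_re])).2⟩
  have b21 : ∀ w ∈ segment ℝ (bar (E2 E₃ ε)) (bar E₁), w.im < 0 ∧ E₃.re + ε ≤ w.re :=
    fun w hw => ⟨im_neg_of_mem_segment hw (by simpa [E2_im]) (by simpa),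
      (re_mem_of_mem_segment (u := E₁.re) hw (by simp [E2_re]) (by simp [h4.le])
        (by simp [E2_re, h4.le]) (by simp)).1⟩
  have b11 : ∀ w ∈ segment ℝ (bar E₁) E₁, w.re = E₁.re := fun w hw =>
    have := re_mem_of_mem_segment (l := E₁.re) (u := E₁.re) hw (by simp) le_rfl (by simp) le_rfl
    le_antisymm this.2 this.1
  have b12 : ∀ w ∈ segment ℝ E₁ (E2 E₃ ε), 0 < w.im ∧ E₃.re + ε ≤ w.re :=
    fun w hw => ⟨im_pos_of_mem_segment hw h1 (by simpa [E2_im]),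
      (re_mem_of_mem_segment (u := E₁.re) hw (by simp [h4.le]) (by simp [E2_re])
        le_rfl (by simp [E2_re, h4.le])).1⟩
  have b23 : ∀ w ∈ segment ℝ (E2 E₃ ε) E₃, 0 < w.im ∧ w.re ≤ E₃.re + ε := fun w hw =>
    ⟨im_pos_of_mem_segment hw (by simpa [E2_im]) h2,
      (re_mem_of_mem_segment (l := E₃.re) hw (by simp [E2_re, h3.le]) le_rfl
        (by simp [E2_re]) (by simp [h3.le])).2⟩
  simp only [arcs, List.mem_cons, List.not_mem_nil, or_false] at hs hs'
  rcases hs with rfl | rfl | rfl | rfl | rfl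
  · have i1 := re_mem_of_mem_openSegment hz (by simpa [E2_re])
    have i2 := b32 z hzs
    simp only [Complex.conj_re, E2_re] at i1
    rcases hs' with rfl | rfl | rfl | rfl | rfl
    · exact hne rfl
    · have := b21 z hz'; linarith [i1.2]
    · have := b11 z hz'; linarith [i1.2]
    · have := b12 z hz'; linarith [i2.1]
    · have := b23 z hz'; linarith [i2.1]
  · have i1 := re_mem_of_mem_openSegment hz (by simpa [E2_re])
    have i2 := b21 z hzs
    simp only [Complex.conj_re, E2_re] at i1
    rcases hs' with rfl | rfl | rfl | rfl | rfl
    · have := b32 z hz'; linarith [i1.1]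
    · exact hne rfl
    · have := b11 z hz'; linarith [i1.2]
    · have := b12 z hz'; linarith [i2.1]
    · have := b23 z hz'; linarith [i2.1]
  · have i1 := b11 z hzs
    obtain ⟨p, q, hp, hq, hpq, h⟩ := hz
    rcases hs' with rfl | rfl | rfl | rfl | rfl
    · have := b32 z hz'; linarith [this.2]
    -- The neighbouring arc meets the line `Re = Re E₁` only in `bar E₁`, and `bar E₁` is not
    -- interior to the vertical arc.
    · obtain ⟨p', q', hp', hq', hpq', h', h''⟩ := re_im_of_mem_segment hz'
      simp only [Complex.conj_re, E2_re, Complex.conj_im, E2_im] at h' h''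
      have hi := congrArg Complex.im h
      have hp0 : p' = 0 := by
        by_contra hne
        have : 0 < p' := lt_of_le_of_ne hp' (Ne.symm hne)
        obtain rfl : q' = 1 - p' := by linarith
        nlinarith
      obtain rfl : q' = 1 := by linarith
      simp only [Complex.add_im, Complex.real_smul, Complex.mul_im, Complex.ofReal_re,
        Complex.ofReal_im, zero_mul, add_zero, Complex.conj_im] at hi
      rw [hp0] at h''
      obtain rfl : p = 1 - q := by linarith
      nlinarith
    · exact hne rfl
    · obtain ⟨p', q', hp', hq', hpq', h', h''⟩ := re_im_of_mem_segment hz'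
      simp only [E2_re, E2_im] at h' h''
      have hi := congrArg Complex.im h
      have hq0 : q' = 0 := by
        by_contra hne
        have : 0 < q' := lt_of_le_of_ne hq' (Ne.symm hne)
        obtain rfl : p' = 1 - q' := by linarith
        nlinarith
      obtain rfl : p' = 1 := by linarith
      simp only [Complex.add_im, Complex.real_smul, Complex.mul_im, Complex.ofReal_re,
        Complex.ofReal_im, zero_mul, add_zero, Complex.conj_im] at hi
      rw [hq0] at h''
      obtain rfl : p = 1 - q := by linarith
      nlinarith
    · have := b23 z hz'; linarith [this.2]
  · rw [openSegment_symm] at hz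
    have i1 := re_mem_of_mem_openSegment hz (by simpa [E2_re])
    have i2 := b12 z hzs
    simp only [E2_re] at i1
    rcases hs' with rfl | rfl | rfl | rfl | rfl
    · have := b32 z hz'; linarith [i1.1]
    · have := b21 z hz'; linarith [i2.1]
    · have := b11 z hz'; linarith [i1.2]
    · exact hne rfl
    · have := b23 z hz'; linarith [i1.1]
  · rw [openSegment_symm] at hz
    have i1 := re_mem_of_mem_openSegment hz (by simpa [E2_re])
    have i2 := b23 z hzs
    simp only [E2_re] at i1
    rcases hs' with rfl | rfl | rfl | rfl | rfl
    · have := b32 z hz'; linarith [i2.1]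
    · have := b21 z hz'; linarith [i2.1]
    · have := b11 z hz'; linarith [i1.2]
    · have := b12 z hz'; linarith [i1.2]
    · exact hne rfl

/-- The contour lies in a finite union of lines, whose complements are open and dense. -/
lemma Admissible.dense_compl (A : Admissible E₁ E₃ ε) : Dense (closedContour E₁ E₃ ε)ᶜ := by
  have hd : ∀ l : List (ℂ × ℂ), (∀ s ∈ l, s.1 ≠ s.2) →
      Dense {z | ∀ s ∈ l, z ∈ offLine s.1 s.2} ∧ IsOpen {z | ∀ s ∈ l, z ∈ offLine s.1 s.2} := by
    intro l
    induction l with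
    | nil => intro _; simp
    | cons a l ih =>
      intro h
      obtain ⟨i1, i2⟩ := ih fun s hs => h s (List.mem_cons_of_mem _ hs)
      have : {z | ∀ s ∈ a :: l, z ∈ offLine s.1 s.2} =
          offLine a.1 a.2 ∩ {z | ∀ s ∈ l, z ∈ offLine s.1 s.2} := by
        ext z; simp
      rw [this]
      exact ⟨(dense_offLine (h a List.mem_cons_self)).inter_of_isOpen_left i1 (isOpen_offLine _ _),
        (isOpen_offLine _ _).inter i2⟩
  refine (hd _ A.arcs_ne).1.mono fun z hz hz' => ?_
  obtain ⟨s, hs, hzs⟩ := mem_closedContour.1 hz'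
  exact segment_subset_compl_offLine _ _ hzs (hz s hs)

/-- Near an interior point of an arc, the contour is contained in that arc without its
endpoints. -/
lemma Admissible.eventually_mem_openSegment (A : Admissible E₁ E₃ ε) {s : ℂ × ℂ}
    (hs : s ∈ arcs E₁ E₃ ε) {z : ℂ} (hz : z ∈ openSegment ℝ s.1 s.2) :
    ∀ᶠ w in 𝓝 z, w ∈ closedContour E₁ E₃ ε → w ∈ openSegment ℝ s.1 s.2 := by
  have h1 : ∀ l : List (ℂ × ℂ), (∀ s' ∈ l, s' ≠ s → z ∉ segment ℝ s'.1 s'.2) →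
      ∀ᶠ w in 𝓝 z, ∀ s' ∈ l, s' ≠ s → w ∉ segment ℝ s'.1 s'.2 := by
    intro l
    induction l with
    | nil => intro _; simp
    | cons a l ih =>
      intro h
      have i1 := ih fun s' hs' => h s' (List.mem_cons_of_mem _ hs')
      by_cases ha : a = s
      · filter_upwards [i1] with w hw s' hs' hne
        rcases List.mem_cons.1 hs' with rfl | hs''
        · exact absurd ha hne
        · exact hw s' hs'' hne
      · filter_upwards [i1, (isCompact_segment' a.1 a.2).isClosed.isOpen_compl.mem_nhds
          (h a List.mem_cons_self ha)] with w hw hw' s' hs' hne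
        rcases List.mem_cons.1 hs' with rfl | hs''
        · exact hw'
        · exact hw s' hs'' hne
  have hne := A.arcs_ne s hs
  have hz1 : z ≠ s.1 := by
    rintro rfl
    exact hne (left_mem_openSegment_iff.1 hz)
  have hz2 : z ≠ s.2 := by
    rintro rfl
    exact hne (right_mem_openSegment_iff.1 hz)
  filter_upwards [h1 _ fun s' hs' hne => A.notMem_segment hs hz hs' hne,
    isOpen_ne.mem_nhds hz1, isOpen_ne.mem_nhds hz2] with w hw hw1 hw2 hwΓ
  obtain ⟨s', hs', hws⟩ := mem_closedContour.1 hwΓ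
  by_cases h : s' = s
  · subst h
    exact mem_openSegment_of_ne_left_right hw1.symm hw2.symm hws
  · exact absurd hws (hw s' hs' h)

/-- **Liouville's theorem** for functions without jumps across the contour. -/
theorem Admissible.eq_const (A : Admissible E₁ E₃ ε) {h : ℂ → ℂ} {L : ℂ}
    (hd : DifferentiableOn ℂ h (closedContour E₁ E₃ ε)ᶜ)
    (hj : ∀ s ∈ arcs E₁ E₃ ε, ∀ z ∈ openSegment ℝ s.1 s.2, ∃ y,
      Tendsto h (𝓝[leftSide s.1 s.2] z) (𝓝 y) ∧ Tendsto h (𝓝[rightSide s.1 s.2] z) (𝓝 y))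
    (hg : ∀ e ∈ endpoints E₁ E₃ ε,
      h =O[𝓝[(closedContour E₁ E₃ ε)ᶜ] e] fun z => ‖z - e‖ ^ (-(1 / 2) : ℝ))
    (hL : Tendsto h (cobounded ℂ) (𝓝 L)) : ∀ z ∉ closedContour E₁ E₃ ε, h z = L := by
  have hcl := (isCompact_closedContour E₁ E₃ ε).isClosed
  have hoff : ∀ z ∉ closedContour E₁ E₃ ε, RemovableAt (closedContour E₁ E₃ ε) h z := by
    intro z hz
    obtain ⟨r, hr, hb⟩ := Metric.isOpen_iff.1 hcl.isOpen_compl z hz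
    exact ⟨r, hr, h, hd.mono hb, fun _ _ _ => rfl⟩
  have hon : ∀ s ∈ arcs E₁ E₃ ε, ∀ z ∈ openSegment ℝ s.1 s.2,
      RemovableAt (closedContour E₁ E₃ ε) h z := by
    intro s hs z hz
    obtain ⟨r, hr, hb⟩ := Metric.eventually_nhds_iff_ball.1 (A.eventually_mem_openSegment hs hz)
    refine removableAt_of_mem_line (A.arcs_ne s hs) hr hd hcl (fun w hw hwΓ =>
      segment_subset_compl_offLine _ _ (openSegment_subset_segment ℝ _ _ (hb w hw hwΓ))) ?_
    intro w hw hwl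
    by_cases hwΓ : w ∈ closedContour E₁ E₃ ε
    · obtain ⟨y, h1, h2⟩ := hj s hs w (hb w hw hwΓ)
      refine ⟨y, ?_⟩
      rw [offLine_eq, nhdsWithin_union]
      exact h1.sup h2
    · exact ⟨_, (hd.differentiableAt
        (hcl.isOpen_compl.mem_nhds hwΓ)).continuousAt.continuousWithinAt⟩
  have hnon : ∀ z ∉ endpoints E₁ E₃ ε, RemovableAt (closedContour E₁ E₃ ε) h z := by
    intro z hz
    by_cases hzΓ : z ∈ closedContour E₁ E₃ ε
    · obtain ⟨s, hs, hzs⟩ := mem_closedContour.1 hzΓ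
      refine hon s hs z (mem_openSegment_of_ne_left_right ?_ ?_ hzs)
      · rintro rfl; exact hz (mem_endpoints.2 ⟨s, hs, Or.inl rfl⟩)
      · rintro rfl; exact hz (mem_endpoints.2 ⟨s, hs, Or.inr rfl⟩)
    · exact hoff z hzΓ
  refine eq_of_forall_removableAt A.dense_compl hcl.isOpen_compl
    (isCompact_closedContour E₁ E₃ ε).isBounded hd (fun z => ?_) hL
  by_cases hz : z ∈ endpoints E₁ E₃ ε
  · refine removableAt_of_isBigO A.dense_compl ?_ ?_ (hg z hz)
    · obtain ⟨s, hs, rfl | rfl⟩ := mem_endpoints.1 hz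
      · exact mem_closedContour.2 ⟨s, hs, left_mem_segment ℝ _ _⟩
      · exact mem_closedContour.2 ⟨s, hs, right_mem_segment ℝ _ _⟩
    · have hfin : (endpoints E₁ E₃ ε).Finite := by
        unfold endpoints; exact Set.toFinite _
      have : (endpoints E₁ E₃ ε \ {z})ᶜ ∈ 𝓝 z :=
        (hfin.subset Set.sdiff_subset).isClosed.isOpen_compl.mem_nhds fun h => h.2 rfl
      filter_upwards [self_mem_nhdsWithin, mem_nhdsWithin_of_mem_nhds this] with w hw hw'
      exact hnon w fun hwe => hw' ⟨hwe, hw⟩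
  · exact hnon z hz

/-! ### Uniqueness -/

lemma det_expSigma3 (s : ℂ) : (expSigma3 s).det = 1 := by
  simp [expSigma3, Matrix.det_fin_two, ← Complex.exp_add]

lemma det_twist (φ : ℂ) : (twist φ).det = 1 := by
  have : (-(Complex.I • sigma2)).det = 1 := by
    simp [sigma2, Matrix.det_fin_two]
  rw [twist, Matrix.det_mul, Matrix.det_mul, this, det_expSigma3, det_expSigma3]
  norm_num

/-- Uniqueness needs nothing about the jump matrices beyond determinant one and their independence
of the solution. -/
lemma exists_jump_matrix {α β x t : ℝ} : ∀ s ∈ arcs E₁ E₃ ε, ∃ M : ℂ → Mat,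
    (∀ z, (M z).det = 1) ∧ ∀ Ψ, IsRHSolution E₁ E₃ α β ε x t Ψ → HasJump Ψ s.1 s.2 M := by
  simp only [arcs, List.mem_cons, List.not_mem_nil, or_false]
  rintro s (rfl | rfl | rfl | rfl | rfl)
  · exact ⟨_, fun _ => det_twist _, fun Ψ h => h.jump32⟩
  · exact ⟨_, fun _ => det_expSigma3 _, fun Ψ h => h.jump21⟩
  · exact ⟨_, fun _ => det_twist _, fun Ψ h => h.jump11⟩
  · exact ⟨_, fun _ => det_expSigma3 _, fun Ψ h => h.jump12⟩
  · exact ⟨_, fun _ => det_twist _, fun Ψ h => h.jump23⟩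

lemma rpow_quarter_mul (e : ℂ) : (fun z : ℂ => ‖z - e‖ ^ (-(1 / 4) : ℝ) * ‖z - e‖ ^ (-(1 / 4) : ℝ))
    =
    fun z => ‖z - e‖ ^ (-(1 / 2) : ℝ) := by
  ext z
  rcases (norm_nonneg (z - e)).eq_or_lt with h | h
  -- At `z = e` both sides vanish, because `0` to a nonzero real power is `0` by convention.
  · rw [← h, Real.zero_rpow (by norm_num), Real.zero_rpow (by norm_num), zero_mul]
  · rw [← Real.rpow_add h]; norm_num

lemma tendsto_mat_iff {X : Type*} {F : X → Mat} {l : Filter X} {M : Mat} :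
    Tendsto F l (𝓝 M) ↔ ∀ i j, Tendsto (fun w => F w i j) l (𝓝 (M i j)) :=
  (tendsto_pi_nhds (f := fun w i => F w i) (g := fun i => M i)).trans
    (forall_congr' fun _ => tendsto_pi_nhds)

lemma tendsto_mat_mul {X : Type*} {F G : X → Mat} {l : Filter X} {P Q : Mat}
    (hF : Tendsto F l (𝓝 P)) (hG : Tendsto G l (𝓝 Q)) :
    Tendsto (fun w => F w * G w) l (𝓝 (P * Q)) :=
  tendsto_mat_iff.2 fun i j => by
    simp only [Matrix.mul_apply]
    exact tendsto_finsetSum _ fun k _ =>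
      (tendsto_mat_iff.1 hF i k).mul (tendsto_mat_iff.1 hG k j)

lemma tendsto_mat_adjugate {X : Type*} {F : X → Mat} {l : Filter X} {P : Mat}
    (hF : Tendsto F l (𝓝 P)) : Tendsto (fun w => (F w).adjugate) l (𝓝 P.adjugate) := by
  have h := tendsto_mat_iff.1 hF
  refine tendsto_mat_iff.2 fun i j => ?_
  simp only [Matrix.adjugate_fin_two]
  fin_cases i <;> fin_cases j
  exacts [h 1 1, (h 0 1).neg, (h 1 0).neg, h 0 0]

lemma IsRHSolution.tendsto_one {α β x t : ℝ} {Ψ : ℂ → Mat}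
    (h : IsRHSolution E₁ E₃ α β ε x t Ψ) : Tendsto Ψ (cobounded ℂ) (𝓝 1) := by
  refine tendsto_mat_iff.2 fun i j => ?_
  have h0 : Tendsto (fun z : ℂ => z⁻¹) (cobounded ℂ) (𝓝 0) := tendsto_inv₀_cobounded
  have := ((h.atInfinity i j).trans_tendsto h0).add_const ((1 : Mat) i j)
  simpa using this

/-- Liouville's theorem, with the adjugate in place of the inverse so that invertibility of `Ψ` need
not be known. The jump cancels because `M * adjugate M = 1`, and the growth exponents add up to
`-1/2`. -/
lemma Admissible.mul_adjugate_eq (A : Admissible E₁ E₃ ε) {α β x t : ℝ} {Ψ Ψ' : ℂ → Mat}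
    (h : IsRHSolution E₁ E₃ α β ε x t Ψ) (h' : IsRHSolution E₁ E₃ α β ε x t Ψ') :
    ∀ z ∉ closedContour E₁ E₃ ε, Ψ' z * (Ψ z).adjugate = 1 := by
  have hadj : ∀ i j, ∃ σ : ℂ, ∃ k l, (∀ w, (Ψ w).adjugate i j = σ * Ψ w k l) := by
    intro i j
    fin_cases i <;> fin_cases j
    · exact ⟨1, 1, 1, fun w => by simp [Matrix.adjugate_fin_two]⟩
    · exact ⟨-1, 0, 1, fun w => by simp [Matrix.adjugate_fin_two]⟩
    · exact ⟨-1, 1, 0, fun w => by simp [Matrix.adjugate_fin_two]⟩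
    · exact ⟨1, 0, 0, fun w => by simp [Matrix.adjugate_fin_two]⟩
  intro z hz
  ext i j
  refine A.eq_const (h := fun z => (Ψ' z * (Ψ z).adjugate) i j) ?_ ?_ ?_ ?_ z hz
  · simp only [Matrix.mul_apply]
    refine DifferentiableOn.fun_sum fun k _ => (h'.analytic i k).mul ?_
    obtain ⟨σ, p, q, e⟩ := hadj k j
    simp only [e]
    exact (h.analytic p q).const_mul σ
  · intro s hs w hw
    obtain ⟨M, hM, hJ⟩ := exists_jump_matrix (α := α) (β := β) (x := x) (t := t) s hs
    obtain ⟨P, N, h1, h2, h3⟩ := hJ Ψ h w hw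
    obtain ⟨P', N', h1', h2', h3'⟩ := hJ Ψ' h' w hw
    have key : P' * P.adjugate = N' * N.adjugate := by
      rw [h3, h3', Matrix.adjugate_mul_distrib, Matrix.mul_assoc, ← Matrix.mul_assoc (M w),
        Matrix.mul_adjugate, hM, one_smul, Matrix.one_mul]
    refine ⟨(N' * N.adjugate) i j, ?_, ?_⟩
    · rw [← key]
      exact tendsto_mat_iff.1 (tendsto_mat_mul h1' (tendsto_mat_adjugate h1)) i j
    · exact tendsto_mat_iff.1 (tendsto_mat_mul h2' (tendsto_mat_adjugate h2)) i j
  · intro e he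
    simp only [Matrix.mul_apply]
    have hk : ∀ k, (fun z => Ψ' z i k * (Ψ z).adjugate k j) =O[𝓝[(closedContour E₁ E₃ ε)ᶜ] e]
        fun z => ‖z - e‖ ^ (-(1 / 2) : ℝ) := by
      intro k
      obtain ⟨σ, p, q, e'⟩ := hadj k j
      simp only [e']
      rw [← rpow_quarter_mul]
      exact (h'.growth e he i k).mul ((h.growth e he p q).const_mul_left σ)
    simp only [Fin.sum_univ_two]
    exact (hk 0).add (hk 1)
  · have := tendsto_mat_iff.1
      (tendsto_mat_mul h'.tendsto_one (tendsto_mat_adjugate h.tendsto_one)) i j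
    rwa [Matrix.adjugate_one, Matrix.mul_one] at this

theorem Admissible.eqOn (A : Admissible E₁ E₃ ε) {α β x t : ℝ} {Ψ Ψ' : ℂ → Mat}
    (h : IsRHSolution E₁ E₃ α β ε x t Ψ) (h' : IsRHSolution E₁ E₃ α β ε x t Ψ') :
    Set.EqOn Ψ' Ψ (closedContour E₁ E₃ ε)ᶜ := by
  intro z hz
  have h1 := A.mul_adjugate_eq h h' z hz
  -- Taking both solutions equal gives `det Ψ = 1`, so the adjugate is the inverse.
  have h2 := A.mul_adjugate_eq h h z hz
  rw [Matrix.mul_adjugate] at h2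
  calc Ψ' z = Ψ' z * ((Ψ z).adjugate * Ψ z) := by rw [Matrix.adjugate_mul, h2, Matrix.mul_one]
    _ = Ψ z := by rw [← Matrix.mul_assoc, h1, Matrix.one_mul]

end

lemma tendsto_nhds_of_eq {X : Type*} {l : Filter X} {f : X → ℂ} {a b : ℂ}
    (h : Tendsto f l (𝓝 a)) (hab : a = b) : Tendsto f l (𝓝 b) := hab ▸ h

/-! ### Logarithms and square roots with a cut along a segment -/

/-- A branch of `log ((z - B) / (z - A))` with cut along the segment from `A` to `B`. -/
noncomputable def cutLog (A B z : ℂ) : ℂ := Complex.log ((z - B) / (z - A))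

/-- A branch of `√((z - B) / (z - A))` with cut along the segment from `A` to `B`. -/
noncomputable def cutSqrt (A B z : ℂ) : ℂ := Complex.exp (cutLog A B z / 2)

/-- If `(z - B) / (z - A) = -r` with `r ≥ 0`, then `z = (r A + B) / (1 + r)` is on the segment. The
Möbius map thus carries the branch cut of the principal logarithm to the segment. -/
lemma div_mem_slitPlane {A B z : ℂ} (hz : z ∉ segment ℝ A B) :
    (z - B) / (z - A) ∈ Complex.slitPlane := by
  have hzA : z - A ≠ 0 := sub_ne_zero.2 fun h => hz (h ▸ left_mem_segment ℝ _ _)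
  by_contra h
  rw [Complex.mem_slitPlane_iff, not_or, not_lt, not_not] at h
  apply hz
  set r := -((z - B) / (z - A)).re with hr
  have hr0 : 0 ≤ r := by linarith [h.1]
  have hre : (z - B) / (z - A) = -(r : ℂ) := by
    apply Complex.ext
    · simp [hr]
    · simp [h.2]
  rw [div_eq_iff hzA] at hre
  have h1 : (1 : ℝ) + r ≠ 0 := by positivity
  have h1' : (1 : ℂ) + r ≠ 0 := by exact_mod_cast h1
  refine ⟨r / (1 + r), 1 / (1 + r), by positivity, by positivity, by field_simp; ring, ?_⟩
  simp only [Complex.real_smul]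
  push_cast
  field_simp
  linear_combination -hre

lemma ne_left_of_notMem_segment {A B z : ℂ} (hz : z ∉ segment ℝ A B) : z ≠ A :=
  fun h => hz (h ▸ left_mem_segment ℝ _ _)

lemma ne_right_of_notMem_segment {A B z : ℂ} (hz : z ∉ segment ℝ A B) : z ≠ B :=
  fun h => hz (h ▸ right_mem_segment ℝ _ _)

lemma differentiableAt_cutLog {A B z : ℂ} (hz : z ∉ segment ℝ A B) :
    DifferentiableAt ℂ (cutLog A B) z := by
  refine DifferentiableAt.clog (DifferentiableAt.fun_div (by fun_prop) (by fun_prop) ?_)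
    (div_mem_slitPlane hz)
  exact sub_ne_zero.2 (ne_left_of_notMem_segment hz)

lemma differentiableAt_cutSqrt {A B z : ℂ} (hz : z ∉ segment ℝ A B) :
    DifferentiableAt ℂ (cutSqrt A B) z :=
  ((differentiableAt_cutLog hz).div_const 2).cexp

lemma cutSqrt_sq {A B z : ℂ} (hA : z ≠ A) (hB : z ≠ B) :
    cutSqrt A B z ^ 2 = (z - B) / (z - A) := by
  rw [cutSqrt, ← Complex.exp_nat_mul, cutLog, Nat.cast_two, mul_div_cancel₀ _ two_ne_zero,
    Complex.exp_log (div_ne_zero (sub_ne_zero.2 hB) (sub_ne_zero.2 hA))]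

/-- The argument of the quotient lies strictly between `-π` and `π`, and its half between `-π/2` and
`π/2`. This positivity keeps sums such as `cutSqrt A B z + cutSqrt A B e` on the principal branch of
the logarithm. -/
lemma cutSqrt_re_pos {A B z : ℂ} (hz : z ∉ segment ℝ A B) : 0 < (cutSqrt A B z).re := by
  have h := (Complex.mem_slitPlane_iff_arg.1 (div_mem_slitPlane hz)).1
  have h1 := Complex.arg_le_pi ((z - B) / (z - A))
  have h2 := Complex.neg_pi_lt_arg ((z - B) / (z - A))
  have h3 : Complex.arg ((z - B) / (z - A)) < Real.pi := lt_of_le_of_ne h1 h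
  rw [cutSqrt, Complex.exp_re]
  refine mul_pos (Real.exp_pos _) (Real.cos_pos_of_mem_Ioo ?_)
  have : (cutLog A B z / 2).im = Complex.arg ((z - B) / (z - A)) / 2 := by
    rw [cutLog, Complex.div_ofNat_im, Complex.log_im]
  rw [this]
  constructor <;> linarith

lemma cutLog_swap {A B z : ℂ} (hz : z ∉ segment ℝ A B) : cutLog B A z = -cutLog A B z := by
  rw [cutLog, cutLog, ← Complex.log_inv _ (Complex.mem_slitPlane_iff_arg.1 (div_mem_slitPlane
    hz)).1,
    inv_div]

lemma norm_exp_mul_cutLog {A B z : ℂ} (κ : ℝ) (hA : z ≠ A) (hB : z ≠ B) :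
    ‖Complex.exp (κ * cutLog A B z)‖ = ‖(z - B) / (z - A)‖ ^ κ := by
  have h : (z - B) / (z - A) ≠ 0 := div_ne_zero (sub_ne_zero.2 hB) (sub_ne_zero.2 hA)
  rw [Complex.norm_exp, Complex.re_ofReal_mul, cutLog, Complex.log_re, mul_comm κ,
    Real.rpow_def_of_pos (norm_pos_iff.2 h)]

lemma div_of_mem_openSegment {A B z : ℂ} (hAB : A ≠ B) (hz : z ∈ openSegment ℝ A B) :
    ∃ t : ℝ, 0 < t ∧ t < 1 ∧ z = A + t * (B - A) ∧
      (z - B) / (z - A) = -(((1 - t) / t : ℝ) : ℂ) := by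
  rw [openSegment_eq_image'] at hz
  obtain ⟨t, ⟨h0, h1⟩, rfl⟩ := hz
  refine ⟨t, h0, h1, by simp, ?_⟩
  have hBA : B - A ≠ 0 := sub_ne_zero.2 hAB.symm
  simp only [Complex.real_smul]
  push_cast
  rw [add_sub_cancel_left]
  field_simp
  ring

lemma leftSide_swap (a b : ℂ) : leftSide b a = rightSide a b := by
  ext w
  simp only [leftSide, rightSide, Set.mem_ofPred_eq, Complex.mul_im, Complex.sub_re,
    Complex.sub_im, Complex.conj_re, Complex.conj_im]
  constructor <;> intro h <;> nlinarith

lemma rightSide_swap (a b : ℂ) : rightSide b a = leftSide a b := (leftSide_swap b a).symm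

/-- The left side of the segment corresponds to the upper half-plane under the Möbius map and the
right side to the lower one. This fixes which boundary value of the logarithm occurs where. -/
lemma im_div_sub (A B w : ℂ) (hw : w ≠ A) : ((w - B) / (w - A)).im =
    ((w - A) * (starRingEnd ℂ) (B - A)).im / Complex.normSq (w - A) := by
  have hn : Complex.normSq (w - A) ≠ 0 := by
    simpa [Complex.normSq_eq_zero, sub_eq_zero] using hw
  rw [Complex.div_im]
  simp only [Complex.mul_im, Complex.sub_re, Complex.sub_im, Complex.conj_re, Complex.conj_im]
  field_simp
  ring

lemma tendsto_div_left {A B z : ℂ} (hz : z ≠ A) :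
    Tendsto (fun w => (w - B) / (w - A)) (𝓝[leftSide A B] z)
      (𝓝[{w | 0 ≤ w.im}] ((z - B) / (z - A))) := by
  refine tendsto_nhdsWithin_iff.2 ⟨?_, ?_⟩
  · refine Tendsto.mono_left (ContinuousAt.tendsto ?_) nhdsWithin_le_nhds
    exact ContinuousAt.div (by fun_prop) (by fun_prop) (sub_ne_zero.2 hz)
  · filter_upwards [self_mem_nhdsWithin, mem_nhdsWithin_of_mem_nhds (isOpen_ne.mem_nhds hz)]
      with w hw hwA
    show 0 ≤ ((w - B) / (w - A)).im
    rw [im_div_sub A B w hwA]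
    exact div_nonneg (le_of_lt hw) (Complex.normSq_nonneg _)

lemma tendsto_div_right {A B z : ℂ} (hz : z ≠ A) :
    Tendsto (fun w => (w - B) / (w - A)) (𝓝[rightSide A B] z)
      (𝓝[{w | w.im < 0}] ((z - B) / (z - A))) := by
  refine tendsto_nhdsWithin_iff.2 ⟨?_, ?_⟩
  · refine Tendsto.mono_left (ContinuousAt.tendsto ?_) nhdsWithin_le_nhds
    exact ContinuousAt.div (by fun_prop) (by fun_prop) (sub_ne_zero.2 hz)
  · filter_upwards [self_mem_nhdsWithin, mem_nhdsWithin_of_mem_nhds (isOpen_ne.mem_nhds hz)]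
      with w hw hwA
    show ((w - B) / (w - A)).im < 0
    rw [im_div_sub A B w hwA]
    exact div_neg_of_neg_of_pos hw (Complex.normSq_pos.2 (sub_ne_zero.2 hwA))

/-- The boundary values of `cutLog` on the cut. -/
lemma tendsto_cutLog {A B z : ℂ} (hAB : A ≠ B) (hz : z ∈ openSegment ℝ A B) :
    Tendsto (cutLog A B) (𝓝[leftSide A B] z)
      (𝓝 (Real.log ‖(z - B) / (z - A)‖ + Real.pi * Complex.I)) ∧
    Tendsto (cutLog A B) (𝓝[rightSide A B] z)
      (𝓝 (Real.log ‖(z - B) / (z - A)‖ - Real.pi * Complex.I)) := by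
  obtain ⟨t, h0, h1, hzt, hdiv⟩ := div_of_mem_openSegment hAB hz
  have hzA : z ≠ A := by
    rintro rfl
    exact hAB (left_mem_openSegment_iff.1 hz)
  have hpos : 0 < (1 - t) / t := div_pos (by linarith) h0
  have hre : ((z - B) / (z - A)).re < 0 := by
    rw [hdiv, Complex.neg_re, Complex.ofReal_re]; linarith
  have him : ((z - B) / (z - A)).im = 0 := by
    rw [hdiv, Complex.neg_im, Complex.ofReal_im, neg_zero]
  exact ⟨(Complex.tendsto_log_nhdsWithin_im_nonneg_of_re_neg_of_im_zero hre him).comp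
    (tendsto_div_left hzA), (Complex.tendsto_log_nhdsWithin_im_neg_of_re_neg_of_im_zero hre
    him).comp
    (tendsto_div_right hzA)⟩

/-- The boundary values of `cutSqrt` on the cut are `± i σ`. -/
lemma tendsto_cutSqrt {A B z : ℂ} (hAB : A ≠ B) (hz : z ∈ openSegment ℝ A B) :
    ∃ σ : ℝ, 0 < σ ∧ (z - B) / (z - A) = -(σ : ℂ) ^ 2 ∧
      Tendsto (cutSqrt A B) (𝓝[leftSide A B] z) (𝓝 (Complex.I * σ)) ∧
      Tendsto (cutSqrt A B) (𝓝[rightSide A B] z) (𝓝 (-(Complex.I * σ))) := by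
  obtain ⟨t, h0, h1, hzt, hdiv⟩ := div_of_mem_openSegment hAB hz
  obtain ⟨hl, hr⟩ := tendsto_cutLog hAB hz
  have hpos : 0 < (1 - t) / t := div_pos (by linarith) h0
  have hn : ‖(z - B) / (z - A)‖ = (1 - t) / t := by
    rw [hdiv, norm_neg, Complex.norm_real, Real.norm_of_nonneg hpos.le]
  rw [hn] at hl hr
  have he : Complex.exp ((Real.log ((1 - t) / t) : ℂ) / 2) = (√((1 - t) / t) : ℝ) := by
    rw [← Complex.ofReal_ofNat 2, ← Complex.ofReal_div, ← Complex.ofReal_exp]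
    congr 1
    rw [← Real.log_sqrt hpos.le, Real.exp_log (Real.sqrt_pos.2 hpos)]
  refine ⟨√((1 - t) / t), Real.sqrt_pos.2 hpos, ?_, ?_, ?_⟩
  · rw [hdiv, ← Complex.ofReal_pow, Real.sq_sqrt hpos.le]
  · have := (Complex.continuous_exp.tendsto _).comp (hl.div_const 2)
    refine tendsto_nhds_of_eq this ?_
    rw [add_div, Complex.exp_add, he, mul_div_right_comm, Complex.exp_pi_div_two_mul_I, mul_comm]
  · have := (Complex.continuous_exp.tendsto _).comp (hr.div_const 2)
    refine tendsto_nhds_of_eq this ?_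
    rw [sub_div, Complex.exp_sub, he, mul_div_right_comm, Complex.exp_pi_div_two_mul_I,
      div_eq_mul_inv, Complex.inv_I]
    ring

/-! ### The scalar function with a constant jump on a segment attached to the cut -/

/-- A branch of `log ((s(e) - s(z)) / (s(e) + s(z)))`, where `s = cutSqrt A B`, with a cut along the
segments from `A` to `B` and from `A` to `e`. -/
noncomputable def szegoLog (A B e z : ℂ) : ℂ :=
  cutLog A e z - 2 * Complex.log (cutSqrt A B z + cutSqrt A B e) -
    Complex.log (-((e - A) / (B - A)))

lemma add_mem_slitPlane {a b : ℂ} (ha : 0 ≤ a.re) (hb : 0 < b.re) : a + b ∈ Complex.slitPlane :=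
  Or.inl (by rw [Complex.add_re]; linarith)

lemma differentiableAt_log_cutSqrt_add {A B e z : ℂ} (he : e ∉ segment ℝ A B)
    (hz : z ∉ segment ℝ A B) :
    DifferentiableAt ℂ (fun z => Complex.log (cutSqrt A B z + cutSqrt A B e)) z :=
  ((differentiableAt_cutSqrt hz).add_const _).clog
    (add_mem_slitPlane (cutSqrt_re_pos hz).le (cutSqrt_re_pos he))

lemma differentiableAt_szegoLog {A B e z : ℂ} (he : e ∉ segment ℝ A B)
    (hz : z ∉ segment ℝ A B) (hz' : z ∉ segment ℝ A e) :
    DifferentiableAt ℂ (szegoLog A B e) z :=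
  ((differentiableAt_cutLog hz').fun_sub
    ((differentiableAt_log_cutSqrt_add he hz).const_mul 2)).sub_const _

/-- Across the segment from `A` to `e` only the summand `cutLog A e` jumps. -/
lemma tendsto_szegoLog_branch {A B e z : ℂ} (he : e ∉ segment ℝ A B)
    (hz : z ∈ openSegment ℝ A e) (hz' : z ∉ segment ℝ A B) :
    ∃ L, Tendsto (szegoLog A B e) (𝓝[leftSide A e] z) (𝓝 (L + 2 * Real.pi * Complex.I)) ∧
      Tendsto (szegoLog A B e) (𝓝[rightSide A e] z) (𝓝 L) := by
  obtain ⟨hl, hr⟩ := tendsto_cutLog (ne_left_of_notMem_segment he).symm hz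
  have hc : ContinuousAt (fun z => 2 * Complex.log (cutSqrt A B z + cutSqrt A B e)) z :=
    ((differentiableAt_log_cutSqrt_add he hz').const_mul 2).continuousAt
  refine ⟨_, ?_, (hr.sub (hc.tendsto.mono_left nhdsWithin_le_nhds)).sub_const _⟩
  have := (hl.sub (hc.tendsto.mono_left nhdsWithin_le_nhds)).sub_const
    (Complex.log (-((e - A) / (B - A))))
  refine tendsto_nhds_of_eq this ?_
  ring

/-- The factors `ζ` and `p + ζ⁻¹` have imaginary parts of opposite sign, so their arguments cannot
add up beyond `±π`. This excludes a stray `2πi` in the boundary values of `szegoLog`. -/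
lemma log_one_add_mul {ζ : ℂ} (hζ : ζ ∈ Complex.slitPlane) {p : ℝ} (hp : 0 < p) :
    Complex.log (1 + p * ζ) = Complex.log ζ + Complex.log (p + ζ⁻¹) := by
  have hζ0 : ζ ≠ 0 := Complex.slitPlane_ne_zero hζ
  have hn : 0 < Complex.normSq ζ := Complex.normSq_pos.2 hζ0
  have him : (p + ζ⁻¹ : ℂ).im = -ζ.im / Complex.normSq ζ := by simp
  have hre : (p + ζ⁻¹ : ℂ).re = p + ζ.re / Complex.normSq ζ := by simp
  have hmul : 1 + p * ζ = ζ * (p + ζ⁻¹) := by field_simp; ring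
  have hne : (p + ζ⁻¹ : ℂ) ≠ 0 := by
    intro h0
    rcases hζ with h | h
    · have := congrArg Complex.re h0
      rw [hre, Complex.zero_re] at this
      have : 0 < ζ.re / Complex.normSq ζ := div_pos h hn
      linarith
    · have := congrArg Complex.im h0
      rw [him, Complex.zero_im, div_eq_zero_iff] at this
      rcases this with h' | h'
      · exact h (by linarith)
      · exact hn.ne' h'
  rw [hmul]
  refine Complex.log_mul hζ0 hne ?_
  have a1 := Complex.neg_pi_lt_arg ζ
  have a2 := Complex.arg_le_pi ζ
  have a3 := Complex.neg_pi_lt_arg (p + ζ⁻¹ : ℂ)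
  have a4 := Complex.arg_le_pi (p + ζ⁻¹ : ℂ)
  rcases lt_trichotomy ζ.im 0 with h | h | h
  · have h1 := Complex.arg_neg_iff.2 h
    have h2 : 0 ≤ Complex.arg (p + ζ⁻¹ : ℂ) := Complex.arg_nonneg_iff.2 (by
      rw [him]; exact div_nonneg (by linarith) hn.le)
    constructor <;> linarith
  · have hre0 : 0 < ζ.re := by
      rcases hζ with h' | h'
      · exact h'
      · exact absurd h h'
    have h1 : Complex.arg ζ = 0 := Complex.arg_eq_zero_iff.2 ⟨hre0.le, h⟩
    have h2 : Complex.arg (p + ζ⁻¹ : ℂ) = 0 := Complex.arg_eq_zero_iff.2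
      ⟨by rw [hre]; positivity, by rw [him, h]; simp⟩
    rw [h1, h2, add_zero]
    exact ⟨by linarith [Real.pi_pos], Real.pi_pos.le⟩
  · have h1 := Complex.arg_nonneg_iff.2 h.le
    have h2 : Complex.arg (p + ζ⁻¹ : ℂ) < 0 := Complex.arg_neg_iff.2 (by
      rw [him]; exact div_neg_of_neg_of_pos (by linarith) hn)
    constructor <;> linarith

lemma log_mul_of_re_pos {a b : ℂ} (ha : 0 < a.re) (hb : 0 < b.re) :
    Complex.log (a * b) = Complex.log a + Complex.log b := by
  have h1 := abs_lt.1 (Complex.abs_arg_lt_pi_div_two_iff.2 (Or.inl ha))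
  have h2 := abs_lt.1 (Complex.abs_arg_lt_pi_div_two_iff.2 (Or.inl hb))
  refine Complex.log_mul ?_ ?_ ⟨by linarith [h1.1, h2.1], by linarith [h1.2, h2.2]⟩
  · rintro rfl; simp at ha
  · rintro rfl; simp at hb

/-- On the cut the boundary values of `szegoLog` are opposite. -/
lemma tendsto_szegoLog_cut {A B e z : ℂ} (hAB : A ≠ B) (he : e ∉ segment ℝ A B)
    (hη : -((e - A) / (B - A)) ∈ Complex.slitPlane)
    (hz : z ∈ openSegment ℝ A B) (hz' : z ∉ segment ℝ A e) :
    ∃ L, Tendsto (szegoLog A B e) (𝓝[leftSide A B] z) (𝓝 L) ∧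
      Tendsto (szegoLog A B e) (𝓝[rightSide A B] z) (𝓝 (-L)) := by
  obtain ⟨t, ht0, ht1, hzt, hdiv⟩ := div_of_mem_openSegment hAB hz
  obtain ⟨σ, hσ, hσ2, hl, hr⟩ := tendsto_cutSqrt hAB hz
  have hc := (differentiableAt_cutLog hz').continuousAt.tendsto
  have hse := cutSqrt_re_pos he
  have m1 : Complex.I * σ + cutSqrt A B e ∈ Complex.slitPlane :=
    add_mem_slitPlane (by simp) hse
  have m2 : -(Complex.I * σ) + cutSqrt A B e ∈ Complex.slitPlane :=
    add_mem_slitPlane (by simp) hse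
  have Hl := ((hc.mono_left nhdsWithin_le_nhds).sub (((hl.add_const (cutSqrt A B e)).clog
      m1).const_mul
    2)).sub_const (Complex.log (-((e - A) / (B - A))))
  have Hr := ((hc.mono_left nhdsWithin_le_nhds).sub (((hr.add_const (cutSqrt A B e)).clog
      m2).const_mul
    2)).sub_const (Complex.log (-((e - A) / (B - A))))
  refine ⟨_, Hl, tendsto_nhds_of_eq Hr ?_⟩
  have heA : e - A ≠ 0 := sub_ne_zero.2 (ne_left_of_notMem_segment he)
  have ht0' : (t : ℂ) ≠ 0 := by exact_mod_cast ht0.ne'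
  -- With `η = -((e - A) / (B - A))`, both the product of the two boundary sums and `(z - e) / (z -
  -- A)` are expressed through `t⁻¹ + η⁻¹`. The normalizing constant `log η` in `szegoLog` is
  -- exactly what makes the two boundary values cancel.
  have e1 : Complex.log (Complex.I * σ + cutSqrt A B e) +
      Complex.log (-(Complex.I * σ) + cutSqrt A B e) =
      Complex.log ((t⁻¹ : ℝ) + (-((e - A) / (B - A)))⁻¹) := by
    rw [← log_mul_of_re_pos (by simpa using hse) (by simpa using hse)]
    congr 1
    have hs := cutSqrt_sq (ne_left_of_notMem_segment he) (ne_right_of_notMem_segment he)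
    have hσ3 : (σ : ℂ) ^ 2 = (1 - t) / t := by
      rw [hdiv] at hσ2
      push_cast at hσ2
      linear_combination hσ2
    have : (Complex.I * σ + cutSqrt A B e) * (-(Complex.I * σ) + cutSqrt A B e) =
        cutSqrt A B e ^ 2 + (σ : ℂ) ^ 2 := by
      ring_nf
      rw [Complex.I_sq]
      ring
    rw [this, hs, hσ3]
    push_cast
    field_simp
    ring
  have e2 : cutLog A e z = Complex.log (-((e - A) / (B - A))) +
      Complex.log ((t⁻¹ : ℝ) + (-((e - A) / (B - A)))⁻¹) := by
    rw [← log_one_add_mul hη (inv_pos.2 ht0), cutLog]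
    congr 1
    rw [hzt]
    push_cast
    rw [add_sub_cancel_left]
    field_simp
    ring
  linear_combination 2 * e2 - 2 * e1

/-- The difference `s(e)² - s(z)²` is a constant multiple of `(z - e) / (z - A)`. Therefore
`szegoLog` can put its branch cut on a prescribed segment through `cutLog A e` and still be a
logarithm of the quotient on the right. -/
lemma exp_szegoLog {A B e z : ℂ} (hAB : A ≠ B) (he : e ∉ segment ℝ A B) (hz : z ∉ segment ℝ A B)
    (hze : z ≠ e) : Complex.exp (szegoLog A B e z) =
      (cutSqrt A B e - cutSqrt A B z) / (cutSqrt A B e + cutSqrt A B z) := by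
  have hzA := sub_ne_zero.2 (ne_left_of_notMem_segment hz)
  have heA := sub_ne_zero.2 (ne_left_of_notMem_segment he)
  have hBA : B - A ≠ 0 := sub_ne_zero.2 hAB.symm
  have hs := Complex.slitPlane_ne_zero
    (add_mem_slitPlane (cutSqrt_re_pos hz).le (cutSqrt_re_pos he))
  have h1 := cutSqrt_sq (ne_left_of_notMem_segment hz) (ne_right_of_notMem_segment hz)
  have h2 := cutSqrt_sq (ne_left_of_notMem_segment he) (ne_right_of_notMem_segment he)
  rw [szegoLog, Complex.exp_sub, Complex.exp_sub, cutLog,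
    Complex.exp_log (div_ne_zero (sub_ne_zero.2 hze) hzA),
    Complex.exp_log (neg_ne_zero.2 (div_ne_zero heA hBA)), two_mul, Complex.exp_add,
    Complex.exp_log hs]
  have h3 : (z - e) / (z - A) = -((e - A) / (B - A)) *
      ((cutSqrt A B e - cutSqrt A B z) * (cutSqrt A B e + cutSqrt A B z)) := by
    have : (cutSqrt A B e - cutSqrt A B z) * (cutSqrt A B e + cutSqrt A B z) =
      cutSqrt A B e ^ 2 - cutSqrt A B z ^ 2 := by ring
    rw [this, h1, h2]
    field_simp
    ring
  rw [h3]
  have : -((e - A) / (B - A)) ≠ 0 := neg_ne_zero.2 (div_ne_zero heA hBA)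
  rw [add_comm (cutSqrt A B z)]
  field_simp

lemma norm_exp_mul_szegoLog (κ : ℝ) (A B e z : ℂ) :
    ‖Complex.exp (κ * szegoLog A B e z)‖ = ‖Complex.exp (szegoLog A B e z)‖ ^ κ := by
  rw [Complex.norm_exp, Complex.norm_exp, Complex.re_ofReal_mul, ← Real.exp_mul, mul_comm]

lemma tendsto_cutSqrt_right {A B : ℂ} (hAB : A ≠ B) :
    Tendsto (cutSqrt A B) (𝓝[≠] B) (𝓝 0) := by
  rw [tendsto_zero_iff_norm_tendsto_zero]
  have h1 : Tendsto (fun z => ‖(z - B) / (z - A)‖ ^ (1 / 2 : ℝ)) (𝓝[≠] B) (𝓝 0) := by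
    have hc : ContinuousAt (fun z => ‖(z - B) / (z - A)‖ ^ (1 / 2 : ℝ)) B := by
      have h0 : ContinuousAt (fun z => (z - B) / (z - A)) B :=
        ContinuousAt.div (by fun_prop) (by fun_prop) (sub_ne_zero.2 hAB.symm)
      exact h0.norm.rpow_const (Or.inr (by norm_num))
    have := hc.tendsto.mono_left (nhdsWithin_le_nhds (s := {B}ᶜ))
    simpa using this
  refine h1.congr' ?_
  filter_upwards [self_mem_nhdsWithin,
    mem_nhdsWithin_of_mem_nhds (isOpen_ne.mem_nhds hAB.symm)] with z hz hzA
  rw [← norm_exp_mul_cutLog _ hzA hz, cutSqrt]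
  congr 2
  push_cast
  ring

lemma tendsto_cutSqrt_left_inv {A B : ℂ} (hAB : A ≠ B) :
    Tendsto (fun z => (cutSqrt A B z)⁻¹) (𝓝[≠] A) (𝓝 0) := by
  rw [tendsto_zero_iff_norm_tendsto_zero]
  have h1 : Tendsto (fun z => ‖(z - A) / (z - B)‖ ^ (1 / 2 : ℝ)) (𝓝[≠] A) (𝓝 0) := by
    have hc : ContinuousAt (fun z => ‖(z - A) / (z - B)‖ ^ (1 / 2 : ℝ)) A := by
      have h0 : ContinuousAt (fun z => (z - A) / (z - B)) A :=
        ContinuousAt.div (by fun_prop) (by fun_prop) (sub_ne_zero.2 hAB)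
      exact h0.norm.rpow_const (Or.inr (by norm_num))
    have := hc.tendsto.mono_left (nhdsWithin_le_nhds (s := {A}ᶜ))
    simpa using this
  refine h1.congr' ?_
  filter_upwards [self_mem_nhdsWithin,
    mem_nhdsWithin_of_mem_nhds (isOpen_ne.mem_nhds hAB)] with z hz hzB
  have h2 := norm_exp_mul_cutLog (1 / 2) hz hzB
  rw [cutSqrt, norm_inv, ← inv_div (z - B), norm_inv, Real.inv_rpow (norm_nonneg _), ← h2]
  congr 3
  push_cast
  ring

/-- `exp (κ szegoLog)` is bounded near the two ends of the cut. -/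
lemma isBigO_exp_szegoLog {A B e p : ℂ} (hAB : A ≠ B) (he : e ∉ segment ℝ A B)
    (hp : p = A ∨ p = B) (κ : ℝ) :
    (fun z => Complex.exp (κ * szegoLog A B e z)) =O[𝓝[(segment ℝ A B)ᶜ] p]
      fun _ => (1 : ℂ) := by
  have hse : cutSqrt A B e ≠ 0 := Complex.exp_ne_zero _
  have hpe : p ≠ e := by
    rcases hp with rfl | rfl
    · exact (ne_left_of_notMem_segment he).symm
    · exact (ne_right_of_notMem_segment he).symm
  have hsub : 𝓝[(segment ℝ A B)ᶜ] p ≤ 𝓝[≠] p := by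
    refine nhdsWithin_mono _ fun z hz => ?_
    rcases hp with rfl | rfl
    · exact ne_left_of_notMem_segment hz
    · exact ne_right_of_notMem_segment hz
  -- At `B` the square root tends to `0` and the quotient to `1`. At `A` it tends to infinity and
  -- the quotient to `-1`. The modulus tends to `1` in both cases, so every real power is bounded.
  have hlim : Tendsto (fun z => ‖Complex.exp (szegoLog A B e z)‖) (𝓝[(segment ℝ A B)ᶜ] p) (𝓝 1) :=
      by
    have hev : ∀ᶠ z in 𝓝[(segment ℝ A B)ᶜ] p, Complex.exp (szegoLog A B e z) =
        (cutSqrt A B e - cutSqrt A B z) / (cutSqrt A B e + cutSqrt A B z) := by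
      filter_upwards [self_mem_nhdsWithin, mem_nhdsWithin_of_mem_nhds (isOpen_ne.mem_nhds hpe)]
        with z hz hze using exp_szegoLog hAB he hz hze
    rcases hp with rfl | rfl
    · have h1 := (tendsto_cutSqrt_left_inv hAB).mono_left hsub
      have h2 : Tendsto (fun z => ‖(cutSqrt p B e * (cutSqrt p B z)⁻¹ - 1) /
          (cutSqrt p B e * (cutSqrt p B z)⁻¹ + 1)‖) (𝓝[(segment ℝ p B)ᶜ] p) (𝓝 1) := by
        have := (((h1.const_mul (cutSqrt p B e)).sub_const 1).div
          ((h1.const_mul (cutSqrt p B e)).add_const 1) (by simp)).norm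
        simpa using this
      refine h2.congr' ?_
      filter_upwards [hev] with z hz
      rw [hz]
      have : cutSqrt p B z ≠ 0 := Complex.exp_ne_zero _
      congr 1
      field_simp
    · have h1 := (tendsto_cutSqrt_right hAB).mono_left hsub
      have h2 := ((h1.const_sub (cutSqrt A p e)).div (h1.const_add (cutSqrt A p e))
        (by simpa using hse)).norm
      rw [sub_zero, add_zero, div_self hse, norm_one] at h2
      refine h2.congr' ?_
      filter_upwards [hev] with z hz
      rw [hz, Pi.div_apply]
  have h3 : Tendsto (fun z => ‖Complex.exp (κ * szegoLog A B e z)‖) (𝓝[(segment ℝ A B)ᶜ] p)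
      (𝓝 1) := by
    simp only [norm_exp_mul_szegoLog]
    simpa using hlim.rpow_const (p := κ) (Or.inl one_ne_zero)
  exact (isBigO_norm_left.1 (h3.isBigO_one ℂ))

/-! ### The phase function -/

/-- The function `g` with `g₊ + g₋ = 2θ` on the cut from `A` to `B`, holomorphic off the cut and at
infinity. -/
noncomputable def gTheta (A B : ℂ) (x t : ℝ) (z : ℂ) : ℂ :=
  t * ((B - A) / 2) ^ 2 * (((1 - cutSqrt A B z) / (1 + cutSqrt A B z)) ^ 2 + 1) +
    (4 * t * ((A + B) / 2) + x) * ((B - A) / 2) * ((1 - cutSqrt A B z) / (1 + cutSqrt A B z)) +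
    theta ((A + B) / 2) x t

lemma one_add_ne_zero_of_re_nonneg {s : ℂ} (hs : 0 ≤ s.re) : 1 + s ≠ 0 := by
  intro h
  have := congrArg Complex.re h
  simp only [Complex.add_re, Complex.one_re, Complex.zero_re] at this
  linarith

lemma differentiableAt_gTheta {A B z : ℂ} (x t : ℝ) (hz : z ∉ segment ℝ A B) :
    DifferentiableAt ℂ (gTheta A B x t) z := by
  have hs := differentiableAt_cutSqrt hz
  have hv : DifferentiableAt ℂ (fun z => (1 - cutSqrt A B z) / (1 + cutSqrt A B z)) z :=
    (hs.const_sub 1).fun_div (hs.const_add 1) (one_add_ne_zero_of_re_nonneg (cutSqrt_re_pos hz).le)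
  exact (((hv.pow 2).add_const _).const_mul _ |>.add (hv.const_mul _)).add_const _

/-- The Cayley transform maps the right half-plane into the unit disc. This bounds `gTheta` near the
ends of its cut. -/
lemma norm_one_sub_div_one_add_le {s : ℂ} (hs : 0 ≤ s.re) : ‖(1 - s) / (1 + s)‖ ≤ 1 := by
  rw [norm_div]
  refine div_le_one_of_le₀ ?_ (norm_nonneg _)
  refine abs_le_of_sq_le_sq' ?_ (norm_nonneg _) |>.2
  rw [Complex.sq_norm, Complex.sq_norm, Complex.normSq_apply, Complex.normSq_apply]
  simp only [Complex.sub_re, Complex.sub_im, Complex.add_re, Complex.add_im, Complex.one_re,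
    Complex.one_im]
  nlinarith

lemma exists_bound_gTheta (A B : ℂ) (x t : ℝ) :
    ∃ C, ∀ z ∉ segment ℝ A B, ‖gTheta A B x t z‖ ≤ C := by
  refine ⟨‖(t : ℂ) * ((B - A) / 2) ^ 2‖ * (1 ^ 2 + 1) +
    ‖(4 * t * ((A + B) / 2) + x) * ((B - A) / 2)‖ * 1 + ‖theta ((A + B) / 2) x t‖, fun z hz => ?_⟩
  have hv := norm_one_sub_div_one_add_le (cutSqrt_re_pos hz).le
  refine (norm_add₃_le).trans ?_
  gcongr ?_ + ?_ + _
  · rw [norm_mul]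
    gcongr
    refine (norm_add_le _ _).trans ?_
    rw [norm_pow, norm_one]
    gcongr
  · rw [norm_mul]
    gcongr

/-- The quantity `v = (1 - s) / (1 + s)` with `s = cutSqrt A B z` is a Joukowski variable: `2 z - (A
+ B) = (B - A) / 2 * (v + v⁻¹)`, and its two boundary values on the cut are inverse to each other.
Since `θ` is quadratic, `2θ` is a symmetric Laurent polynomial in `v`, and `gTheta` keeps its
positive powers and half of its constant term. -/
lemma tendsto_gTheta_cut {A B z : ℂ} (x t : ℝ) (hAB : A ≠ B) (hz : z ∈ openSegment ℝ A B) :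
    ∃ P N, Tendsto (gTheta A B x t) (𝓝[leftSide A B] z) (𝓝 P) ∧
      Tendsto (gTheta A B x t) (𝓝[rightSide A B] z) (𝓝 N) ∧ P + N = 2 * theta z x t := by
  obtain ⟨σ, hσ, hσ2, hl, hr⟩ := tendsto_cutSqrt hAB hz
  have hzA : z - A ≠ 0 := by
    rw [sub_ne_zero]; rintro rfl
    exact hAB (left_mem_openSegment_iff.1 hz)
  have n1 : 1 + Complex.I * (σ : ℂ) ≠ 0 := one_add_ne_zero_of_re_nonneg (by simp)
  have n2 : 1 + -(Complex.I * (σ : ℂ)) ≠ 0 := one_add_ne_zero_of_re_nonneg (by simp)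
  have lim : ∀ (l : Filter ℂ) (s : ℂ), Tendsto (cutSqrt A B) l (𝓝 s) → 1 + s ≠ 0 →
      Tendsto (gTheta A B x t) l (𝓝 (t * ((B - A) / 2) ^ 2 * (((1 - s) / (1 + s)) ^ 2 + 1) +
        (4 * t * ((A + B) / 2) + x) * ((B - A) / 2) * ((1 - s) / (1 + s)) +
        theta ((A + B) / 2) x t)) := by
    intro l s h hs
    have hv := (h.const_sub 1).div (h.const_add 1) hs
    exact ((((hv.pow 2).add_const _).const_mul _).add (hv.const_mul _)).add_const _
  refine ⟨_, _, lim _ _ hl n1, lim _ _ hr n2, ?_⟩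
  set v := (1 - Complex.I * (σ : ℂ)) / (1 + Complex.I * σ) with hv
  set w := (1 - -(Complex.I * (σ : ℂ))) / (1 + -(Complex.I * σ)) with hw
  have hvw : v * w = 1 := by rw [hv, hw]; field_simp; ring
  have hII : Complex.I ^ 2 = -1 := Complex.I_sq
  have hn12 : 1 + (σ : ℂ) ^ 2 ≠ 0 := by
    have : (1 : ℝ) + σ ^ 2 ≠ 0 := by positivity
    exact_mod_cast this
  have hsum : v + w = 2 * (1 - σ ^ 2) / (1 + σ ^ 2) := by
    have e : (1 + Complex.I * (σ : ℂ)) * (1 + -(Complex.I * σ)) = 1 + σ ^ 2 := by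
      linear_combination -(σ : ℂ) ^ 2 * hII
    rw [hv, hw, div_add_div _ _ n1 n2, e]
    congr 1
    linear_combination 2 * (σ : ℂ) ^ 2 * hII
  have hzm : (B - A) / 2 * (v + w) = 2 * z - (A + B) := by
    rw [hsum]
    rw [div_eq_iff hzA] at hσ2
    field_simp
    linear_combination (-2) * hσ2
  have : theta z x t = 2 * t * z ^ 2 + x * z := rfl
  have h2 : theta ((A + B) / 2) x t = 2 * t * ((A + B) / 2) ^ 2 + x * ((A + B) / 2) := rfl
  rw [this, h2]
  linear_combination (t * ((B - A) / 2 * (v + w) + (2 * z - (A + B))) +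
    (4 * t * ((A + B) / 2) + x)) * hzm - 2 * t * ((B - A) / 2) ^ 2 * hvw

/-! ### Matrix functions and their jumps -/

/-- The relation between the boundary values at a single point of an oriented segment. -/
def JumpAt (Ψ : ℂ → Mat) (a b z : ℂ) (M : Mat) : Prop :=
  ∃ Ψp Ψm : Mat, Tendsto Ψ (𝓝[leftSide a b] z) (𝓝 Ψp) ∧
    Tendsto Ψ (𝓝[rightSide a b] z) (𝓝 Ψm) ∧ Ψp = Ψm * M

lemma JumpAt.swap {Ψ : ℂ → Mat} {a b z : ℂ} {M M' : Mat} (h : JumpAt Ψ a b z M)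
    (hM : M * M' = 1) : JumpAt Ψ b a z M' := by
  obtain ⟨P, N, h1, h2, h3⟩ := h
  refine ⟨N, P, by rwa [leftSide_swap], by rwa [rightSide_swap], ?_⟩
  rw [h3, Matrix.mul_assoc, hM, Matrix.mul_one]

lemma JumpAt.mul_left {Ψ C : ℂ → Mat} {a b z : ℂ} {M : Mat} (h : JumpAt Ψ a b z M)
    (hC : ∀ i j, ContinuousAt (fun w => C w i j) z) : JumpAt (fun w => C w * Ψ w) a b z M := by
  obtain ⟨P, N, h1, h2, h3⟩ := h
  have hC' : Tendsto C (𝓝 z) (𝓝 (C z)) := tendsto_mat_iff.2 hC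
  exact ⟨C z * P, C z * N, tendsto_mat_mul (hC'.mono_left nhdsWithin_le_nhds) h1,
    tendsto_mat_mul (hC'.mono_left nhdsWithin_le_nhds) h2, by rw [h3, Matrix.mul_assoc]⟩

lemma JumpAt.congr {Ψ Ψ' : ℂ → Mat} {a b z : ℂ} {M : Mat} (h : JumpAt Ψ a b z M)
    (hΨ : ∀ᶠ w in 𝓝 z, w ∈ offLine a b → Ψ w = Ψ' w) : JumpAt Ψ' a b z M := by
  obtain ⟨P, N, h1, h2, h3⟩ := h
  refine ⟨P, N, h1.congr' ?_, h2.congr' ?_, h3⟩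
  · filter_upwards [self_mem_nhdsWithin, mem_nhdsWithin_of_mem_nhds hΨ] with w hw hw'
    exact hw' (by rw [offLine_eq]; exact Or.inl hw)
  · filter_upwards [self_mem_nhdsWithin, mem_nhdsWithin_of_mem_nhds hΨ] with w hw hw'
    exact hw' (by rw [offLine_eq]; exact Or.inr hw)

/-- The rotation matrix `exp (-σ₂ l / 4)`. -/
noncomputable def rot (l : ℂ) : Mat :=
  !![Complex.cosh (l / 4), Complex.I * Complex.sinh (l / 4);
    -(Complex.I * Complex.sinh (l / 4)), Complex.cosh (l / 4)]

lemma expSigma3_add (a b : ℂ) : expSigma3 (a + b) = expSigma3 a * expSigma3 b := by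
  ext i j
  fin_cases i <;> fin_cases j <;>
    simp [expSigma3, Matrix.mul_apply, Complex.exp_add, mul_comm]

lemma expSigma3_zero : expSigma3 0 = 1 := by
  ext i j
  fin_cases i <;> fin_cases j <;> simp [expSigma3]

lemma expSigma3_mul_neg (a : ℂ) : expSigma3 a * expSigma3 (-a) = 1 := by
  rw [← expSigma3_add, add_neg_cancel, expSigma3_zero]

lemma expSigma3_neg_mul (a : ℂ) : expSigma3 (-a) * expSigma3 a = 1 := by
  rw [← expSigma3_add, neg_add_cancel, expSigma3_zero]

lemma sigma2_mul_expSigma3 (a : ℂ) :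
    -(Complex.I • sigma2) * expSigma3 a = expSigma3 (-a) * -(Complex.I • sigma2) := by
  ext i j
  fin_cases i <;> fin_cases j <;> simp [expSigma3, sigma2, Matrix.mul_apply]

lemma rot_add_two_pi (l : ℂ) :
    rot (l + 2 * Real.pi * Complex.I) = rot l * -(Complex.I • sigma2) := by
  have e : (l + 2 * Real.pi * Complex.I) / 4 = l / 4 + Real.pi / 2 * Complex.I := by ring
  have h1 : Complex.cosh (Real.pi / 2 * Complex.I) = 0 := by
    rw [Complex.cosh_mul_I, Complex.cos_pi_div_two]
  have h2 : Complex.sinh (Real.pi / 2 * Complex.I) = Complex.I := by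
    rw [Complex.sinh_mul_I, Complex.sin_pi_div_two, one_mul]
  have hII : Complex.I * Complex.I = -1 := Complex.I_mul_I
  ext i j
  fin_cases i <;> fin_cases j <;>
    simp [rot, sigma2, Matrix.mul_apply, e, Complex.cosh_add, Complex.sinh_add, h1, h2] <;>
    first
    | ring1
    | linear_combination Complex.cosh (l / 4) * hII
    | linear_combination -Complex.cosh (l / 4) * hII

lemma det_rot (l : ℂ) : (rot l).det = 1 := by
  have := Complex.cosh_sq_sub_sinh_sq (l / 4)
  rw [rot, Matrix.det_fin_two_of]
  linear_combination this + Complex.sinh (l / 4) ^ 2 * Complex.I_sq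

lemma continuous_rot_apply (i j : Fin 2) : Continuous fun l => rot l i j := by
  have h1 : Continuous fun l : ℂ => Complex.cosh (l / 4) :=
    Complex.continuous_cosh.comp (by fun_prop)
  have h2 : Continuous fun l : ℂ => Complex.sinh (l / 4) :=
    Complex.continuous_sinh.comp (by fun_prop)
  fin_cases i <;> fin_cases j
  exacts [h1, h2.const_mul _ , (h2.const_mul _).neg, h1]

lemma differentiable_rot_apply (i j : Fin 2) : Differentiable ℂ fun l => rot l i j := by
  have h1 : Differentiable ℂ fun l : ℂ => Complex.cosh (l / 4) :=
    Complex.differentiable_cosh.comp (by fun_prop)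
  have h2 : Differentiable ℂ fun l : ℂ => Complex.sinh (l / 4) :=
    Complex.differentiable_sinh.comp (by fun_prop)
  fin_cases i <;> fin_cases j
  exacts [h1, h2.const_mul _ , (h2.const_mul _).neg, h1]

lemma differentiable_expSigma3_apply (i j : Fin 2) : Differentiable ℂ fun l => expSigma3 l i j := by
  fin_cases i <;> fin_cases j
  exacts [Complex.differentiable_exp, differentiable_const _, differentiable_const _,
    Complex.differentiable_exp.comp differentiable_neg]

lemma tendsto_rot {X : Type*} {l : Filter X} {f : X → ℂ} {a : ℂ} (h : Tendsto f l (𝓝 a)) :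
    Tendsto (fun w => rot (f w)) l (𝓝 (rot a)) :=
  tendsto_mat_iff.2 fun i j => ((continuous_rot_apply i j).tendsto a).comp h

lemma tendsto_expSigma3 {X : Type*} {l : Filter X} {f : X → ℂ} {a : ℂ} (h : Tendsto f l (𝓝 a)) :
    Tendsto (fun w => expSigma3 (f w)) l (𝓝 (expSigma3 a)) :=
  tendsto_mat_iff.2 fun i j => ((differentiable_expSigma3_apply i j).continuous.tendsto a).comp h

/-- This is the source of every `twist` jump, in the outer and the local parametrix alike. Across
the cut `cutLog` gains `2πi` and `rot` gains `-iσ₂`, and moving this matrix past `expSigma3`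
reverses the sign of the exponent. Hence only the sum of the boundary values of `J` matters. -/
lemma jumpAt_rot_mul_expSigma3 {A B z φ P N : ℂ} {J : ℂ → ℂ} (hAB : A ≠ B)
    (hz : z ∈ openSegment ℝ A B) (hl : Tendsto J (𝓝[leftSide A B] z) (𝓝 P))
    (hr : Tendsto J (𝓝[rightSide A B] z) (𝓝 N)) (hPN : P + N = 2 * (Complex.I * φ)) :
    JumpAt (fun w => rot (cutLog A B w) * expSigma3 (J w)) A B z (twist φ) := by
  obtain ⟨h1, h2⟩ := tendsto_cutLog hAB hz
  refine ⟨_, _, tendsto_mat_mul (tendsto_rot h1) (tendsto_expSigma3 hl),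
    tendsto_mat_mul (tendsto_rot h2) (tendsto_expSigma3 hr), ?_⟩
  have e1 : (Real.log ‖(z - B) / (z - A)‖ + Real.pi * Complex.I : ℂ) =
      (Real.log ‖(z - B) / (z - A)‖ - Real.pi * Complex.I) + 2 * Real.pi * Complex.I := by ring
  have e2 : P = -N + Complex.I * φ + Complex.I * φ := by linear_combination hPN
  have e3 : expSigma3 N * twist φ = -(Complex.I • sigma2) * expSigma3 P := by
    rw [twist, ← Matrix.mul_assoc, ← Matrix.mul_assoc, ← expSigma3_add,
      show N + -(Complex.I * φ) = -(-N + Complex.I * φ) by ring, ← sigma2_mul_expSigma3,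
      Matrix.mul_assoc, ← expSigma3_add, e2]
  rw [e1, rot_add_two_pi, Matrix.mul_assoc, Matrix.mul_assoc, e3]

lemma jumpAt_mul_expSigma3 {a b z ν N : ℂ} {C : ℂ → Mat} {J : ℂ → ℂ}
    (hC : ∀ i j, ContinuousAt (fun w => C w i j) z)
    (hl : Tendsto J (𝓝[leftSide a b] z) (𝓝 (N + ν)))
    (hr : Tendsto J (𝓝[rightSide a b] z) (𝓝 N)) :
    JumpAt (fun w => C w * expSigma3 (J w)) a b z (expSigma3 ν) :=
  JumpAt.mul_left ⟨_, _, tendsto_expSigma3 hl, tendsto_expSigma3 hr, expSigma3_add _ _⟩ hC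

/-! ### Growth at the ends of a cut -/

lemma isBigO_exp_cutLog_left {A B : ℂ} (hAB : A ≠ B) {κ : ℝ} (hκ : |κ| ≤ 1 / 4) :
    (fun z => Complex.exp (κ * cutLog A B z)) =O[𝓝[≠] A] fun z => ‖z - A‖ ^ (-(1 / 4) : ℝ) := by
  have hc : ContinuousAt (fun z => ‖z - B‖ ^ κ) A :=
    ContinuousAt.rpow_const (by fun_prop) (Or.inl (norm_ne_zero_iff.2 (sub_ne_zero.2 hAB)))
  have hb : (fun z => ‖z - B‖ ^ κ) =O[𝓝[≠] A] fun _ => (1 : ℝ) :=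
    (hc.tendsto.mono_left nhdsWithin_le_nhds).isBigO_one ℝ
  have h2 : (fun z => ‖z - A‖ ^ (-κ)) =O[𝓝[≠] A] fun z => ‖z - A‖ ^ (-(1 / 4) : ℝ) := by
    refine IsBigO.of_bound 1 ?_
    filter_upwards [self_mem_nhdsWithin, mem_nhdsWithin_of_mem_nhds
      (Metric.ball_mem_nhds A one_pos)] with z hz hz1
    have hz0 : 0 < ‖z - A‖ := norm_pos_iff.2 (sub_ne_zero.2 hz)
    rw [mem_ball_iff_norm] at hz1
    rw [one_mul, Real.norm_of_nonneg (by positivity), Real.norm_of_nonneg (by positivity)]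
    exact Real.rpow_le_rpow_of_exponent_ge hz0 hz1.le (by linarith [(abs_le.1 hκ).2])
  have h3 := hb.mul h2
  simp only [one_mul] at h3
  refine IsBigO.congr' (IsBigO.of_norm_left (f' := fun z => Complex.exp (κ * cutLog A B z))
    (h3.congr' ?_ EventuallyEq.rfl)) EventuallyEq.rfl EventuallyEq.rfl
  filter_upwards [self_mem_nhdsWithin, mem_nhdsWithin_of_mem_nhds (isOpen_ne.mem_nhds hAB)]
    with z hz hzB
  rw [norm_exp_mul_cutLog κ hz hzB, norm_div, Real.div_rpow (norm_nonneg _) (norm_nonneg _),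
    Real.rpow_neg (norm_nonneg _), div_eq_mul_inv]

lemma isBigO_exp_cutLog {A B p : ℂ} (hAB : A ≠ B) (hp : p = A ∨ p = B) {κ : ℝ}
    (hκ : |κ| ≤ 1 / 4) :
    (fun z => Complex.exp (κ * cutLog A B z)) =O[𝓝[≠] p] fun z => ‖z - p‖ ^ (-(1 / 4) : ℝ) := by
  rcases hp with rfl | rfl
  · exact isBigO_exp_cutLog_left hAB hκ
  · refine (isBigO_norm_left.1 (IsBigO.congr' (isBigO_norm_left.2 (isBigO_exp_cutLog_left hAB.symm
      (κ := -κ) (by rwa [abs_neg]))) ?_ EventuallyEq.rfl))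
    filter_upwards [self_mem_nhdsWithin, mem_nhdsWithin_of_mem_nhds (isOpen_ne.mem_nhds hAB.symm)]
      with z hz hzB
    rw [norm_exp_mul_cutLog _ hz hzB, norm_exp_mul_cutLog _ hzB hz, ← inv_div, norm_inv,
      Real.inv_rpow (norm_nonneg _), Real.rpow_neg (norm_nonneg _), inv_inv]

/-- The entries are combinations of `exp (± cutLog A B z / 4)`, of modulus `|(z - B) / (z -
A)|^{±1/4}`. This is where the exponent `1/4` of the growth condition comes from. -/
lemma isBigO_rot {A B p : ℂ} (hAB : A ≠ B) (hp : p = A ∨ p = B) (i j : Fin 2) :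
    (fun z => rot (cutLog A B z) i j) =O[𝓝[≠] p] fun z => ‖z - p‖ ^ (-(1 / 4) : ℝ) := by
  have h1 := isBigO_exp_cutLog hAB hp (κ := 1 / 4) (by norm_num [abs_of_pos])
  have h2 := isBigO_exp_cutLog hAB hp (κ := -(1 / 4)) (by norm_num [abs_of_pos])
  have e1 : ∀ z, ((1 / 4 : ℝ) : ℂ) * cutLog A B z = cutLog A B z / 4 := fun z => by
    push_cast; ring
  have e2 : ∀ z, ((-(1 / 4) : ℝ) : ℂ) * cutLog A B z = -(cutLog A B z / 4) := fun z => by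
    push_cast; ring
  simp only [e1] at h1
  simp only [e2] at h2
  have hc : (fun z => Complex.cosh (cutLog A B z / 4)) =O[𝓝[≠] p]
      fun z => ‖z - p‖ ^ (-(1 / 4) : ℝ) := by
    have := (h1.add h2).const_mul_left (1 / 2 : ℂ)
    refine this.congr_left fun z => ?_
    rw [Complex.cosh]; ring
  have hs : (fun z => Complex.I * Complex.sinh (cutLog A B z / 4)) =O[𝓝[≠] p]
      fun z => ‖z - p‖ ^ (-(1 / 4) : ℝ) := by
    have := (h1.sub h2).const_mul_left (Complex.I / 2)
    refine this.congr_left fun z => ?_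
    rw [Complex.sinh]; ring
  fin_cases i <;> fin_cases j
  exacts [hc, hs, hs.neg_left, hc]

/-! ### Behaviour at infinity -/

/-- `u (z) = a + O(1 / z)` at infinity. -/
def NearInf (u : ℂ → ℂ) (a : ℂ) : Prop :=
  (fun z => u z - a) =O[cobounded ℂ] fun z : ℂ => z⁻¹

namespace NearInf
variable {u v : ℂ → ℂ} {a b : ℂ}

lemma tendsto (h : NearInf u a) : Tendsto u (cobounded ℂ) (𝓝 a) := by
  have h0 : Tendsto (fun z : ℂ => z⁻¹) (cobounded ℂ) (𝓝 0) := tendsto_inv₀_cobounded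
  simpa using (h.trans_tendsto h0).add_const a

lemma const (a : ℂ) : NearInf (fun _ => a) a := by
  unfold NearInf; simpa using isBigO_zero _ _

lemma add (hu : NearInf u a) (hv : NearInf v b) : NearInf (fun z => u z + v z) (a + b) :=
  (IsBigO.add hu hv).congr_left fun z => by ring

lemma sub (hu : NearInf u a) (hv : NearInf v b) : NearInf (fun z => u z - v z) (a - b) :=
  (IsBigO.sub hu hv).congr_left fun z => by ring

lemma const_mul (c : ℂ) (hu : NearInf u a) : NearInf (fun z => c * u z) (c * a) :=
  (IsBigO.const_mul_left hu c).congr_left fun z => by ring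

lemma mul (hu : NearInf u a) (hv : NearInf v b) : NearInf (fun z => u z * v z) (a * b) := by
  have h1 : (fun z => (u z - a) * v z) =O[cobounded ℂ] fun z : ℂ => z⁻¹ := by
    simpa using IsBigO.mul hu (hv.tendsto.isBigO_one ℂ)
  exact (h1.add (IsBigO.const_mul_left hv a)).congr_left fun z => by ring

lemma comp {f : ℂ → ℂ} (hf : DifferentiableAt ℂ f a) (hu : NearInf u a) :
    NearInf (fun z => f (u z)) (f a) :=
  (hf.isBigO_sub.comp_tendsto hu.tendsto).trans hu

lemma congr (hu : NearInf u a) (h : u =ᶠ[cobounded ℂ] v) : NearInf v a :=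
  IsBigO.congr' hu (by filter_upwards [h] with z hz; rw [hz]) EventuallyEq.rfl

end NearInf

lemma eventually_ne_zero_cobounded : ∀ᶠ z : ℂ in cobounded ℂ, z ≠ 0 := by
  have := isBounded_def.1 (Metric.isBounded_closedBall (x := (0 : ℂ)) (r := 0))
  filter_upwards [this] with z hz
  simpa using hz

lemma cutLog_eq_comp_inv (A B : ℂ) {z : ℂ} (hz : z ≠ 0) :
    cutLog A B z = Complex.log ((1 - B * z⁻¹) / (1 - A * z⁻¹)) := by
  rw [cutLog]
  congr 1
  rw [← mul_div_mul_right (1 - B * z⁻¹) (1 - A * z⁻¹) hz]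
  congr 1 <;> field_simp

lemma hasDerivAt_log_div (A B : ℂ) :
    HasDerivAt (fun w : ℂ => Complex.log ((1 - B * w) / (1 - A * w))) (A - B) 0 := by
  have h : ∀ C : ℂ, HasDerivAt (fun w : ℂ => 1 - C * w) (-C) 0 := fun C => by
    simpa using ((hasDerivAt_id (0 : ℂ)).const_mul C).const_sub 1
  have := ((h B).fun_div (h A) (by simp)).clog (by simp)
  simpa [sub_eq_add_neg, add_comm] using this

lemma nearInf_inv : NearInf (fun z => z⁻¹) 0 := by
  unfold NearInf; simpa using isBigO_refl _ _

lemma nearInf_cutLog (A B : ℂ) : NearInf (cutLog A B) 0 := by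
  have := NearInf.comp (hasDerivAt_log_div A B).differentiableAt nearInf_inv
  simp only [mul_zero, sub_zero, div_one, Complex.log_one] at this
  refine this.congr ?_
  filter_upwards [eventually_ne_zero_cobounded] with z hz
  exact (cutLog_eq_comp_inv A B hz).symm

lemma nearInf_cutSqrt (A B : ℂ) : NearInf (cutSqrt A B) 1 := by
  have h := (nearInf_cutLog A B).comp (f := fun l => Complex.exp (l / 2)) (by fun_prop)
  simp only [zero_div, Complex.exp_zero] at h
  exact h

/-- The value of `szegoLog` at infinity. -/
noncomputable def szegoInf (A B e : ℂ) : ℂ :=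
  -2 * Complex.log (1 + cutSqrt A B e) - Complex.log (-((e - A) / (B - A)))

lemma nearInf_szegoLog {A B e : ℂ} (he : e ∉ segment ℝ A B) :
    NearInf (szegoLog A B e) (szegoInf A B e) := by
  have h1 := (nearInf_cutSqrt A B).comp (f := fun s => Complex.log (s + cutSqrt A B e))
    ((differentiableAt_id.add_const _).clog (add_mem_slitPlane (by simp) (cutSqrt_re_pos he)))
  have h2 := ((nearInf_cutLog A e).sub (h1.const_mul 2)).sub
    (NearInf.const (Complex.log (-((e - A) / (B - A)))))
  have e1 : szegoInf A B e = 0 - 2 * Complex.log (1 + cutSqrt A B e) -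
      Complex.log (-((e - A) / (B - A))) := by rw [szegoInf]; ring
  rw [e1]
  exact h2

lemma nearInf_gTheta (A B : ℂ) (x t : ℝ) :
    NearInf (gTheta A B x t) (t * ((B - A) / 2) ^ 2 + theta ((A + B) / 2) x t) := by
  have hv : NearInf (fun z => (1 - cutSqrt A B z) / (1 + cutSqrt A B z)) 0 := by
    have := (nearInf_cutSqrt A B).comp (f := fun s => (1 - s) / (1 + s))
      (DifferentiableAt.fun_div (by fun_prop) (by fun_prop) (by norm_num))
    simpa using this
  have h := hv.comp (f := fun v => t * ((B - A) / 2) ^ 2 * (v ^ 2 + 1) +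
    (4 * t * ((A + B) / 2) + x) * ((B - A) / 2) * v + theta ((A + B) / 2) x t) (by fun_prop)
  have e0 : (t : ℂ) * ((B - A) / 2) ^ 2 * (0 ^ 2 + 1) +
      (4 * t * ((A + B) / 2) + x) * ((B - A) / 2) * 0 + theta ((A + B) / 2) x t =
      t * ((B - A) / 2) ^ 2 + theta ((A + B) / 2) x t := by ring
  rw [← e0]
  exact h

/-- In the variable `w = 1/z` the entry vanishes at `w = 0`, and the limit is its derivative there.
-/
lemma tendsto_mul_rot (A B : ℂ) :
    Tendsto (fun z => z * rot (cutLog A B z) 0 1) (cobounded ℂ) (𝓝 (Complex.I * (A - B) / 4)) := by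
  have h1 : HasDerivAt (fun w : ℂ => Complex.I *
      Complex.sinh (Complex.log ((1 - B * w) / (1 - A * w)) / 4)) (Complex.I * (A - B) / 4) 0 := by
    have := ((hasDerivAt_log_div A B).div_const 4).csinh.const_mul Complex.I
    simpa [mul_div_assoc] using this
  have h2 := (hasDerivAt_iff_tendsto_slope.1 h1).comp (tendsto_inv₀_cobounded' (α := ℂ))
  refine h2.congr' ?_
  filter_upwards [eventually_ne_zero_cobounded] with z hz
  simp [slope, rot, cutLog_eq_comp_inv A B hz]

/-! ### Products of matrix functions -/

lemma differentiableAt_mul_apply {F G : ℂ → Mat} {z : ℂ}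
    (hF : ∀ i j, DifferentiableAt ℂ (fun w => F w i j) z)
    (hG : ∀ i j, DifferentiableAt ℂ (fun w => G w i j) z) (i j : Fin 2) :
    DifferentiableAt ℂ (fun w => (F w * G w) i j) z := by
  simp only [Matrix.mul_apply, Fin.sum_univ_two]
  exact ((hF i 0).mul (hG 0 j)).add ((hF i 1).mul (hG 1 j))

lemma continuousAt_mul_apply {X : Type*} [TopologicalSpace X] {F G : X → Mat} {z : X}
    (hF : ∀ i j, ContinuousAt (fun w => F w i j) z)
    (hG : ∀ i j, ContinuousAt (fun w => G w i j) z) (i j : Fin 2) :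
    ContinuousAt (fun w => (F w * G w) i j) z := by
  simp only [Matrix.mul_apply, Fin.sum_univ_two]
  exact ((hF i 0).mul (hG 0 j)).add ((hF i 1).mul (hG 1 j))

lemma isBigO_mul_apply {F G : ℂ → Mat} {l : Filter ℂ} {f g : ℂ → ℝ}
    (hF : ∀ i j, (fun w => F w i j) =O[l] f) (hG : ∀ i j, (fun w => G w i j) =O[l] g)
    (i j : Fin 2) : (fun w => (F w * G w) i j) =O[l] fun w => f w * g w := by
  simp only [Matrix.mul_apply, Fin.sum_univ_two]
  exact ((hF i 0).mul (hG 0 j)).add ((hF i 1).mul (hG 1 j))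

lemma nearInf_mul_apply {F G : ℂ → Mat} {P Q : Mat}
    (hF : ∀ i j, NearInf (fun w => F w i j) (P i j))
    (hG : ∀ i j, NearInf (fun w => G w i j) (Q i j)) (i j : Fin 2) :
    NearInf (fun w => (F w * G w) i j) ((P * Q) i j) := by
  simp only [Matrix.mul_apply, Fin.sum_univ_two]
  exact ((hF i 0).mul (hG 0 j)).add ((hF i 1).mul (hG 1 j))

lemma isBigO_expSigma3 {J : ℂ → ℂ} {l : Filter ℂ}
    (h1 : (fun z => Complex.exp (J z)) =O[l] fun _ => (1 : ℝ))
    (h2 : (fun z => Complex.exp (-J z)) =O[l] fun _ => (1 : ℝ)) (i j : Fin 2) :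
    (fun z => expSigma3 (J z) i j) =O[l] fun _ => (1 : ℝ) := by
  fin_cases i <;> fin_cases j
  exacts [h1, isBigO_zero _ _, isBigO_zero _ _, h2]

lemma isBigO_mul_rot_mul_expSigma3 {A B p : ℂ} (hAB : A ≠ B) (hp : p = A ∨ p = B) {l : Filter ℂ}
    (hl : l ≤ 𝓝[≠] p) {C : ℂ → Mat} (hC : ∀ i j, (fun z => C z i j) =O[l] fun _ => (1 : ℝ))
    {J : ℂ → ℂ} (h1 : (fun z => Complex.exp (J z)) =O[l] fun _ => (1 : ℝ))
    (h2 : (fun z => Complex.exp (-J z)) =O[l] fun _ => (1 : ℝ)) (i j : Fin 2) :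
    (fun z => (C z * (rot (cutLog A B z) * expSigma3 (J z))) i j) =O[l]
      fun z => ‖z - p‖ ^ (-(1 / 4) : ℝ) := by
  have := isBigO_mul_apply hC (isBigO_mul_apply (fun i j => (isBigO_rot hAB hp i j).mono hl)
    (isBigO_expSigma3 h1 h2)) i j
  simpa only [one_mul, mul_one] using this

/-! ### The outer parametrix -/

/-- The exponent of the outer parametrix. -/
noncomputable def outerExp (E₁ e : ℂ) (κ x t : ℝ) (z : ℂ) : ℂ :=
  Complex.I * gTheta (bar E₁) E₁ x t z - κ * szegoLog E₁ (bar E₁) e z +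
    κ * szegoLog (bar E₁) E₁ (bar e) z

/-- The value of `outerExp` at infinity. -/
noncomputable def outerInf (E₁ e : ℂ) (κ x t : ℝ) : ℂ :=
  Complex.I * (t * ((E₁ - bar E₁) / 2) ^ 2 + theta ((bar E₁ + E₁) / 2) x t) -
    κ * szegoInf E₁ (bar E₁) e + κ * szegoInf (bar E₁) E₁ (bar e)

/-- The outer parametrix: it has the required jumps on the three middle arcs. -/
noncomputable def outer (E₁ e : ℂ) (κ x t : ℝ) (z : ℂ) : Mat :=
  expSigma3 (-outerInf E₁ e κ x t) *
    (rot (cutLog (bar E₁) E₁ z) * expSigma3 (outerExp E₁ e κ x t z))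

lemma notMem_segment_of_re_lt {p q w : ℂ} {r : ℝ} (hp : p.re = r) (hq : q.re = r) (hw : w.re < r) :
    w ∉ segment ℝ p q := fun h =>
  absurd (re_mem_of_mem_segment (u := r) h hp.ge hq.ge hp.le hq.le).1 (not_le.2 hw)

section
variable {E₁ e : ℂ}

lemma bar_ne_self (h : 0 < E₁.im) : bar E₁ ≠ E₁ := by
  intro h'
  have := congrArg Complex.im h'
  rw [Complex.conj_im] at this
  linarith

lemma sub_bar_self (p : ℂ) : p - bar p = 2 * p.im * Complex.I := by
  apply Complex.ext <;> simp; ring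

/-- Because `bar p - p` is purely imaginary, the imaginary part of the quotient is a nonzero
multiple of `Re (e - p)`. -/
lemma neg_div_mem_slitPlane {p e : ℂ} (hp : p.im ≠ 0) (he : e.re < p.re) :
    -((e - p) / (bar p - p)) ∈ Complex.slitPlane := by
  right
  have : -((e - p) / (bar p - p)) = (p - e).im / (2 * p.im) * -1 +
      (((e - p).re / (2 * p.im) : ℝ) : ℂ) * -Complex.I + (p - e).im / (2 * p.im) +
      (((p - e).im / (2 * p.im) : ℝ) : ℂ) * -1 := by
    have h1 : bar p - p = -(2 * p.im * Complex.I) := by rw [← sub_bar_self]; ring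
    have h2 : e - p = (e - p).re - (p - e).im * Complex.I := by
      apply Complex.ext <;> simp
    have hp' : (p.im : ℂ) ≠ 0 := by exact_mod_cast hp
    rw [h1, h2]
    push_cast
    simp only [Complex.sub_re, Complex.sub_im, Complex.ofReal_re, Complex.mul_re,
      Complex.ofReal_im, Complex.I_re, Complex.I_im]
    push_cast
    field_simp
    linear_combination ((e.re : ℂ) - p.re) * Complex.I_sq
  rw [this]
  simp only [Complex.add_im, Complex.mul_im, Complex.neg_im, Complex.neg_re, Complex.I_im,
    Complex.I_re, Complex.ofReal_re, Complex.ofReal_im, Complex.one_im, Complex.one_re]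
  have h3 : (e - p).re / (2 * p.im) ≠ 0 := by
    refine div_ne_zero ?_ (by simpa using hp)
    rw [Complex.sub_re]; linarith
  intro h0
  apply h3
  linarith

lemma differentiableAt_outerExp {κ x t : ℝ} (he : e.re < E₁.re) {z : ℂ}
    (h1 : z ∉ segment ℝ (bar E₁) E₁) (h2 : z ∉ segment ℝ E₁ e)
    (h3 : z ∉ segment ℝ (bar E₁) (bar e)) : DifferentiableAt ℂ (outerExp E₁ e κ x t) z := by
  have he1 : e ∉ segment ℝ E₁ (bar E₁) := notMem_segment_of_re_lt rfl (by simp) he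
  have he2 : bar e ∉ segment ℝ (bar E₁) E₁ := notMem_segment_of_re_lt (by simp) rfl (by simpa)
  have h1' : z ∉ segment ℝ E₁ (bar E₁) := by rwa [segment_symm]
  exact (((differentiableAt_gTheta x t h1).const_mul _).sub
    ((differentiableAt_szegoLog he1 h1' h2).const_mul _)).add
    ((differentiableAt_szegoLog he2 h1 h3).const_mul _)

lemma differentiableAt_outer {κ x t : ℝ} (he : e.re < E₁.re) {z : ℂ}
    (h1 : z ∉ segment ℝ (bar E₁) E₁) (h2 : z ∉ segment ℝ E₁ e)
    (h3 : z ∉ segment ℝ (bar E₁) (bar e)) (i j : Fin 2) :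
    DifferentiableAt ℂ (fun w => outer E₁ e κ x t w i j) z := by
  refine differentiableAt_mul_apply (F := fun _ => expSigma3 (-outerInf E₁ e κ x t))
    (G := fun w => rot (cutLog (bar E₁) E₁ w) * expSigma3 (outerExp E₁ e κ x t w))
    (fun _ _ => differentiableAt_const _) (differentiableAt_mul_apply (fun i j => ?_)
    fun i j => ?_) i j
  · exact (differentiable_rot_apply i j _).comp z (differentiableAt_cutLog h1)
  · exact (differentiable_expSigma3_apply i j _).comp z (differentiableAt_outerExp he h1 h2 h3)

lemma jumpAt_outer_cut {κ x t : ℝ} (h0 : 0 < E₁.im) (he : e.re < E₁.re) {z : ℂ}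
    (hz : z ∈ openSegment ℝ (bar E₁) E₁) (h2 : z ∉ segment ℝ E₁ e)
    (h3 : z ∉ segment ℝ (bar E₁) (bar e)) :
    JumpAt (outer E₁ e κ x t) (bar E₁) E₁ z (twist (theta z x t)) := by
  have hne := bar_ne_self h0
  have he1 : e ∉ segment ℝ E₁ (bar E₁) := notMem_segment_of_re_lt rfl (by simp) he
  have he2 : bar e ∉ segment ℝ (bar E₁) E₁ := notMem_segment_of_re_lt (by simp) rfl (by simpa)
  obtain ⟨P, N, g1, g2, g3⟩ := tendsto_gTheta_cut x t hne hz
  have hη : -((bar e - bar E₁) / (E₁ - bar E₁)) ∈ Complex.slitPlane := by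
    simpa using neg_div_mem_slitPlane (p := bar E₁) (e := bar e) (by simpa using h0.ne')
      (by simpa using he)
  obtain ⟨L, l1, l2⟩ := tendsto_szegoLog_cut hne he2 hη hz h3
  obtain ⟨L', l1', l2'⟩ := tendsto_szegoLog_cut hne.symm he1 (neg_div_mem_slitPlane h0.ne' he)
    (by rwa [openSegment_symm]) h2
  -- This `szegoLog` has its cut oriented from `E₁` to `bar E₁`, against the contour, so its left
  -- and right limits change roles.
  rw [leftSide_swap] at l1'
  rw [rightSide_swap] at l2'
  refine JumpAt.mul_left (jumpAt_rot_mul_expSigma3 hne hz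
    (((g1.const_mul _).sub (l2'.const_mul _)).add (l1.const_mul _))
    (((g2.const_mul _).sub (l1'.const_mul _)).add (l2.const_mul _)) ?_)
    fun _ _ => continuousAt_const
  linear_combination Complex.I * g3

lemma continuousAt_rot_cutLog {A B z : ℂ} (hz : z ∉ segment ℝ A B) (i j : Fin 2) :
    ContinuousAt (fun w => rot (cutLog A B w) i j) z :=
  ((differentiable_rot_apply i j _).comp z (differentiableAt_cutLog hz)).continuousAt

lemma jumpAt_outer_upper {κ x t : ℝ} (he : e.re < E₁.re) {z : ℂ}
    (h1 : z ∉ segment ℝ (bar E₁) E₁) (hz : z ∈ openSegment ℝ E₁ e)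
    (h3 : z ∉ segment ℝ (bar E₁) (bar e)) :
    JumpAt (outer E₁ e κ x t) E₁ e z (expSigma3 (-(κ * (2 * Real.pi * Complex.I)))) := by
  have he1 : e ∉ segment ℝ E₁ (bar E₁) := notMem_segment_of_re_lt rfl (by simp) he
  have he2 : bar e ∉ segment ℝ (bar E₁) E₁ := notMem_segment_of_re_lt (by simp) rfl (by simpa)
  have h1' : z ∉ segment ℝ E₁ (bar E₁) := by rwa [segment_symm]
  obtain ⟨L, l1, l2⟩ := tendsto_szegoLog_branch he1 hz h1'
  have c1 := (differentiableAt_gTheta x t h1).continuousAt.tendsto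
  have c2 := (differentiableAt_szegoLog he2 h1 h3).continuousAt.tendsto
  have H : ∀ (s : Set ℂ) (l : ℂ), Tendsto (szegoLog E₁ (bar E₁) e) (𝓝[s] z) (𝓝 l) →
      Tendsto (outerExp E₁ e κ x t) (𝓝[s] z) (𝓝 (Complex.I * gTheta (bar E₁) E₁ x t z - κ * l +
        κ * szegoLog (bar E₁) E₁ (bar e) z)) := fun s l h =>
    (((c1.mono_left nhdsWithin_le_nhds).const_mul _).sub (h.const_mul _)).add
      ((c2.mono_left nhdsWithin_le_nhds).const_mul _)
  refine JumpAt.mul_left (jumpAt_mul_expSigma3 (continuousAt_rot_cutLog h1)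
    (tendsto_nhds_of_eq (H _ _ l1) ?_) (H _ _ l2)) fun _ _ => continuousAt_const
  ring

lemma jumpAt_outer_lower {κ x t : ℝ} (he : e.re < E₁.re) {z : ℂ}
    (h1 : z ∉ segment ℝ (bar E₁) E₁) (h2 : z ∉ segment ℝ E₁ e)
    (hz : z ∈ openSegment ℝ (bar E₁) (bar e)) :
    JumpAt (outer E₁ e κ x t) (bar e) (bar E₁) z
      (expSigma3 (-(κ * (2 * Real.pi * Complex.I)))) := by
  have he1 : e ∉ segment ℝ E₁ (bar E₁) := notMem_segment_of_re_lt rfl (by simp) he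
  have he2 : bar e ∉ segment ℝ (bar E₁) E₁ := notMem_segment_of_re_lt (by simp) rfl (by simpa)
  have h1' : z ∉ segment ℝ E₁ (bar E₁) := by rwa [segment_symm]
  obtain ⟨L, l1, l2⟩ := tendsto_szegoLog_branch he2 hz h1
  have c1 := (differentiableAt_gTheta x t h1).continuousAt.tendsto
  have c2 := (differentiableAt_szegoLog he1 h1' h2).continuousAt.tendsto
  have H : ∀ (s : Set ℂ) (l : ℂ), Tendsto (szegoLog (bar E₁) E₁ (bar e)) (𝓝[s] z) (𝓝 l) →
      Tendsto (outerExp E₁ e κ x t) (𝓝[s] z) (𝓝 (Complex.I * gTheta (bar E₁) E₁ x t z -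
        κ * szegoLog E₁ (bar E₁) e z + κ * l)) := fun s l h =>
    (((c1.mono_left nhdsWithin_le_nhds).const_mul _).sub
      ((c2.mono_left nhdsWithin_le_nhds).const_mul _)).add (h.const_mul _)
  refine JumpAt.swap (M := expSigma3 (κ * (2 * Real.pi * Complex.I))) (JumpAt.mul_left
    (jumpAt_mul_expSigma3 (continuousAt_rot_cutLog h1)
    (tendsto_nhds_of_eq (H _ _ l1) ?_) (H _ _ l2)) fun _ _ => continuousAt_const)
    (expSigma3_mul_neg _)
  ring

lemma isBigO_exp_of_bounded {l : Filter ℂ} {f : ℂ → ℂ} {C : ℝ} (h : ∀ᶠ z in l, ‖f z‖ ≤ C) :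
    (fun z => Complex.exp (f z)) =O[l] fun _ => (1 : ℝ) := by
  refine IsBigO.of_bound (Real.exp C) ?_
  filter_upwards [h] with z hz
  rw [Complex.norm_exp, norm_one, mul_one]
  exact Real.exp_le_exp.2 ((Complex.re_le_norm _).trans hz)

lemma isBigO_outer {κ x t : ℝ} (h0 : 0 < E₁.im) (he : e.re < E₁.re) {p : ℂ}
    (hp : p = bar E₁ ∨ p = E₁) (i j : Fin 2) :
    (fun z => outer E₁ e κ x t z i j) =O[𝓝[(segment ℝ (bar E₁) E₁)ᶜ] p]
      fun z => ‖z - p‖ ^ (-(1 / 4) : ℝ) := by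
  have hne := bar_ne_self h0
  have he1 : e ∉ segment ℝ E₁ (bar E₁) := notMem_segment_of_re_lt rfl (by simp) he
  have he2 : bar e ∉ segment ℝ (bar E₁) E₁ := notMem_segment_of_re_lt (by simp) rfl (by simpa)
  obtain ⟨C, hC⟩ := exists_bound_gTheta (bar E₁) E₁ x t
  have hsub : 𝓝[(segment ℝ (bar E₁) E₁)ᶜ] p ≤ 𝓝[≠] p := by
    refine nhdsWithin_mono _ fun z hz => ?_
    rcases hp with rfl | rfl
    · exact ne_left_of_notMem_segment hz
    · exact ne_right_of_notMem_segment hz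
  have key : ∀ τ : ℝ, |τ| = 1 → (fun z => Complex.exp (τ * outerExp E₁ e κ x t z))
      =O[𝓝[(segment ℝ (bar E₁) E₁)ᶜ] p] fun _ => (1 : ℝ) := by
    intro τ hτ
    have b1 : (fun z => Complex.exp (τ * (Complex.I * gTheta (bar E₁) E₁ x t z)))
        =O[𝓝[(segment ℝ (bar E₁) E₁)ᶜ] p] fun _ => (1 : ℝ) := by
      refine isBigO_exp_of_bounded (C := C) ?_
      filter_upwards [self_mem_nhdsWithin] with z hz
      rw [norm_mul, norm_mul, Complex.norm_I, one_mul, Complex.norm_real, Real.norm_eq_abs, hτ,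
        one_mul]
      exact hC z hz
    have b2 := isBigO_exp_szegoLog hne.symm he1 hp.symm (-(τ * κ))
    have b3 := isBigO_exp_szegoLog hne he2 hp (τ * κ)
    rw [segment_symm] at b2
    have b2' := b2.norm_right
    have b3' := b3.norm_right
    simp only [norm_one] at b2' b3'
    have := (b1.mul b2').mul b3'
    simp only [mul_one] at this
    refine this.congr_left fun z => ?_
    rw [← Complex.exp_add, ← Complex.exp_add, outerExp]
    congr 1
    push_cast
    ring
  refine isBigO_mul_rot_mul_expSigma3 (C := fun _ => expSigma3 (-outerInf E₁ e κ x t))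
    (J := outerExp E₁ e κ x t) hne hp hsub (fun i j => (tendsto_const_nhds).isBigO_one ℝ) ?_ ?_ i j
  · simpa using key 1 (by simp)
  · simpa using key (-1) (by simp)

lemma nearInf_outerExp {κ x t : ℝ} (he : e.re < E₁.re) :
    NearInf (outerExp E₁ e κ x t) (outerInf E₁ e κ x t) := by
  have he1 : e ∉ segment ℝ E₁ (bar E₁) := notMem_segment_of_re_lt rfl (by simp) he
  have he2 : bar e ∉ segment ℝ (bar E₁) E₁ := notMem_segment_of_re_lt (by simp) rfl (by simpa)
  exact (((nearInf_gTheta (bar E₁) E₁ x t).const_mul _).sub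
    ((nearInf_szegoLog he1).const_mul _)).add ((nearInf_szegoLog he2).const_mul _)

lemma rot_zero : rot 0 = 1 := by
  ext i j
  fin_cases i <;> fin_cases j <;> simp [rot]

lemma nearInf_outer {κ x t : ℝ} (he : e.re < E₁.re) (i j : Fin 2) :
    NearInf (fun z => outer E₁ e κ x t z i j) ((1 : Mat) i j) := by
  have h := nearInf_mul_apply (F := fun _ => expSigma3 (-outerInf E₁ e κ x t))
    (fun i j => NearInf.const (expSigma3 (-outerInf E₁ e κ x t) i j)) (nearInf_mul_apply
    (fun i j => (nearInf_cutLog (bar E₁) E₁).comp (f := fun l => rot l i j)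
      (differentiable_rot_apply i j _))
    (fun i j => (nearInf_outerExp (κ := κ) (x := x) (t := t) he).comp
      (f := fun l => expSigma3 l i j) (differentiable_expSigma3_apply i j _))) i j
  have e1 : expSigma3 (-outerInf E₁ e κ x t) * (rot 0 * expSigma3 (outerInf E₁ e κ x t)) = 1 := by
    rw [rot_zero, Matrix.one_mul, expSigma3_neg_mul]
  rw [← e1]
  exact h

lemma tendsto_mul_outer {κ x t : ℝ} (he : e.re < E₁.re) :
    Tendsto (fun z => z * outer E₁ e κ x t z 0 1) (cobounded ℂ)
      (𝓝 (E₁.im / 2 * Complex.exp (-2 * outerInf E₁ e κ x t))) := by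
  have h1 := tendsto_mul_rot (bar E₁) E₁
  have h2 := (nearInf_outerExp (κ := κ) (x := x) (t := t) he).tendsto
  have h3 : Tendsto (fun z => Complex.exp (-outerExp E₁ e κ x t z)) (cobounded ℂ)
      (𝓝 (Complex.exp (-outerInf E₁ e κ x t))) := (Complex.continuous_exp.tendsto _).comp h2.neg
  have h4 := (h1.mul h3).const_mul (Complex.exp (-outerInf E₁ e κ x t))
  refine (tendsto_nhds_of_eq h4 ?_).congr fun z => ?_
  · have h5 : bar E₁ - E₁ = -(2 * E₁.im * Complex.I) := by rw [← sub_bar_self]; ring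
    rw [h5, show -2 * outerInf E₁ e κ x t = -outerInf E₁ e κ x t + -outerInf E₁ e κ x t by ring,
      Complex.exp_add]
    linear_combination (-(E₁.im : ℂ) / 2 * Complex.exp (-outerInf E₁ e κ x t) *
      Complex.exp (-outerInf E₁ e κ x t)) * Complex.I_sq
  · simp [outer, Matrix.mul_apply, expSigma3]
    ring

end

/-! ### The local parametrix -/

/-- The regular part of the exponent `outerExp` near the shrinking arc. -/
noncomputable def regExp (E₁ p e : ℂ) (κ x t : ℝ) (z : ℂ) : ℂ :=
  Complex.I * gTheta (bar E₁) E₁ x t z +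
    κ * (2 * Complex.log (cutSqrt p (bar p) z + cutSqrt p (bar p) e) +
      Complex.log (-((e - p) / (bar p - p)))) +
    κ * szegoLog (bar p) p (bar e) z

/-- The analytic left factor common to the outer and the local parametrix. -/
noncomputable def frame (E₁ p e : ℂ) (κ α x t : ℝ) (s z : ℂ) : Mat :=
  expSigma3 (-s) * (rot (cutLog (bar E₁) E₁ z) *
    expSigma3 (regExp E₁ p e κ x t z - Complex.I * (theta z x t + α / 2)))

/-- The constant exponent matching the local to the outer parametrix. -/
noncomputable def innerConst (p e c : ℂ) (κ : ℝ) : ℂ :=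
  κ * (2 * Complex.log 2 + Complex.log (-((p - e) / (c - e))))

/-- The local parametrix near the shrinking arc with ends `c` and `e`, oriented from `a` to `b`. -/
noncomputable def inner (E₁ p e c a b : ℂ) (κ α x t : ℝ) (s z : ℂ) : Mat :=
  frame E₁ p e κ α x t s z * expSigma3 (innerConst p e c κ) *
    (rot (cutLog a b z) *
      expSigma3 (κ * szegoLog e c p z + Complex.I * (theta z x t + α / 2)))

/-- The mismatch of the parametrices, conjugated by `frame`. -/
noncomputable def mismatch (p e c a b : ℂ) (κ : ℝ) (z : ℂ) : Mat :=
  expSigma3 (innerConst p e c κ) * rot (cutLog a b z) *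
    expSigma3 (κ * (2 * Complex.log 2 - 2 * Complex.log (cutSqrt e c z + cutSqrt e c p)) -
      innerConst p e c κ)

lemma outerExp_eq_upper (E₁ e : ℂ) (κ x t : ℝ) (z : ℂ) :
    outerExp E₁ e κ x t z = regExp E₁ E₁ e κ x t z - κ * cutLog E₁ e z := by
  simp only [outerExp, regExp, szegoLog]
  ring

/-- In the lower half-plane the exponent has the form of the upper one, with conjugated endpoints
and `κ` replaced by `-κ`. One local construction therefore serves both short arcs. -/
lemma outerExp_eq_lower (E₁ e : ℂ) (κ x t : ℝ) (z : ℂ) :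
    outerExp E₁ e κ x t z =
      regExp E₁ (bar E₁) (bar e) (-κ) x t z - (-κ : ℝ) * cutLog (bar E₁) (bar e) z := by
  simp only [outerExp, regExp, szegoLog, Complex.conj_conj]
  push_cast
  ring

lemma differentiable_theta (x t : ℝ) : Differentiable ℂ fun z => theta z x t := by
  unfold theta
  fun_prop

section
variable {E₁ p e c a b s z : ℂ} {κ α x t : ℝ}

/-- Positivity of such a product says that the point lies in the half-plane of `p`, whichever of the
two it is. -/
lemma notMem_segment_bar (he : 0 < p.im * e.im) (hz : 0 < p.im * z.im) :
    z ∉ segment ℝ (bar p) (bar e) := by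
  intro h
  obtain ⟨u, v, hu, hv, -, -, h'⟩ := re_im_of_mem_segment h
  rw [Complex.conj_im, Complex.conj_im] at h'
  rw [h'] at hz
  nlinarith [mul_nonneg hu (mul_self_nonneg p.im), mul_nonneg hv he.le]

lemma differentiableAt_regExp (hp : p.re = E₁.re) (he : e.re < p.re) (he' : 0 < p.im * e.im)
    (hz : z.re < p.re) (hz' : 0 < p.im * z.im) :
    DifferentiableAt ℂ (regExp E₁ p e κ x t) z := by
  have h1 : z ∉ segment ℝ (bar E₁) E₁ := notMem_segment_of_re_lt (by simp) rfl (hp ▸ hz)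
  have h2 : z ∉ segment ℝ p (bar p) := notMem_segment_of_re_lt rfl (by simp) hz
  have h2' : z ∉ segment ℝ (bar p) p := notMem_segment_of_re_lt (by simp) rfl hz
  have h3 : e ∉ segment ℝ p (bar p) := notMem_segment_of_re_lt rfl (by simp) he
  have h4 : bar e ∉ segment ℝ (bar p) p := notMem_segment_of_re_lt (by simp) rfl (by simpa)
  exact (((differentiableAt_gTheta x t h1).const_mul _).add
    ((((differentiableAt_log_cutSqrt_add h3 h2).const_mul 2).add_const _).const_mul _)).add
    ((differentiableAt_szegoLog h4 h2' (notMem_segment_bar he' hz')).const_mul _)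

lemma differentiableAt_frame (hp : p.re = E₁.re) (he : e.re < p.re) (he' : 0 < p.im * e.im)
    (hz : z.re < p.re) (hz' : 0 < p.im * z.im) (i j : Fin 2) :
    DifferentiableAt ℂ (fun w => frame E₁ p e κ α x t s w i j) z := by
  have h1 : z ∉ segment ℝ (bar E₁) E₁ := notMem_segment_of_re_lt (by simp) rfl (hp ▸ hz)
  refine differentiableAt_mul_apply (F := fun _ => expSigma3 (-s))
    (G := fun w => rot (cutLog (bar E₁) E₁ w) *
    expSigma3 (regExp E₁ p e κ x t w - Complex.I * (theta w x t + α / 2)))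
    (fun _ _ => differentiableAt_const _) (differentiableAt_mul_apply (fun i j => ?_)
    fun i j => ?_) i j
  · exact (differentiable_rot_apply i j _).comp z (differentiableAt_cutLog h1)
  · exact (differentiable_expSigma3_apply i j _).comp z
      ((differentiableAt_regExp hp he he' hz hz').sub
        (((differentiable_theta x t z).add_const _).const_mul _))

lemma det_frame (E₁ p e : ℂ) (κ α x t : ℝ) (s z : ℂ) : (frame E₁ p e κ α x t s z).det = 1 := by
  rw [frame, Matrix.det_mul, Matrix.det_mul, det_expSigma3, det_rot, det_expSigma3]
  norm_num

lemma continuousAt_frame_mul (hp : p.re = E₁.re) (he : e.re < p.re) (he' : 0 < p.im * e.im)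
    (hz : z.re < p.re) (hz' : 0 < p.im * z.im) (M : Mat) (i j : Fin 2) :
    ContinuousAt (fun w => (frame E₁ p e κ α x t s w * M) i j) z :=
  continuousAt_mul_apply (G := fun _ => M)
    (fun i j => (differentiableAt_frame hp he he' hz hz' i j).continuousAt)
    (fun _ _ => continuousAt_const) i j

lemma differentiableAt_inner (hp : p.re = E₁.re) (he : e.re < p.re) (he' : 0 < p.im * e.im)
    (hz : z.re < p.re) (hz' : 0 < p.im * z.im) (hp' : p ∉ segment ℝ e c)
    (h1 : z ∉ segment ℝ a b) (h2 : z ∉ segment ℝ e c) (h3 : z ∉ segment ℝ e p) (i j : Fin 2) :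
    DifferentiableAt ℂ (fun w => inner E₁ p e c a b κ α x t s w i j) z := by
  refine differentiableAt_mul_apply (differentiableAt_mul_apply
    (G := fun _ => expSigma3 (innerConst p e c κ))
    (differentiableAt_frame hp he he' hz hz') fun _ _ => differentiableAt_const _)
    (differentiableAt_mul_apply (fun i j => ?_) fun i j => ?_) i j
  · exact (differentiable_rot_apply i j _).comp z (differentiableAt_cutLog h1)
  · exact (differentiable_expSigma3_apply i j _).comp z
      (((differentiableAt_szegoLog hp' h2 h3).const_mul _).add
        (((differentiable_theta x t z).add_const _).const_mul _))

lemma jumpAt_inner_cut (hp : p.re = E₁.re) (he : e.re < p.re) (he' : 0 < p.im * e.im)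
    (hz : z.re < p.re) (hz' : 0 < p.im * z.im) (hp' : p ∉ segment ℝ e c) (hec : e ≠ c)
    (hη : -((p - e) / (c - e)) ∈ Complex.slitPlane) (hab : a = e ∧ b = c ∨ a = c ∧ b = e)
    (hzab : z ∈ openSegment ℝ a b) (h3 : z ∉ segment ℝ e p) :
    JumpAt (inner E₁ p e c a b κ α x t s) a b z (twist (theta z x t + α / 2)) := by
  have hθ : ContinuousAt (fun w => Complex.I * (theta w x t + α / 2)) z :=
    (((differentiable_theta x t z).add_const _).const_mul _).continuousAt
  have hne : a ≠ b := by
    rcases hab with ⟨rfl, rfl⟩ | ⟨rfl, rfl⟩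
    exacts [hec, hec.symm]
  obtain ⟨L, l1, l2⟩ : ∃ L, Tendsto (szegoLog e c p) (𝓝[leftSide a b] z) (𝓝 L) ∧
      Tendsto (szegoLog e c p) (𝓝[rightSide a b] z) (𝓝 (-L)) := by
    rcases hab with ⟨rfl, rfl⟩ | ⟨rfl, rfl⟩
    · exact tendsto_szegoLog_cut hec hp' hη hzab h3
    · rw [openSegment_symm] at hzab
      obtain ⟨L, l1, l2⟩ := tendsto_szegoLog_cut hec hp' hη hzab h3
      rw [leftSide_swap] at l1
      rw [rightSide_swap] at l2
      exact ⟨-L, l2, by rwa [neg_neg]⟩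
  refine JumpAt.mul_left (jumpAt_rot_mul_expSigma3 hne hzab
    ((l1.const_mul _).add (hθ.tendsto.mono_left nhdsWithin_le_nhds))
    ((l2.const_mul _).add (hθ.tendsto.mono_left nhdsWithin_le_nhds)) ?_)
    (continuousAt_frame_mul hp he he' hz hz' _)
  ring

lemma jumpAt_inner_branch (hp : p.re = E₁.re) (he : e.re < p.re) (he' : 0 < p.im * e.im)
    (hz : z.re < p.re) (hz' : 0 < p.im * z.im) (hp' : p ∉ segment ℝ e c)
    (h1 : z ∉ segment ℝ a b) (h2 : z ∉ segment ℝ e c) (hzep : z ∈ openSegment ℝ e p) :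
    JumpAt (inner E₁ p e c a b κ α x t s) e p z (expSigma3 (κ * (2 * Real.pi * Complex.I))) := by
  have hθ : ContinuousAt (fun w => Complex.I * (theta w x t + α / 2)) z :=
    (((differentiable_theta x t z).add_const _).const_mul _).continuousAt
  obtain ⟨L, l1, l2⟩ := tendsto_szegoLog_branch hp' hzep h2
  refine JumpAt.mul_left (jumpAt_mul_expSigma3 (continuousAt_rot_cutLog h1)
    (tendsto_nhds_of_eq ((l1.const_mul _).add (hθ.tendsto.mono_left nhdsWithin_le_nhds)) ?_)
    ((l2.const_mul _).add (hθ.tendsto.mono_left nhdsWithin_le_nhds)))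
    (continuousAt_frame_mul hp he he' hz hz' _)
  ring

lemma isBigO_inner (hp : p.re = E₁.re) (he : e.re < p.re) (he' : 0 < p.im * e.im)
    (hz : z.re < p.re) (hz' : 0 < p.im * z.im) (hp' : p ∉ segment ℝ e c) (hec : e ≠ c)
    (hab : a = e ∧ b = c ∨ a = c ∧ b = e) (hze : z = e ∨ z = c) (i j : Fin 2) :
    (fun w => inner E₁ p e c a b κ α x t s w i j) =O[𝓝[(segment ℝ e c)ᶜ] z]
      fun w => ‖w - z‖ ^ (-(1 / 4) : ℝ) := by
  have hθ : ContinuousAt (fun w => Complex.I * (theta w x t + α / 2)) z :=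
    (((differentiable_theta x t z).add_const _).const_mul _).continuousAt
  have hne : a ≠ b := by
    rcases hab with ⟨rfl, rfl⟩ | ⟨rfl, rfl⟩
    exacts [hec, hec.symm]
  have hzab : z = a ∨ z = b := by
    rcases hab with ⟨rfl, rfl⟩ | ⟨rfl, rfl⟩
    exacts [hze, hze.symm]
  have hsub : 𝓝[(segment ℝ e c)ᶜ] z ≤ 𝓝[≠] z := by
    refine nhdsWithin_mono _ fun w hw => ?_
    rcases hze with rfl | rfl
    · exact ne_left_of_notMem_segment hw
    · exact ne_right_of_notMem_segment hw
  have key : ∀ τ : ℝ, (fun w => Complex.exp (τ * (κ * szegoLog e c p w +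
      Complex.I * (theta w x t + α / 2)))) =O[𝓝[(segment ℝ e c)ᶜ] z] fun _ => (1 : ℝ) := by
    intro τ
    have b1 : (fun w => Complex.exp (τ * (Complex.I * (theta w x t + α / 2))))
        =O[𝓝[(segment ℝ e c)ᶜ] z] fun _ => (1 : ℝ) :=
      (((hθ.const_mul _).cexp).tendsto.mono_left nhdsWithin_le_nhds).isBigO_one ℝ
    have b2 := (isBigO_exp_szegoLog hec hp' hze (τ * κ)).norm_right
    simp only [norm_one] at b2
    have := b1.mul b2
    simp only [mul_one] at this
    refine this.congr_left fun w => ?_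
    rw [← Complex.exp_add]
    congr 1
    push_cast
    ring
  refine isBigO_mul_rot_mul_expSigma3
    (C := fun w => frame E₁ p e κ α x t s w * expSigma3 (innerConst p e c κ))
    (J := fun w => κ * szegoLog e c p w + Complex.I * (theta w x t + α / 2)) hne hzab hsub
    (fun i j => ((continuousAt_frame_mul hp he he' hz hz' _ i j).tendsto.mono_left
      nhdsWithin_le_nhds).isBigO_one ℝ) ?_ ?_ i j
  · simpa using key 1
  · simpa using key (-1)

lemma differentiableAt_mismatch (hp' : p ∉ segment ℝ e c) (h1 : z ∉ segment ℝ a b)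
    (h2 : z ∉ segment ℝ e c) (i j : Fin 2) :
    DifferentiableAt ℂ (fun w => mismatch p e c a b κ w i j) z := by
  refine differentiableAt_mul_apply (F := fun w =>
    expSigma3 (innerConst p e c κ) * rot (cutLog a b w)) (differentiableAt_mul_apply
    (F := fun _ => expSigma3 (innerConst p e c κ))
    (fun _ _ => differentiableAt_const _) fun i j => ?_) (fun i j => ?_) i j
  · exact (differentiable_rot_apply i j _).comp z (differentiableAt_cutLog h1)
  · exact (differentiable_expSigma3_apply i j _).comp z
      ((((differentiableAt_log_cutSqrt_add hp' h2).const_mul 2).const_sub _ |>.const_mul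
        _).sub_const _)

/-- Away from the short arc `cutSqrt e c` is close to `1`, so `κ * szegoLog e c p z` is close to `-κ
* cutLog p e z - innerConst p e c κ`. The leading factor `expSigma3 (innerConst p e c κ)` cancels
this constant, at the price of conjugating `rot` in `mismatch`. -/
lemma inner_eq_frame_mul (h3 : z ∉ segment ℝ e p) :
    inner E₁ p e c a b κ α x t s z = frame E₁ p e κ α x t s z * (mismatch p e c a b κ z *
      expSigma3 (Complex.I * (theta z x t + α / 2) - κ * cutLog p e z)) := by
  have h : κ * szegoLog e c p z + Complex.I * (theta z x t + α / 2) =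
      (κ * (2 * Complex.log 2 - 2 * Complex.log (cutSqrt e c z + cutSqrt e c p)) -
      innerConst p e c κ) + (Complex.I * (theta z x t + α / 2) - κ * cutLog p e z) := by
    rw [cutLog_swap h3, innerConst, szegoLog]
    ring
  rw [inner, h, expSigma3_add, mismatch]
  simp only [Matrix.mul_assoc]

lemma frame_mul_eq : frame E₁ p e κ α x t s z *
      expSigma3 (Complex.I * (theta z x t + α / 2) - κ * cutLog p e z) =
    expSigma3 (-s) * (rot (cutLog (bar E₁) E₁ z) *
      expSigma3 (regExp E₁ p e κ x t z - κ * cutLog p e z)) := by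
  have h : regExp E₁ p e κ x t z - κ * cutLog p e z =
      (regExp E₁ p e κ x t z - Complex.I * (theta z x t + α / 2)) +
      (Complex.I * (theta z x t + α / 2) - κ * cutLog p e z) := by ring
  rw [h, expSigma3_add, frame]
  simp only [Matrix.mul_assoc]

/-- The error made by the outer parametrix on the annulus. -/
noncomputable def parametrixError (E₁ p e c a b : ℂ) (κ α x t : ℝ) (s z : ℂ) : Mat :=
  frame E₁ p e κ α x t s z * (mismatch p e c a b κ z - 1) * (frame E₁ p e κ α x t s z).adjugate

/-- The last factor is the outer parametrix. The branching term `cutLog p e` occurs only in that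
factor, so `parametrixError` is holomorphic across the arc from `e` to `p`, and the error is a
genuine holomorphic jump on the annulus. -/
lemma inner_eq_mul (h3 : z ∉ segment ℝ e p) :
    inner E₁ p e c a b κ α x t s z = (1 + parametrixError E₁ p e c a b κ α x t s z) *
      (expSigma3 (-s) * (rot (cutLog (bar E₁) E₁ z) *
      expSigma3 (regExp E₁ p e κ x t z - κ * cutLog p e z))) := by
  have h1 := Matrix.mul_adjugate (frame E₁ p e κ α x t s z)
  have h2 := Matrix.adjugate_mul (frame E₁ p e κ α x t s z)
  rw [det_frame, one_smul] at h1 h2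
  have h : 1 + parametrixError E₁ p e c a b κ α x t s z =
      frame E₁ p e κ α x t s z * mismatch p e c a b κ z *
        (frame E₁ p e κ α x t s z).adjugate := by
    rw [parametrixError, Matrix.mul_sub, Matrix.sub_mul, Matrix.mul_one, h1]
    abel
  rw [h, ← frame_mul_eq (α := α), inner_eq_frame_mul h3, ← Matrix.mul_assoc,
    Matrix.mul_assoc (_ * mismatch _ _ _ _ _ _ _), ← Matrix.mul_assoc (Matrix.adjugate _), h2,
    Matrix.one_mul]

lemma differentiableAt_parametrixError (hp : p.re = E₁.re) (he : e.re < p.re)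
    (he' : 0 < p.im * e.im) (hz : z.re < p.re) (hz' : 0 < p.im * z.im) (hp' : p ∉ segment ℝ e c)
    (h1 : z ∉ segment ℝ a b) (h2 : z ∉ segment ℝ e c) (i j : Fin 2) :
    DifferentiableAt ℂ (fun w => parametrixError E₁ p e c a b κ α x t s w i j) z := by
  have hf := differentiableAt_frame (κ := κ) (α := α) (x := x) (t := t) (s := s) hp he he' hz hz'
  refine differentiableAt_mul_apply (differentiableAt_mul_apply hf fun i j => ?_)
    (fun i j => ?_) i j
  · exact (differentiableAt_mismatch hp' h1 h2 i j).sub_const _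
  · simp only [Matrix.adjugate_fin_two]
    fin_cases i <;> fin_cases j
    exacts [hf 1 1, (hf 0 1).neg, (hf 1 0).neg, hf 0 0]

lemma norm_parametrixError_le {C η : ℝ} (hC : ∀ i j, ‖frame E₁ p e κ α x t s z i j‖ ≤ C)
    (hη : ∀ i j, ‖(mismatch p e c a b κ z - 1) i j‖ ≤ η) (i j : Fin 2) :
    ‖parametrixError E₁ p e c a b κ α x t s z i j‖ ≤ 4 * C ^ 2 * η := by
  have hC0 : 0 ≤ C := (norm_nonneg _).trans (hC 0 0)
  have hadj : ∀ i j, ‖(frame E₁ p e κ α x t s z).adjugate i j‖ ≤ C := by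
    intro i j
    simp only [Matrix.adjugate_fin_two]
    fin_cases i <;> fin_cases j
    · exact hC 1 1
    · exact (norm_neg _).le.trans (hC 0 1)
    · exact (norm_neg _).le.trans (hC 1 0)
    · exact hC 0 0
  have hmul : ∀ {M N : Mat} {u v : ℝ}, 0 ≤ u → (∀ i j, ‖M i j‖ ≤ u) → (∀ i j, ‖N i j‖ ≤ v) →
      ∀ i j, ‖(M * N) i j‖ ≤ 2 * (u * v) := by
    intro M N u v hu hM hN i j
    rw [Matrix.mul_apply, Fin.sum_univ_two, two_mul]
    refine (norm_add_le _ _).trans (add_le_add ?_ ?_) <;> rw [norm_mul] <;>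
      exact mul_le_mul (hM _ _) (hN _ _) (norm_nonneg _) hu
  have hη0 : 0 ≤ η := (norm_nonneg _).trans (hη 0 0)
  refine (hmul (by positivity) (hmul hC0 hC hη) hadj i j).trans (le_of_eq ?_)
  ring

end

/-! ### Joint continuity -/

section
variable {X : Type*} [TopologicalSpace X] {q : X}

lemma continuousAt_cutLog_comp {A B z : X → ℂ} (hA : ContinuousAt A q) (hB : ContinuousAt B q)
    (hz : ContinuousAt z q) (h : z q ∉ segment ℝ (A q) (B q)) :
    ContinuousAt (fun q => cutLog (A q) (B q) (z q)) q :=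
  ((hz.sub hB).div (hz.sub hA) (sub_ne_zero.2 (ne_left_of_notMem_segment h))).clog
    (div_mem_slitPlane h)

lemma continuousAt_cutSqrt_comp {A B z : X → ℂ} (hA : ContinuousAt A q) (hB : ContinuousAt B q)
    (hz : ContinuousAt z q) (h : z q ∉ segment ℝ (A q) (B q)) :
    ContinuousAt (fun q => cutSqrt (A q) (B q) (z q)) q :=
  ((continuousAt_cutLog_comp hA hB hz h).div_const 2).cexp

lemma continuousAt_log_cutSqrt_add_comp {A B : ℂ} {e z : X → ℂ} (he : ContinuousAt e q)
    (hz : ContinuousAt z q) (h : z q ∉ segment ℝ A B) (h' : e q ∉ segment ℝ A B) :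
    ContinuousAt (fun q => Complex.log (cutSqrt A B (z q) + cutSqrt A B (e q))) q :=
  ((continuousAt_cutSqrt_comp continuousAt_const continuousAt_const hz h).add
    (continuousAt_cutSqrt_comp continuousAt_const continuousAt_const he h')).clog
    (add_mem_slitPlane (cutSqrt_re_pos h).le (cutSqrt_re_pos h'))

lemma continuousAt_log_neg_div {A B : ℂ} {e : X → ℂ} (he : ContinuousAt e q)
    (h : -((e q - A) / (B - A)) ∈ Complex.slitPlane) :
    ContinuousAt (fun q => Complex.log (-((e q - A) / (B - A)))) q :=
  (((he.sub continuousAt_const).div_const _).neg).clog h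

lemma continuousAt_szegoLog_comp {A B : ℂ} {e z : X → ℂ} (he : ContinuousAt e q)
    (hz : ContinuousAt z q) (h : z q ∉ segment ℝ A B) (h' : e q ∉ segment ℝ A B)
    (h'' : z q ∉ segment ℝ A (e q)) (hη : -((e q - A) / (B - A)) ∈ Complex.slitPlane) :
    ContinuousAt (fun q => szegoLog A B (e q) (z q)) q :=
  ((continuousAt_cutLog_comp continuousAt_const he hz h'').sub
    ((continuousAt_log_cutSqrt_add_comp he hz h h').const_mul 2)).sub
    (continuousAt_log_neg_div he hη)

lemma continuousAt_szegoInf_comp {A B : ℂ} {e : X → ℂ} (he : ContinuousAt e q)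
    (h' : e q ∉ segment ℝ A B) (hη : -((e q - A) / (B - A)) ∈ Complex.slitPlane) :
    ContinuousAt (fun q => szegoInf A B (e q)) q :=
  ((((continuousAt_cutSqrt_comp continuousAt_const continuousAt_const he h').const_add 1).clog
    (add_mem_slitPlane (by simp) (cutSqrt_re_pos h'))).const_mul (-2)).sub
    (continuousAt_log_neg_div he hη)

lemma continuousAt_theta_comp {x t : X → ℝ} {z : X → ℂ} (hx : ContinuousAt x q)
    (ht : ContinuousAt t q) (hz : ContinuousAt z q) :
    ContinuousAt (fun q => theta (z q) (x q) (t q)) q := by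
  unfold theta
  fun_prop

lemma continuousAt_gTheta_comp {A B : ℂ} {x t : X → ℝ} {z : X → ℂ} (hx : ContinuousAt x q)
    (ht : ContinuousAt t q) (hz : ContinuousAt z q) (h : z q ∉ segment ℝ A B) :
    ContinuousAt (fun q => gTheta A B (x q) (t q) (z q)) q := by
  have hs := continuousAt_cutSqrt_comp continuousAt_const continuousAt_const hz h
  have hv : ContinuousAt (fun q => (1 - cutSqrt A B (z q)) / (1 + cutSqrt A B (z q))) q :=
    (hs.const_sub 1).div (hs.const_add 1) (one_add_ne_zero_of_re_nonneg (cutSqrt_re_pos h).le)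
  have h0 := continuousAt_theta_comp hx ht (continuousAt_const (y := (A + B) / 2))
  unfold gTheta
  fun_prop

lemma continuousAt_expSigma3_comp {f : X → ℂ} (hf : ContinuousAt f q) (i j : Fin 2) :
    ContinuousAt (fun q => expSigma3 (f q) i j) q :=
  (differentiable_expSigma3_apply i j).continuous.continuousAt.comp hf

lemma continuousAt_rot_comp {f : X → ℂ} (hf : ContinuousAt f q) (i j : Fin 2) :
    ContinuousAt (fun q => rot (f q) i j) q :=
  (continuous_rot_apply i j).continuousAt.comp hf

lemma continuousAt_bar_comp {e : X → ℂ} (he : ContinuousAt e q) :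
    ContinuousAt (fun q => bar (e q)) q :=
  Complex.continuous_conj.continuousAt.comp he

lemma neg_div_bar_mem_slitPlane {p e : ℂ} (hp : p.im ≠ 0) (he : e.re < p.re) :
    -((bar e - bar p) / (p - bar p)) ∈ Complex.slitPlane := by
  simpa using neg_div_mem_slitPlane (p := bar p) (e := bar e) (by simpa using hp) (by simpa using
    he)

lemma continuousAt_outerInf_comp {E₁ : ℂ} {κ : ℝ} {x t : X → ℝ} {e : X → ℂ} (h0 : 0 < E₁.im)
    (hx : ContinuousAt x q) (ht : ContinuousAt t q) (he : ContinuousAt e q)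
    (her : (e q).re < E₁.re) : ContinuousAt (fun q => outerInf E₁ (e q) κ (x q) (t q)) q := by
  have h1 := continuousAt_szegoInf_comp (A := E₁) (B := bar E₁) he
    (notMem_segment_of_re_lt rfl (by simp) her) (neg_div_mem_slitPlane h0.ne' her)
  have h2 := continuousAt_szegoInf_comp (A := bar E₁) (B := E₁) (continuousAt_bar_comp he)
    (notMem_segment_of_re_lt (by simp) rfl (by simpa)) (neg_div_bar_mem_slitPlane h0.ne' her)
  have h3 := continuousAt_theta_comp hx ht (continuousAt_const (y := (bar E₁ + E₁) / 2))
  unfold outerInf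
  exact ((((Complex.continuous_ofReal.continuousAt.comp ht).mul_const _).add h3).const_mul
    _ |>.sub (h1.const_mul _)).add (h2.const_mul _)

lemma continuousAt_frame_comp {E₁ p : ℂ} {κ α : ℝ} {x t : X → ℝ} {e z s : X → ℂ}
    (hx : ContinuousAt x q) (ht : ContinuousAt t q) (he : ContinuousAt e q)
    (hz : ContinuousAt z q) (hs : ContinuousAt s q) (hp : p.re = E₁.re)
    (h1 : (e q).re < p.re) (h2 : 0 < p.im * (e q).im) (h3 : (z q).re < p.re)
    (h4 : 0 < p.im * (z q).im) (i j : Fin 2) :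
    ContinuousAt (fun q => frame E₁ p (e q) κ α (x q) (t q) (s q) (z q) i j) q := by
  have hp0 : p.im ≠ 0 := by rintro h; rw [h, zero_mul] at h2; exact h2.ne rfl
  have n1 : z q ∉ segment ℝ (bar E₁) E₁ := notMem_segment_of_re_lt (by simp) rfl (hp ▸ h3)
  have n2 : z q ∉ segment ℝ p (bar p) := notMem_segment_of_re_lt rfl (by simp) h3
  have n2' : z q ∉ segment ℝ (bar p) p := notMem_segment_of_re_lt (by simp) rfl h3
  have n3 : e q ∉ segment ℝ p (bar p) := notMem_segment_of_re_lt rfl (by simp) h1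
  have n4 : bar (e q) ∉ segment ℝ (bar p) p := notMem_segment_of_re_lt (by simp) rfl (by simpa)
  have c1 : ContinuousAt (fun q => regExp E₁ p (e q) κ (x q) (t q) (z q)) q :=
    (((continuousAt_gTheta_comp hx ht hz n1).const_mul _).add
      ((((continuousAt_log_cutSqrt_add_comp he hz n2 n3).const_mul 2).add
      (continuousAt_log_neg_div he (neg_div_mem_slitPlane hp0 h1))).const_mul _)).add
      ((continuousAt_szegoLog_comp (continuousAt_bar_comp he) hz n2' n4
      (notMem_segment_bar h2 h4) (neg_div_bar_mem_slitPlane hp0 h1)).const_mul _)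
  refine continuousAt_mul_apply (continuousAt_expSigma3_comp hs.neg)
    (continuousAt_mul_apply (continuousAt_rot_comp
    (continuousAt_cutLog_comp continuousAt_const continuousAt_const hz n1))
    (continuousAt_expSigma3_comp (c1.sub
    (((continuousAt_theta_comp hx ht hz).add continuousAt_const).const_mul _)))) i j

end

/-- Uniform bound for `frame` near the shrinking arc. -/
lemma exists_bound_frame {E₁ E₃ p c : ℂ} {κ α κ₀ ρ₁ ρ₂ : ℝ} (h0 : 0 < E₁.im) (hp : p.re = E₁.re)
    (h3 : E₃.re + ρ₁ < E₁.re) (h1 : c.re + ρ₁ < p.re) (h2 : 0 < p.im * c.im)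
    (hball : ∀ z, ‖z - c‖ ≤ ρ₂ → z.re < p.re ∧ 0 < p.im * z.im) {K : Set (ℝ × ℝ)}
    (hK : IsCompact K) :
    ∃ C, ∀ ε ∈ Set.Icc 0 ρ₁, ∀ xt ∈ K, ∀ z, ‖z - c‖ ≤ ρ₂ → ∀ i j,
      ‖frame E₁ p (c + (ε : ℝ)) κ α xt.1 xt.2 (outerInf E₁ (E₃ + (ε : ℝ)) κ₀ xt.1 xt.2) z i j‖
        ≤ C := by
  -- `frame` depends continuously on all parameters up to and including `ε = 0`, so compactness
  -- gives a bound that does not deteriorate as the arc shrinks.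
  have hcomp : IsCompact (Set.Icc 0 ρ₁ ×ˢ (K ×ˢ Metric.closedBall c ρ₂)) :=
    isCompact_Icc.prod (hK.prod (isCompact_closedBall c ρ₂))
  have key : ∀ i j, ∃ C, ∀ q ∈ Set.Icc 0 ρ₁ ×ˢ (K ×ˢ Metric.closedBall c ρ₂),
      ‖frame E₁ p (c + (q.1 : ℝ)) κ α q.2.1.1 q.2.1.2
        (outerInf E₁ (E₃ + (q.1 : ℝ)) κ₀ q.2.1.1 q.2.1.2) q.2.2 i j‖ ≤ C := by
    intro i j
    refine hcomp.exists_bound_of_continuousOn (f := fun q : ℝ × ((ℝ × ℝ) × ℂ) =>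
      frame E₁ p (c + (q.1 : ℝ)) κ α q.2.1.1 q.2.1.2
        (outerInf E₁ (E₃ + (q.1 : ℝ)) κ₀ q.2.1.1 q.2.1.2) q.2.2 i j)
      fun q hq => ContinuousAt.continuousWithinAt ?_
    obtain ⟨⟨hq1, hq2⟩, -, hq3⟩ := hq
    rw [mem_closedBall_iff_norm] at hq3
    obtain ⟨b1, b2⟩ := hball _ hq3
    refine continuousAt_frame_comp (X := ℝ × ((ℝ × ℝ) × ℂ)) (x := fun q => q.2.1.1)
      (t := fun q => q.2.1.2) (e := fun q => c + (q.1 : ℝ)) (z := fun q => q.2.2)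
      (s := fun q => outerInf E₁ (E₃ + (q.1 : ℝ)) κ₀ q.2.1.1 q.2.1.2) (by fun_prop) (by fun_prop)
      (by fun_prop) (by fun_prop) ?_ hp ?_ ?_ b1 b2 i j
    · refine continuousAt_outerInf_comp (X := ℝ × ((ℝ × ℝ) × ℂ)) (x := fun q => q.2.1.1)
        (t := fun q => q.2.1.2) (e := fun q => E₃ + (q.1 : ℝ)) h0 (by fun_prop) (by fun_prop)
        (by fun_prop) ?_
      simp only [Complex.add_re, Complex.ofReal_re]
      linarith
    · simp only [Complex.add_re, Complex.ofReal_re]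
      linarith
    · simpa using h2
  choose C hC using key
  refine ⟨∑ i, ∑ j, |C i j|, fun ε hε xt hxt z hz i j => ?_⟩
  refine (hC i j (ε, xt, z) ⟨hε, hxt, mem_closedBall_iff_norm.2 hz⟩).trans
    ((le_abs_self _).trans ?_)
  refine (Finset.single_le_sum (f := fun j => |C i j|) (fun _ _ => abs_nonneg _)
    (Finset.mem_univ j)).trans ?_
  exact Finset.single_le_sum (f := fun i => ∑ j, |C i j|)
    (fun _ _ => Finset.sum_nonneg fun _ _ => abs_nonneg _) (Finset.mem_univ i)

/-! ### The mismatch tends to zero -/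

/-- Here `(z - b) / (z - a) - 1 = (a - b) / (z - a)` has numerator of modulus `ε` and denominator at
least `ρ / 2`. The principal filter in the product expresses uniformity in `z`. -/
lemma isBigO_cutLog_shrinking {c : ℂ} {ρ : ℝ} (hρ : 0 < ρ) {a b : ℝ → ℂ}
    (hab : (∀ ε : ℝ, a ε = c + (ε : ℝ) ∧ b ε = c) ∨ ∀ ε : ℝ, a ε = c ∧ b ε = c + (ε : ℝ)) :
    (fun q : ℝ × ℂ => cutLog (a q.1) (b q.1) q.2) =O[𝓝[>] 0 ×ˢ 𝓟 {z | ρ ≤ ‖z - c‖}]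
      fun q => q.1 := by
  have hsmall : ∀ᶠ ε : ℝ in 𝓝[>] 0, 0 < ε ∧ ε ≤ ρ / 2 := by
    filter_upwards [Ioc_mem_nhdsGT (half_pos hρ)] with ε h using h
  have h1 : (fun q : ℝ × ℂ => (q.2 - b q.1) / (q.2 - a q.1) - 1)
      =O[𝓝[>] 0 ×ˢ 𝓟 {z | ρ ≤ ‖z - c‖}] fun q => q.1 := by
    refine IsBigO.of_bound (2 / ρ) (eventually_prod_principal_iff.2 ?_)
    filter_upwards [hsmall] with ε hε z hz
    have hd : ‖a ε - b ε‖ = ε := by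
      rcases hab with h | h <;> rw [(h ε).1, (h ε).2] <;> simp [abs_of_pos hε.1]
    have ha : ρ / 2 ≤ ‖z - a ε‖ := by
      have hca : ‖a ε - c‖ ≤ ε := by
        rcases hab with h | h <;> rw [(h ε).1] <;> simp [abs_of_pos hε.1, hε.1.le]
      have := norm_sub_le_norm_sub_add_norm_sub z (a ε) c
      linarith [hε.2]
    have ha0 : 0 < ‖z - a ε‖ := (half_pos hρ).trans_le ha
    have e1 : (z - b ε) / (z - a ε) - 1 = (a ε - b ε) / (z - a ε) := by
      rw [div_sub_one (norm_pos_iff.1 ha0)]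
      congr 1
      ring
    rw [e1, norm_div, hd, Real.norm_of_nonneg hε.1.le, div_le_iff₀ ha0]
    calc ε = 2 / ρ * ε * (ρ / 2) := by field_simp
      _ ≤ _ := mul_le_mul_of_nonneg_left ha (by have := hε.1; positivity)
  have h0 : Tendsto (fun q : ℝ × ℂ => q.1) (𝓝[>] 0 ×ˢ 𝓟 {z | ρ ≤ ‖z - c‖}) (𝓝 0) :=
    (tendsto_nhdsWithin_iff.1 tendsto_id).1.comp tendsto_fst
  have h2 : Tendsto (fun q : ℝ × ℂ => (q.2 - b q.1) / (q.2 - a q.1))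
      (𝓝[>] 0 ×ˢ 𝓟 {z | ρ ≤ ‖z - c‖}) (𝓝 1) := by
    simpa using (h1.trans_tendsto h0).add_const 1
  have h3 := ((Complex.hasDerivAt_log
      Complex.one_mem_slitPlane).differentiableAt.isBigO_sub.comp_tendsto
    h2).trans h1
  simpa [Function.comp_def, cutLog] using h3

/-- The exponential has modulus `(4 |p - e| / ε)^μ` with `e = c + ε`, so the product is a bounded
factor times `ε^{1 - μ}`. It is used with `μ = ±2κ`. -/
lemma tendsto_mul_norm_exp {p c : ℂ} (hpc : p ≠ c) {μ : ℝ} (hμ : μ < 1) :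
    Tendsto (fun ε : ℝ => ε * ‖Complex.exp (μ * (2 * Complex.log 2 +
      Complex.log (-((p - (c + (ε : ℝ))) / (c - (c + (ε : ℝ)))))))‖) (𝓝[>] 0) (𝓝 0) := by
  have hcont : Tendsto (fun ε : ℝ => (4 * ‖p - (c + (ε : ℝ))‖) ^ μ * ε ^ (1 - μ)) (𝓝[>] 0)
      (𝓝 0) := by
    have h1 : ContinuousAt (fun ε : ℝ => (4 * ‖p - (c + (ε : ℝ))‖) ^ μ * ε ^ (1 - μ)) 0 := by
      refine ContinuousAt.mul (ContinuousAt.rpow_const (by fun_prop) (Or.inl ?_))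
        (ContinuousAt.rpow_const (by fun_prop) (Or.inr (by linarith)))
      simpa using sub_ne_zero.2 hpc
    have := h1.tendsto.mono_left (nhdsWithin_le_nhds (s := Set.Ioi 0))
    rwa [Real.zero_rpow (by linarith), mul_zero] at this
  have hne : ∀ᶠ ε : ℝ in 𝓝[>] 0, p - (c + (ε : ℝ)) ≠ 0 := by
    have : ContinuousAt (fun ε : ℝ => p - (c + (ε : ℝ))) 0 := by fun_prop
    exact (this.eventually_ne (by simpa using sub_ne_zero.2 hpc)).filter_mono nhdsWithin_le_nhds
  refine hcont.congr' ?_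
  filter_upwards [hne, self_mem_nhdsWithin] with ε h hε
  have hε0 : (0 : ℝ) < ε := hε
  have h0 : 0 < ‖p - (c + (ε : ℝ))‖ := norm_pos_iff.2 h
  have e1 : ‖-((p - (c + (ε : ℝ))) / (c - (c + (ε : ℝ))))‖ = ‖p - (c + (ε : ℝ))‖ / ε := by
    rw [norm_neg, norm_div]
    congr 1
    simp [abs_of_pos hε0]
  have e2 : (2 * Complex.log 2 + Complex.log (-((p - (c + (ε : ℝ))) / (c - (c + (ε : ℝ)))))).re =
      Real.log (4 * ‖p - (c + (ε : ℝ))‖ / ε) := by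
    have h4 : Real.log 4 = 2 * Real.log 2 := by
      rw [show (4 : ℝ) = 2 ^ 2 by norm_num, Real.log_pow]; norm_num
    rw [Complex.add_re, Complex.log_re, e1, mul_div_assoc, Real.log_mul (by norm_num)
      (by positivity),
      h4]
    simp [Complex.log_re]
  rw [Complex.norm_exp, Complex.re_ofReal_mul, e2, mul_comm μ, ← Real.rpow_def_of_pos
    (by positivity),
    Real.div_rpow (by positivity) hε0.le, Real.rpow_sub hε0, Real.rpow_one]
  ring

lemma mismatch_apply (p e c a b : ℂ) (κ : ℝ) (z ζ : ℂ)
    (hζ : ζ = κ * (2 * Complex.log 2 - 2 * Complex.log (cutSqrt e c z + cutSqrt e c p))) :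
    mismatch p e c a b κ z = !![Complex.cosh (cutLog a b z / 4) * Complex.exp ζ,
      Complex.I * Complex.sinh (cutLog a b z / 4) * Complex.exp (2 * innerConst p e c κ) *
        Complex.exp (-ζ);
      -(Complex.I * Complex.sinh (cutLog a b z / 4)) * Complex.exp (-(2 * innerConst p e c κ)) *
        Complex.exp ζ, Complex.cosh (cutLog a b z / 4) * Complex.exp (-ζ)] := by
  rw [mismatch, ← hζ]
  set d := innerConst p e c κ
  have e1 : Complex.exp d * Complex.exp (-d) = 1 := by rw [← Complex.exp_add]; simp
  have e2 : Complex.exp (2 * d) = Complex.exp d * Complex.exp d := by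
    rw [← Complex.exp_add]; congr 1; ring
  have e3 : Complex.exp (-(2 * d)) = Complex.exp (-d) * Complex.exp (-d) := by
    rw [← Complex.exp_add]; congr 1; ring
  have e4 : Complex.exp (ζ - d) = Complex.exp ζ * Complex.exp (-d) := by
    rw [← Complex.exp_add]; congr 1
  have e5 : Complex.exp (d - ζ) = Complex.exp (-ζ) * Complex.exp d := by
    rw [← Complex.exp_add]; congr 1; ring
  ext i j
  fin_cases i <;> fin_cases j <;>
    simp [expSigma3, rot, Matrix.mul_apply, e2, e3, e4, e5] <;> first
    | ring1
    | linear_combination Complex.cosh (cutLog a b z / 4) * Complex.exp ζ * e1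
    | linear_combination Complex.cosh (cutLog a b z / 4) * Complex.exp (-ζ) * e1

/-- The diagonal tends to `1`. Off the diagonal a factor `sinh (cutLog / 4) = O(ε)` competes with
`exp (±2 * innerConst)`, and the condition `|κ| < 1/2` lets the first one win for both signs. -/
lemma eventually_norm_mismatch_le {p c : ℂ} (hpc : c.re < p.re) {κ ρ : ℝ} (hκ : |κ| < 1 / 2)
    (hρ : 0 < ρ) {a b : ℝ → ℂ}
    (hab : (∀ ε : ℝ, a ε = c + (ε : ℝ) ∧ b ε = c) ∨ ∀ ε : ℝ, a ε = c ∧ b ε = c + (ε : ℝ))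
    {η : ℝ} (hη : 0 < η) : ∀ᶠ ε : ℝ in 𝓝[>] 0, ∀ z, ρ ≤ ‖z - c‖ → ∀ i j,
      ‖(mismatch p (c + (ε : ℝ)) c (a ε) (b ε) κ z - 1) i j‖ ≤ η := by
  have hpc' : p ≠ c := by rintro rfl; exact lt_irrefl _ hpc
  set l : Filter (ℝ × ℂ) := 𝓝[>] 0 ×ˢ 𝓟 {z | ρ ≤ ‖z - c‖} with hl
  have h0 : Tendsto (fun q : ℝ × ℂ => q.1) l (𝓝 0) :=
    (tendsto_nhdsWithin_iff.1 tendsto_id).1.comp tendsto_fst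
  have hΛ := isBigO_cutLog_shrinking hρ hab
  have hΛ0 : Tendsto (fun q : ℝ × ℂ => cutLog (a q.1) (b q.1) q.2 / 4) l (𝓝 0) := by
    simpa using (hΛ.trans_tendsto h0).div_const 4
  have hs1 : Tendsto (fun q : ℝ × ℂ => cutSqrt (c + (q.1 : ℝ)) c q.2) l (𝓝 1) := by
    have := ((isBigO_cutLog_shrinking (a := fun ε => c + (ε : ℝ)) (b := fun _ => c) hρ
      (Or.inl fun _ => ⟨rfl, rfl⟩)).trans_tendsto h0).div_const 2 |>.cexp
    simpa [cutSqrt] using this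
  have hs2 : Tendsto (fun q : ℝ × ℂ => cutSqrt (c + (q.1 : ℝ)) c p) l (𝓝 1) := by
    have h1 : ContinuousAt (fun ε : ℝ => cutSqrt (c + (ε : ℝ)) c p) 0 :=
      continuousAt_cutSqrt_comp (by fun_prop) continuousAt_const continuousAt_const
        (by simpa using hpc')
    have h2 : cutSqrt (c + (0 : ℝ)) c p = 1 := by
      simp [cutSqrt, cutLog, div_self (sub_ne_zero.2 hpc')]
    have := h1.tendsto
    rw [h2] at this
    exact this.comp h0
  have hζ : Tendsto (fun q : ℝ × ℂ => κ * (2 * Complex.log 2 -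
      2 * Complex.log (cutSqrt (c + (q.1 : ℝ)) c q.2 + cutSqrt (c + (q.1 : ℝ)) c p))) l (𝓝 0) := by
    have h2 := ((((hs1.add hs2).clog (by norm_num)).const_mul 2).const_sub
      (2 * Complex.log 2)).const_mul (κ : ℂ)
    refine tendsto_nhds_of_eq h2 ?_
    norm_num
  have hch := (Complex.continuous_cosh.tendsto 0).comp hΛ0
  rw [Complex.cosh_zero] at hch
  have hsh : (fun q : ℝ × ℂ => Complex.sinh (cutLog (a q.1) (b q.1) q.2 / 4)) =O[l]
      fun q => q.1 := by
    have h1 := ((Complex.hasDerivAt_sinh 0).differentiableAt.isBigO_sub.comp_tendsto hΛ0)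
    simp only [Function.comp_def, Complex.sinh_zero, sub_zero] at h1
    refine h1.trans ?_
    exact (hΛ.const_mul_left (1 / 4 : ℂ)).congr_left fun q => by ring
  have hd : ∀ μ : ℝ, μ < 1 → Tendsto (fun q : ℝ × ℂ =>
      Complex.sinh (cutLog (a q.1) (b q.1) q.2 / 4) * Complex.exp (μ * (2 * Complex.log 2 +
      Complex.log (-((p - (c + (q.1 : ℝ))) / (c - (c + (q.1 : ℝ)))))))) l (𝓝 0) := by
    intro μ hμ
    have h1 := hsh.mul (isBigO_refl (fun q : ℝ × ℂ => ‖Complex.exp (μ * (2 * Complex.log 2 +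
      Complex.log (-((p - (c + (q.1 : ℝ))) / (c - (c + (q.1 : ℝ)))))))‖) l).of_norm_left
    exact h1.trans_tendsto ((tendsto_mul_norm_exp hpc' hμ).comp tendsto_fst)
  have hκ1 := abs_lt.1 hκ
  have hd1 := hd (2 * κ) (by linarith)
  have hd2 := hd (-(2 * κ)) (by linarith)
  have hlim : Tendsto (fun q : ℝ × ℂ => mismatch p (c + (q.1 : ℝ)) c (a q.1) (b q.1) κ q.2) l
      (𝓝 1) := by
    refine tendsto_mat_iff.2 fun i j => ?_
    simp only [mismatch_apply _ _ _ _ _ _ _ _ rfl]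
    fin_cases i <;> fin_cases j
    · refine tendsto_nhds_of_eq (hch.mul hζ.cexp) (by simp)
    · have := (hd1.const_mul Complex.I).mul hζ.neg.cexp
      refine (tendsto_nhds_of_eq this (by simp)).congr fun q => ?_
      simp only [innerConst]
      push_cast
      simp only [Matrix.of_apply, Matrix.cons_val', Matrix.cons_val_zero, Matrix.cons_val_one,
        Matrix.cons_val_fin_one, ← mul_assoc]
    · have := (hd2.const_mul (-Complex.I)).mul hζ.cexp
      refine (tendsto_nhds_of_eq this (by simp)).congr fun q => ?_
      simp only [innerConst]
      push_cast
      simp only [Matrix.of_apply, Matrix.cons_val', Matrix.cons_val_zero, Matrix.cons_val_one,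
        Matrix.cons_val_fin_one, ← mul_assoc, neg_mul]
    · refine tendsto_nhds_of_eq (hch.mul hζ.neg.cexp) (by simp)
  have hfin : ∀ᶠ q in l, ∀ i j, ‖(mismatch p (c + (q.1 : ℝ)) c (a q.1) (b q.1) κ q.2 - 1) i j‖
      ≤ η := by
    refine eventually_all.2 fun i => eventually_all.2 fun j => ?_
    filter_upwards [(Metric.tendsto_nhds.1 (tendsto_mat_iff.1 hlim i j)) η hη] with q hq
    rw [dist_eq_norm] at hq
    exact hq.le
  exact eventually_prod_principal_iff.1 hfin

/-! ### The phase constant -/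

lemma bar_log {z : ℂ} (hz : z ∈ Complex.slitPlane) :
    bar (Complex.log z) = Complex.log (bar z) :=
  (Complex.log_conj _ (Complex.mem_slitPlane_iff_arg.1 hz).1).symm

lemma cutLog_bar {A B z : ℂ} (hz : z ∉ segment ℝ A B) :
    cutLog (bar A) (bar B) (bar z) = bar (cutLog A B z) := by
  rw [cutLog, cutLog, bar_log (div_mem_slitPlane hz)]
  simp [bar]

lemma cutSqrt_bar {A B z : ℂ} (hz : z ∉ segment ℝ A B) :
    cutSqrt (bar A) (bar B) (bar z) = bar (cutSqrt A B z) := by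
  rw [cutSqrt, cutSqrt, cutLog_bar hz]
  simp [bar, ← Complex.exp_conj, map_ofNat]

lemma szegoInf_bar {A B e : ℂ} (he : e ∉ segment ℝ A B)
    (hη : -((e - A) / (B - A)) ∈ Complex.slitPlane) :
    szegoInf (bar A) (bar B) (bar e) = bar (szegoInf A B e) := by
  have h1 : 1 + cutSqrt A B e ∈ Complex.slitPlane :=
    add_mem_slitPlane (by simp) (cutSqrt_re_pos he)
  have e3 : bar (szegoInf A B e) = -2 * bar (Complex.log (1 + cutSqrt A B e)) -
      bar (Complex.log (-((e - A) / (B - A)))) := by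
    simp [szegoInf, bar, map_ofNat]
  rw [e3, bar_log h1, bar_log hη, szegoInf, cutSqrt_bar he]
  simp [bar]

/-- The limiting phase constant. -/
noncomputable def phaseConst (E₁ e : ℂ) (κ : ℝ) : ℂ :=
  Complex.exp (-2 * (-κ * szegoInf E₁ (bar E₁) e + κ * szegoInf (bar E₁) E₁ (bar e)))

/-- The two values of `szegoInf` are complex conjugates, so their difference, and with it the
exponent, is purely imaginary. -/
lemma norm_phaseConst {E₁ e : ℂ} (h0 : 0 < E₁.im) (he : e.re < E₁.re) (κ : ℝ) :
    ‖phaseConst E₁ e κ‖ = 1 := by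
  have h := szegoInf_bar (A := E₁) (B := bar E₁) (e := e)
    (notMem_segment_of_re_lt rfl (by simp) he) (neg_div_mem_slitPlane h0.ne' he)
  rw [show bar (bar E₁) = E₁ from Complex.conj_conj _] at h
  rw [phaseConst, Complex.norm_exp, h, Real.exp_eq_one_iff]
  simp

lemma planeWave_phaseConst (E₁ e : ℂ) (κ x t : ℝ) :
    planeWave E₁ (phaseConst E₁ e κ) x t = -(E₁.im * Complex.exp (-2 * outerInf E₁ e κ x t)) := by
  have h1 : E₁ - bar E₁ = 2 * E₁.im * Complex.I := sub_bar_self _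
  have h2 : bar E₁ + E₁ = 2 * E₁.re := by
    rw [add_comm]
    apply Complex.ext <;> simp
    ring
  rw [planeWave, phaseConst, mul_assoc, ← Complex.exp_add]
  congr 3
  rw [outerInf, h1, h2, theta]
  push_cast
  linear_combination (2 * Complex.I * t * (E₁.im : ℂ) ^ 2) * Complex.I_sq

/-- The outer parametrix is attached to `E₂` and not to `E₃`, so its phase still depends on `ε`. -/
lemma tendsto_phaseConst {E₁ E₃ : ℂ} (h0 : 0 < E₁.im) (he : E₃.re < E₁.re) (κ : ℝ) :
    Tendsto (fun ε : ℝ => phaseConst E₁ (E₃ + (ε : ℝ)) κ) (𝓝[>] 0) (𝓝 (phaseConst E₁ E₃ κ)) := by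
  have hc : ContinuousAt (fun ε : ℝ => E₃ + (ε : ℝ)) 0 := by fun_prop
  have he' : (E₃ + (0 : ℝ)).re < E₁.re := by simpa
  have h1 := continuousAt_szegoInf_comp (A := E₁) (B := bar E₁) hc
    (notMem_segment_of_re_lt rfl (by simp) he') (neg_div_mem_slitPlane h0.ne' he')
  have h2 := continuousAt_szegoInf_comp (A := bar E₁) (B := E₁) (continuousAt_bar_comp hc)
    (notMem_segment_of_re_lt (by simp) rfl (by simpa)) (neg_div_bar_mem_slitPlane h0.ne' he')
  have h3 : ContinuousAt (fun ε : ℝ => phaseConst E₁ (E₃ + (ε : ℝ)) κ) 0 :=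
    (((h1.const_mul _).add (h2.const_mul _)).const_mul _).cexp
  have := h3.tendsto.mono_left (nhdsWithin_le_nhds (s := Set.Ioi 0))
  simpa using this

/-! ### Functions near infinity -/

lemma eventually_lt_norm_sub (c : ℂ) (ρ : ℝ) : ∀ᶠ z : ℂ in cobounded ℂ, ρ < ‖z - c‖ := by
  filter_upwards [isBounded_def.1 (Metric.isBounded_closedBall (x := c) (r := ρ))] with z hz
  simpa [dist_eq_norm] using hz

lemma tendsto_norm_div_norm_sub (c : ℂ) :
    Tendsto (fun z : ℂ => ‖z‖ * ‖z - c‖⁻¹) (cobounded ℂ) (𝓝 1) := by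
  have h1 : Tendsto (fun z : ℂ => (1 - c * z⁻¹)⁻¹) (cobounded ℂ) (𝓝 1) := by
    have h0 : Tendsto (fun z : ℂ => z⁻¹) (cobounded ℂ) (𝓝 0) := tendsto_inv₀_cobounded
    have := ((h0.const_mul c).const_sub 1).inv₀ (by simp)
    simpa using this
  have h2 := h1.norm
  rw [norm_one] at h2
  refine h2.congr' ?_
  filter_upwards [eventually_ne_zero_cobounded] with z hz
  have : 1 - c * z⁻¹ = (z - c) * z⁻¹ := by field_simp
  rw [this, mul_inv, inv_inv, norm_mul, norm_inv, mul_comm]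

/-- A holomorphic function dominated by `∑ 1 / ‖z - c‖` near infinity has a residue there. -/
lemma exists_tendsto_mul_of_norm_le {ι : Type*} [Fintype ι] {c : ι → ℂ} {ρ D : ℝ} {f : ℂ → ℂ}
    (hf : DifferentiableOn ℂ f {z | ∀ j, ρ < ‖z - c j‖})
    (hb : ∀ z, (∀ j, ρ < ‖z - c j‖) → ‖f z‖ ≤ D * ∑ j, ‖z - c j‖⁻¹) :
    ∃ r, ‖r‖ ≤ D * Fintype.card ι ∧ Tendsto (fun z => z * f z) (cobounded ℂ) (𝓝 r) := by
  have hfar : ∀ᶠ z : ℂ in cobounded ℂ, ∀ j, ρ < ‖z - c j‖ :=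
    eventually_all.2 fun j => eventually_lt_norm_sub _ _
  have hopen : IsOpen {z : ℂ | ∀ j, ρ < ‖z - c j‖} := by
    rw [Set.ofPred_forall]
    exact isOpen_iInter_of_finite fun j => isOpen_lt_norm_sub _ _
  have hlim : Tendsto (fun z : ℂ => D * ∑ j, ‖z‖ * ‖z - c j‖⁻¹) (cobounded ℂ)
      (𝓝 (D * Fintype.card ι)) := by
    have := (tendsto_finsetSum (Finset.univ : Finset ι)
      fun j _ => tendsto_norm_div_norm_sub (c j)).const_mul D
    simpa using this
  have hle : ∀ᶠ z in cobounded ℂ, ‖z * f z‖ ≤ D * ∑ j, ‖z‖ * ‖z - c j‖⁻¹ := by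
    filter_upwards [hfar] with z hz
    rw [norm_mul, ← Finset.mul_sum, mul_left_comm]
    exact mul_le_mul_of_nonneg_left (hb z hz) (norm_nonneg _)
  obtain ⟨r, hr⟩ : ∃ r, Tendsto (fun z => z * f z) (cobounded ℂ) (𝓝 r) := by
    -- In the variable `w = 1/z` the function `w⁻¹ * f w⁻¹` is bounded near `0`, and a removable
    -- singularity supplies the limit.
    have hinv : Tendsto (fun w : ℂ => w⁻¹) (𝓝[≠] 0) (cobounded ℂ) := tendsto_inv₀_nhdsNE_zero
    have h1 : ∀ᶠ w in 𝓝[≠] (0 : ℂ), DifferentiableAt ℂ (fun w => w⁻¹ * f w⁻¹) w := by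
      filter_upwards [hinv.eventually hfar, self_mem_nhdsWithin] with w hw hw0
      have hi : DifferentiableAt ℂ (fun w : ℂ => w⁻¹) w := differentiableAt_inv hw0
      exact hi.mul ((hf.differentiableAt (hopen.mem_nhds hw)).comp w hi)
    have h2 : IsBoundedUnder (· ≤ ·) (𝓝[≠] (0 : ℂ))
        fun w => ‖w⁻¹ * f w⁻¹ - (0 : ℂ)⁻¹ * f (0 : ℂ)⁻¹‖ := by
      -- The value at `w = 0` is `0` because `0⁻¹ = 0`.
      simp only [inv_zero, zero_mul, sub_zero]
      exact (((hlim.comp hinv).isBoundedUnder_le).mono_le (hinv.eventually hle))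
    have h3 := Complex.tendsto_limUnder_of_differentiable_on_punctured_nhds_of_bounded_under h1 h2
    refine ⟨_, (h3.comp (tendsto_inv₀_cobounded' (α := ℂ))).congr fun z => ?_⟩
    simp
  exact ⟨r, le_of_tendsto_of_tendsto hr.norm hlim hle, hr⟩

lemma nearInf_of_tendsto_mul {f : ℂ → ℂ} {a r : ℂ}
    (h : Tendsto (fun z => z * (f z - a)) (cobounded ℂ) (𝓝 r)) : NearInf f a := by
  have h1 := (isBigO_refl (fun z : ℂ => z⁻¹) (cobounded ℂ)).mul (h.isBigO_one ℂ)
  simp only [mul_one] at h1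
  refine h1.congr' ?_ EventuallyEq.rfl
  filter_upwards [eventually_ne_zero_cobounded] with z hz
  rw [inv_mul_cancel_left₀ hz]

/-! ### Gluing -/

/-- The discs are disjoint, so the index of the disc containing a point is determined. Agreement on
the annuli is required only off `Γ`, where the values matter. -/
lemma exists_glue {ι : Type*} {c : ι → ℂ} {ρ₁ ρ₂ : ℝ}
    (hsep : ∀ j k, j ≠ k → ∀ z, ‖z - c j‖ < ρ₂ → ρ₂ ≤ ‖z - c k‖) {Γ : Set ℂ} {F : ℂ → Mat}
    {G : ι → ℂ → Mat} (hFG : ∀ j, ∀ z ∈ annulus (c j) ρ₁ ρ₂, z ∉ Γ → F z = G j z) :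
    ∃ Ψ : ℂ → Mat, (∀ z ∉ Γ, (∀ j, ρ₁ < ‖z - c j‖) → Ψ z = F z) ∧
      ∀ j, ∀ z ∉ Γ, ‖z - c j‖ < ρ₂ → Ψ z = G j z := by
  classical
  refine ⟨fun z => if h : ∃ j, ‖z - c j‖ < ρ₂ then G h.choose z else F z, fun z hz h => ?_,
    fun j z hz h => ?_⟩
  · by_cases h' : ∃ j, ‖z - c j‖ < ρ₂
    · simp only [h', dif_pos]
      exact (hFG _ z ⟨h _, h'.choose_spec⟩ hz).symm
    · simp only [h', dif_neg, not_false_eq_true]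
  · have h' : ∃ j, ‖z - c j‖ < ρ₂ := ⟨j, h⟩
    have : h'.choose = j := by
      by_contra hne
      exact absurd h (not_lt.2 (hsep _ _ hne z h'.choose_spec))
    simp only [h', dif_pos]
    rw [this]

/-! ### The two local problems -/

/-- The identity or the complex conjugation. -/
def reflIf (j : Bool) (z : ℂ) : ℂ := if j then bar z else z

lemma reflIf_re (j : Bool) (z : ℂ) : (reflIf j z).re = z.re := by cases j <;> simp [reflIf]

lemma reflIf_E2 (j : Bool) (E₃ : ℂ) (ε : ℝ) : reflIf j (E2 E₃ ε) = reflIf j E₃ + (ε : ℝ) := by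
  cases j <;> simp [reflIf, E2]

lemma reflIf_im_mul_pos {z w : ℂ} (hz : 0 < z.im) (hw : 0 < w.im) (j : Bool) :
    0 < (reflIf j z).im * (reflIf j w).im := by
  cases j <;> simp [reflIf, mul_pos hz hw]

/-- The initial point of the shrinking arc. -/
def arcStart (j : Bool) (E₃ : ℂ) (ε : ℝ) : ℂ := if j then bar E₃ else E2 E₃ ε

/-- The end point of the shrinking arc. -/
def arcEnd (j : Bool) (E₃ : ℂ) (ε : ℝ) : ℂ := if j then bar (E2 E₃ ε) else E₃

/-- The exponent with the sign belonging to the half-plane. -/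
def signed (j : Bool) (κ : ℝ) : ℝ := if j then -κ else κ

/-- The two local parametrices. -/
noncomputable def localInner (E₁ E₃ : ℂ) (ε κ α x t : ℝ) (j : Bool) (z : ℂ) : Mat :=
  inner E₁ (reflIf j E₁) (reflIf j (E2 E₃ ε)) (reflIf j E₃) (arcStart j E₃ ε) (arcEnd j E₃ ε)
    (signed j κ) α x t (outerInf E₁ (E2 E₃ ε) κ x t) z

/-- The errors made by the outer parametrix on the two annuli. -/
noncomputable def localError (E₁ E₃ : ℂ) (ε κ α x t : ℝ) (j : Bool) (z : ℂ) : Mat :=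
  parametrixError E₁ (reflIf j E₁) (reflIf j (E2 E₃ ε)) (reflIf j E₃) (arcStart j E₃ ε) (arcEnd j
  E₃ ε)
    (signed j κ) α x t (outerInf E₁ (E2 E₃ ε) κ x t) z

section
variable {E₁ E₃ z : ℂ} {ε κ α x t ρ : ℝ} {j : Bool}

lemma notMem_of_notMem_closedContour (hz : z ∉ closedContour E₁ E₃ ε) (j : Bool) :
    z ∉ segment ℝ (arcStart j E₃ ε) (arcEnd j E₃ ε) ∧
    z ∉ segment ℝ (reflIf j (E2 E₃ ε)) (reflIf j E₃) ∧
    z ∉ segment ℝ (reflIf j (E2 E₃ ε)) (reflIf j E₁) := by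
  simp only [closedContour, Set.mem_union, not_or] at hz
  obtain ⟨⟨⟨⟨h1, h2⟩, h3⟩, h4⟩, h5⟩ := hz
  cases j
  · exact ⟨h5, h5, by rwa [segment_symm] at h4⟩
  · exact ⟨h1, by rwa [segment_symm] at h1, h2⟩

lemma disc_subset (him : 0 < E₁.im) (h1 : ρ < E₃.im) (h2 : E₃.re + ρ < E₁.re)
    (hz : ‖z - reflIf j E₃‖ ≤ ρ) : z.re < (reflIf j E₁).re ∧ 0 < (reflIf j E₁).im * z.im := by
  have hr := abs_le.1 ((Complex.abs_re_le_norm _).trans hz)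
  have hi := abs_le.1 ((Complex.abs_im_le_norm _).trans hz)
  rw [Complex.sub_re, reflIf_re] at hr
  rw [Complex.sub_im] at hi
  refine ⟨by rw [reflIf_re]; linarith, ?_⟩
  cases j
  · simp only [reflIf, Bool.false_eq_true, if_false] at hi ⊢
    exact mul_pos him (by linarith)
  · simp only [reflIf, if_true, Complex.conj_im] at hi ⊢
    exact mul_pos_of_neg_of_neg (by linarith) (by linarith)

lemma disc_separated (him : 0 < E₁.im) (h1 : ρ < E₃.im) (h2 : E₃.re + ρ < E₁.re) (j k : Bool)
    (hjk : j ≠ k) (z : ℂ) (hz : ‖z - reflIf j E₃‖ < ρ) : ρ ≤ ‖z - reflIf k E₃‖ := by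
  by_contra! hk
  have a1 := (disc_subset him h1 h2 hz.le).2
  have a2 := (disc_subset him h1 h2 hk.le).2
  cases j <;> cases k
  · exact hjk rfl
  · simp [reflIf] at a1 a2; linarith
  · simp [reflIf] at a1 a2; linarith
  · exact hjk rfl

/-- Reflection reverses the orientation: the upper short arc starts at `E₂` and the lower one ends
at `bar E₂`. This is why `inner` carries the oriented ends `a`, `b` besides `e`, `c`. -/
lemma arc_eq (j : Bool) :
    arcStart j E₃ ε = reflIf j (E2 E₃ ε) ∧ arcEnd j E₃ ε = reflIf j E₃ ∨
    arcStart j E₃ ε = reflIf j E₃ ∧ arcEnd j E₃ ε = reflIf j (E2 E₃ ε) := by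
  cases j
  exacts [Or.inl ⟨rfl, rfl⟩, Or.inr ⟨rfl, rfl⟩]

lemma localInner_eq (hz : z ∉ closedContour E₁ E₃ ε) (j : Bool) :
    localInner E₁ E₃ ε κ α x t j z =
      (1 + localError E₁ E₃ ε κ α x t j z) * outer E₁ (E2 E₃ ε) κ x t z := by
  rw [localInner, inner_eq_mul (notMem_of_notMem_closedContour hz j).2.2, localError, outer]
  cases j
  · rw [outerExp_eq_upper]; rfl
  · rw [outerExp_eq_lower]; rfl

section
variable (A : Admissible E₁ E₃ ε)
include A

lemma Admissible.refl_E2_re_lt (j : Bool) : (reflIf j (E2 E₃ ε)).re < (reflIf j E₁).re := by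
  rw [reflIf_re, reflIf_re, E2_re]; exact A.re

lemma Admissible.refl_E2_im (j : Bool) : 0 < (reflIf j E₁).im * (reflIf j (E2 E₃ ε)).im :=
  reflIf_im_mul_pos A.im₁ (by rw [E2_im]; exact A.im₃) j

lemma Admissible.refl_notMem (j : Bool) :
    reflIf j E₁ ∉ segment ℝ (reflIf j (E2 E₃ ε)) (reflIf j E₃) := by
  intro h
  have h1 := A.pos
  have h2 := A.re
  have := (re_mem_of_mem_segment (l := E₃.re) (u := E₃.re + ε) h
    (by rw [reflIf_re, E2_re]; linarith) (by rw [reflIf_re]) (by rw [reflIf_re, E2_re])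
    (by rw [reflIf_re]; linarith)).2
  rw [reflIf_re] at this
  linarith

lemma Admissible.refl_ne (j : Bool) : reflIf j (E2 E₃ ε) ≠ reflIf j E₃ := by
  rw [reflIf_E2]
  simpa using A.pos.ne'

lemma Admissible.refl_slitPlane (j : Bool) :
    -((reflIf j E₁ - reflIf j (E2 E₃ ε)) / (reflIf j E₃ - reflIf j (E2 E₃ ε))) ∈ Complex.slitPlane
    := by
  left
  have h : reflIf j E₃ - reflIf j (E2 E₃ ε) = -(ε : ℂ) := by rw [reflIf_E2]; ring
  have h1 := A.refl_E2_re_lt j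
  rw [h, div_neg, neg_neg, Complex.div_ofReal_re, Complex.sub_re]
  exact div_pos (by linarith) A.pos

end

end

/-! ### Assembling the solution -/

lemma mem_arcs_arc (E₁ E₃ : ℂ) (ε : ℝ) (j : Bool) :
    (arcStart j E₃ ε, arcEnd j E₃ ε) ∈ arcs E₁ E₃ ε := by
  cases j <;> simp [arcs, arcStart, arcEnd]

section
variable {E₁ E₃ : ℂ} {ε : ℝ} (A : Admissible E₁ E₃ ε)
include A

/-- A continuous left factor does not change a jump on the right. Near an interior point of an arc
the contour lies on a single line, so an identity off the contour holds on both sides of that line.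
-/
lemma Admissible.jumpAt_of_eventually {s : ℂ × ℂ} (hs : s ∈ arcs E₁ E₃ ε) {z : ℂ}
    (hz : z ∈ openSegment ℝ s.1 s.2) {Ψ C G : ℂ → Mat} {M : Mat} (hG : JumpAt G s.1 s.2 z M)
    (hC : ∀ i j, ContinuousAt (fun w => C w i j) z)
    (h : ∀ᶠ w in 𝓝 z, w ∉ closedContour E₁ E₃ ε → Ψ w = C w * G w) :
    JumpAt Ψ s.1 s.2 z M := by
  refine (hG.mul_left hC).congr ?_
  filter_upwards [h, A.eventually_mem_openSegment hs hz] with w h1 h2 hw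
  refine (h1 fun hΓ => ?_).symm
  exact segment_subset_compl_offLine _ _ (openSegment_subset_segment ℝ _ _ (h2 hΓ)) hw

lemma Admissible.dist_le_of_mem_arc {j : Bool} {z : ℂ}
    (hz : z ∈ segment ℝ (arcStart j E₃ ε) (arcEnd j E₃ ε)) : ‖z - reflIf j E₃‖ ≤ ε := by
  have h1 : reflIf j E₃ ∈ Metric.closedBall (reflIf j E₃) ε :=
    Metric.mem_closedBall_self A.pos.le
  have h2 : reflIf j (E2 E₃ ε) ∈ Metric.closedBall (reflIf j E₃) ε := by
    rw [mem_closedBall_iff_norm, reflIf_E2]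
    simp [abs_of_pos A.pos]
  rw [← mem_closedBall_iff_norm]
  rcases arc_eq (E₃ := E₃) (ε := ε) j with ⟨e1, e2⟩ | ⟨e1, e2⟩ <;> rw [e1, e2] at hz
  · exact (convex_closedBall _ _).segment_subset h2 h1 hz
  · exact (convex_closedBall _ _).segment_subset h1 h2 hz

/-- Jumps and growth are local and survive multiplication from the left by `R` or `S`, so each arc
is checked with the parametrix available there. The short arcs lie in the discs and the vertical arc
outside them; the two remaining arcs pass through both regions. -/
theorem Admissible.isRHSolution_of_parametrices {α β x t ρ₁ ρ₂ : ℝ} (h12 : ρ₁ < ρ₂) (hε : ε < ρ₁)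
    (him : ρ₂ < E₃.im) (hre : E₃.re + ρ₂ < E₁.re) {R Ψ : ℂ → Mat} {S : Bool → ℂ → Mat}
    (hR : ∀ a b, DifferentiableOn ℂ (fun z => R z a b) {z | ∀ j, ρ₁ < ‖z - reflIf j E₃‖})
    (hS : ∀ j a b, DifferentiableOn ℂ (fun z => S j z a b) {z | ‖z - reflIf j E₃‖ < ρ₂})
    (hout : ∀ z ∉ closedContour E₁ E₃ ε, (∀ j, ρ₁ < ‖z - reflIf j E₃‖) →
      Ψ z = R z * outer E₁ (E2 E₃ ε) (β / (2 * Real.pi)) x t z)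
    (hin : ∀ j, ∀ z ∉ closedContour E₁ E₃ ε, ‖z - reflIf j E₃‖ < ρ₂ →
      Ψ z = S j z * localInner E₁ E₃ ε (β / (2 * Real.pi)) α x t j z)
    (hinf : ∀ a b, NearInf (fun z => R z a b) ((1 : Mat) a b)) :
    IsRHSolution E₁ E₃ α β ε x t Ψ := by
  set κ := β / (2 * Real.pi) with hκ
  have hcl := (isCompact_closedContour E₁ E₃ ε).isClosed
  have hlt : (E2 E₃ ε).re < E₁.re := by rw [E2_re]; exact A.re
  have hUo : IsOpen {z : ℂ | ∀ j, ρ₁ < ‖z - reflIf j E₃‖} := by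
    rw [Set.ofPred_forall]
    exact isOpen_iInter_of_finite fun j => isOpen_lt_norm_sub _ _
  have hDo : ∀ j, IsOpen {z : ℂ | ‖z - reflIf j E₃‖ < ρ₂} := fun j => isOpen_norm_sub_lt _ _
  have hR' : ∀ z, (∀ j, ρ₁ < ‖z - reflIf j E₃‖) → ∀ a b,
      DifferentiableAt ℂ (fun z => R z a b) z := fun z hz a b =>
    (hR a b).differentiableAt (hUo.mem_nhds hz)
  have hS' : ∀ j z, ‖z - reflIf j E₃‖ < ρ₂ → ∀ a b,
      DifferentiableAt ℂ (fun z => S j z a b) z := fun j z hz a b =>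
    (hS j a b).differentiableAt ((hDo j).mem_nhds hz)
  have hcover : ∀ z, (∃ j, ‖z - reflIf j E₃‖ < ρ₂) ∨ ∀ j, ρ₁ < ‖z - reflIf j E₃‖ := by
    intro z
    by_cases h : ∃ j, ‖z - reflIf j E₃‖ < ρ₂
    · exact Or.inl h
    · push Not at h
      exact Or.inr fun j => h12.trans_le (h j)
  have hinE : ∀ j z, ‖z - reflIf j E₃‖ < ρ₂ → ∀ᶠ w in 𝓝 z, w ∉ closedContour E₁ E₃ ε →
      Ψ w = S j w * localInner E₁ E₃ ε κ α x t j w := by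
    intro j z hz
    filter_upwards [(hDo j).mem_nhds hz] with w hw hwΓ using hin j w hwΓ hw
  have houtE : ∀ z, (∀ j, ρ₁ < ‖z - reflIf j E₃‖) → ∀ᶠ w in 𝓝 z, w ∉ closedContour E₁ E₃ ε →
      Ψ w = R w * outer E₁ (E2 E₃ ε) κ x t w := by
    intro z hz
    filter_upwards [hUo.mem_nhds hz] with w hw hwΓ using hout w hwΓ hw
  have hout' : ∀ z, (∀ j, ρ₁ < ‖z - reflIf j E₃‖) → ∀ s ∈ arcs E₁ E₃ ε,
      z ∈ openSegment ℝ s.1 s.2 → ∀ M, JumpAt (outer E₁ (E2 E₃ ε) κ x t) s.1 s.2 z M →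
      JumpAt Ψ s.1 s.2 z M := fun z hz s hs hzs M hM =>
    A.jumpAt_of_eventually hs hzs hM (fun a b => (hR' z hz a b).continuousAt) (houtE z hz)
  have hin' : ∀ j z, ‖z - reflIf j E₃‖ < ρ₂ → ∀ s ∈ arcs E₁ E₃ ε,
      z ∈ openSegment ℝ s.1 s.2 → ∀ M, JumpAt (localInner E₁ E₃ ε κ α x t j) s.1 s.2 z M →
      JumpAt Ψ s.1 s.2 z M := fun j z hz s hs hzs M hM =>
    A.jumpAt_of_eventually hs hzs hM (fun a b => (hS' j z hz a b).continuousAt) (hinE j z hz)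
  have hnot : ∀ s ∈ arcs E₁ E₃ ε, ∀ z ∈ openSegment ℝ s.1 s.2, ∀ s' ∈ arcs E₁ E₃ ε, s' ≠ s →
      z ∉ segment ℝ s'.1 s'.2 := fun s hs z hz s' hs' hne => A.notMem_segment hs hz hs' hne
  have m32 : (bar E₃, bar (E2 E₃ ε)) ∈ arcs E₁ E₃ ε := by simp [arcs]
  have m21 : (bar (E2 E₃ ε), bar E₁) ∈ arcs E₁ E₃ ε := by simp [arcs]
  have m11 : (bar E₁, E₁) ∈ arcs E₁ E₃ ε := by simp [arcs]
  have m12 : (E₁, E2 E₃ ε) ∈ arcs E₁ E₃ ε := by simp [arcs]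
  have m23 : (E2 E₃ ε, E₃) ∈ arcs E₁ E₃ ε := by simp [arcs]
  have i1 := A.im₁
  have i3 := A.im₃
  have ip := A.pos
  -- the arc `(E₂, E₃)` and its mirror image
  have hcut : ∀ j, ∀ z ∈ openSegment ℝ (arcStart j E₃ ε) (arcEnd j E₃ ε),
      z ∉ segment ℝ (reflIf j (E2 E₃ ε)) (reflIf j E₁) →
      JumpAt Ψ (arcStart j E₃ ε) (arcEnd j E₃ ε) z (twist (theta z x t + α / 2)) := by
    intro j z hz hz'
    have hd : ‖z - reflIf j E₃‖ < ρ₂ :=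
      (A.dist_le_of_mem_arc (openSegment_subset_segment ℝ _ _ hz)).trans_lt (hε.trans h12)
    obtain ⟨d1, d2⟩ := disc_subset i1 him hre hd.le
    exact hin' j z hd _ (mem_arcs_arc E₁ E₃ ε j) hz _ (jumpAt_inner_cut (reflIf_re j E₁)
      (A.refl_E2_re_lt j) (A.refl_E2_im j) d1 d2 (A.refl_notMem j) (A.refl_ne j)
      (A.refl_slitPlane j) (arc_eq j) hz hz')
  -- the arc `(E₁, E₂)` and its mirror image inside the discs
  have hbranch : ∀ j z, ‖z - reflIf j E₃‖ < ρ₂ →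
      z ∈ openSegment ℝ (reflIf j (E2 E₃ ε)) (reflIf j E₁) →
      z ∉ segment ℝ (arcStart j E₃ ε) (arcEnd j E₃ ε) →
      JumpAt (localInner E₁ E₃ ε κ α x t j) (reflIf j (E2 E₃ ε)) (reflIf j E₁) z
        (expSigma3 (signed j κ * (2 * Real.pi * Complex.I))) := by
    intro j z hd hz hz'
    obtain ⟨d1, d2⟩ := disc_subset i1 him hre hd.le
    have hz'' : z ∉ segment ℝ (reflIf j (E2 E₃ ε)) (reflIf j E₃) := by
      rcases arc_eq (E₃ := E₃) (ε := ε) j with ⟨e1, e2⟩ | ⟨e1, e2⟩ <;> rw [e1, e2] at hz'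
      · exact hz'
      · rwa [segment_symm]
    exact jumpAt_inner_branch (reflIf_re j E₁) (A.refl_E2_re_lt j) (A.refl_E2_im j) d1 d2
      (A.refl_notMem j) hz' hz'' hz
  have hβ : (κ : ℂ) * (2 * Real.pi * Complex.I) = Complex.I * β := by
    rw [hκ]
    push_cast
    field_simp
  have hfar : ∀ p : ℂ, p.re = E₁.re → ∀ j, ρ₁ < ‖p - reflIf j E₃‖ := by
    intro p hp j
    have := (le_abs_self _).trans (Complex.abs_re_le_norm (p - reflIf j E₃))
    rw [Complex.sub_re, reflIf_re, hp] at this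
    linarith
  refine ⟨?_, ?_, ?_, ?_, ?_, ?_, ?_, ?_⟩
  · intro a b z hz
    refine DifferentiableAt.differentiableWithinAt ?_
    have hev : ∀ᶠ w in 𝓝 z, w ∉ closedContour E₁ E₃ ε := hcl.isOpen_compl.mem_nhds hz
    rcases hcover z with ⟨j, hj⟩ | h
    · obtain ⟨d1, d2⟩ := disc_subset i1 him hre hj.le
      obtain ⟨n1, n2, n3⟩ := notMem_of_notMem_closedContour hz j
      refine (differentiableAt_mul_apply (hS' j z hj) (G := localInner E₁ E₃ ε κ α x t j)
        (differentiableAt_inner (reflIf_re j E₁) (A.refl_E2_re_lt j) (A.refl_E2_im j) d1 d2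
        (A.refl_notMem j) n1 n2 n3) a b).congr_of_eventuallyEq ?_
      filter_upwards [hinE j z hj, hev] with w h1 h2
      rw [h1 h2]
    · simp only [closedContour, Set.mem_compl_iff, Set.mem_union, not_or] at hz
      obtain ⟨⟨⟨⟨-, h2⟩, h3⟩, h4⟩, -⟩ := hz
      refine (differentiableAt_mul_apply (hR' z h) (differentiableAt_outer (κ := κ) (x := x)
        (t := t) hlt h3 h4 (by rwa [segment_symm])) a b).congr_of_eventuallyEq ?_
      filter_upwards [houtE z h, hev] with w h1 h2
      rw [h1 h2]
  · intro z hz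
    refine hcut false z hz ?_
    have := hnot _ m23 z hz _ m12 fun h => by
      have := congrArg (fun s : ℂ × ℂ => s.1.re) h
      simp only [E2_re] at this
      linarith
    rwa [segment_symm] at this
  · intro z hz
    have n23 := hnot _ m12 z hz _ m23 fun h => by
      have := congrArg (fun s : ℂ × ℂ => s.1.re) h
      simp only [E2_re] at this
      linarith
    have n11 := hnot _ m12 z hz _ m11 fun h => by
      have := congrArg (fun s : ℂ × ℂ => s.2.re) h
      simp only [E2_re] at this
      linarith
    have n21 := hnot _ m12 z hz _ m21 fun h => by
      have := congrArg (fun s : ℂ × ℂ => s.2.re) h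
      simp only [E2_re, Complex.conj_re] at this
      linarith
    show JumpAt Ψ E₁ (E2 E₃ ε) z _
    rw [← hβ]
    rcases hcover z with ⟨j, hj⟩ | h
    -- On the arc `(E₁, E₂)` only the upper disc can occur, since the arc is in the upper
    -- half-plane. The parametrix has its branch oriented from `E₂` to `E₁`, whence the `swap`.
    · cases j
      · refine hin' false z hj _ m12 hz _ ((hbranch false z hj ?_ n23).swap
          (expSigma3_mul_neg _))
        rwa [openSegment_symm] at hz
      · have a1 := (disc_subset i1 him hre hj.le).2
        have a2 := im_pos_of_mem_segment (openSegment_subset_segment ℝ _ _ hz) i1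
          (by rw [E2_im]; exact i3)
        simp only [reflIf, if_true, Complex.conj_im] at a1
        nlinarith
    · exact hout' z h _ m12 hz _ (jumpAt_outer_upper hlt n11 hz (by rwa [segment_symm]))
  · intro z hz
    have n12 := hnot _ m11 z hz _ m12 fun h => by
      have := congrArg (fun s : ℂ × ℂ => s.2.re) h
      simp only [E2_re] at this
      linarith
    have n21 := hnot _ m11 z hz _ m21 fun h => by
      have := congrArg (fun s : ℂ × ℂ => s.1.re) h
      simp only [E2_re, Complex.conj_re] at this
      linarith
    refine hout' z (hfar z ?_) _ m11 hz _ (jumpAt_outer_cut i1 hlt hz n12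
      (by rwa [segment_symm]))
    have := re_mem_of_mem_segment (l := E₁.re) (u := E₁.re) (openSegment_subset_segment ℝ _ _ hz)
      (by simp) le_rfl (by simp) le_rfl
    exact le_antisymm this.2 this.1
  · intro z hz
    have n32 := hnot _ m21 z hz _ m32 fun h => by
      have := congrArg (fun s : ℂ × ℂ => s.1.re) h
      simp only [E2_re, Complex.conj_re] at this
      linarith
    have n11 := hnot _ m21 z hz _ m11 fun h => by
      have := congrArg (fun s : ℂ × ℂ => s.1.re) h
      simp only [E2_re, Complex.conj_re] at this
      linarith
    have n12 := hnot _ m21 z hz _ m12 fun h => by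
      have := congrArg (fun s : ℂ × ℂ => s.2.re) h
      simp only [E2_re, Complex.conj_re] at this
      linarith
    show JumpAt Ψ (bar (E2 E₃ ε)) (bar E₁) z _
    rw [← hβ]
    rcases hcover z with ⟨j, hj⟩ | h
    · cases j
      · have a1 := (disc_subset i1 him hre hj.le).2
        have a2 := im_neg_of_mem_segment (openSegment_subset_segment ℝ _ _ hz)
          (by rw [Complex.conj_im, E2_im]; linarith) (by rw [Complex.conj_im]; linarith)
        simp only [reflIf, Bool.false_eq_true, if_false] at a1
        nlinarith
      · have := hbranch true z hj hz n32
        simp only [signed, if_true, Complex.ofReal_neg, neg_mul] at this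
        exact hin' true z hj _ m21 hz _ this
    · exact hout' z h _ m21 hz _ (jumpAt_outer_lower hlt n11 n12 (by rwa [openSegment_symm]))
  · intro z hz
    refine hcut true z hz ?_
    exact hnot _ m32 z hz _ m21 fun h => by
      have := congrArg (fun s : ℂ × ℂ => s.1.re) h
      simp only [E2_re, Complex.conj_re] at this
      linarith
  · intro a b
    have h1 := nearInf_mul_apply hinf (nearInf_outer (κ := κ) (x := x) (t := t) hlt) a b
    rw [Matrix.mul_one] at h1
    refine h1.congr ?_
    filter_upwards [isBounded_def.1 (isCompact_closedContour E₁ E₃ ε).isBounded,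
      eventually_all.2 fun j => eventually_lt_norm_sub (reflIf j E₃) ρ₁] with z h2 h3
    rw [hout z h2 h3]
  · have hinner : ∀ j p, p = reflIf j (E2 E₃ ε) ∨ p = reflIf j E₃ → ∀ a b,
        (fun z => Ψ z a b) =O[𝓝[(closedContour E₁ E₃ ε)ᶜ] p]
          fun z => ‖z - p‖ ^ (-(1 / 4) : ℝ) := by
      intro j p hp a b
      have hd : ‖p - reflIf j E₃‖ < ρ₂ := by
        rcases hp with rfl | rfl
        · rw [reflIf_E2]
          simp only [add_sub_cancel_left, Complex.norm_real, Real.norm_eq_abs, abs_of_pos ip]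
          linarith
        · rw [sub_self, norm_zero]; linarith
      obtain ⟨d1, d2⟩ := disc_subset i1 him hre hd.le
      have h1 := isBigO_inner (α := α) (κ := signed j κ) (x := x) (t := t)
        (s := outerInf E₁ (E2 E₃ ε) κ x t) (reflIf_re j E₁) (A.refl_E2_re_lt j) (A.refl_E2_im j)
        d1 d2 (A.refl_notMem j) (A.refl_ne j) (arc_eq j) hp
      have hsub : 𝓝[(closedContour E₁ E₃ ε)ᶜ] p ≤
          𝓝[(segment ℝ (reflIf j (E2 E₃ ε)) (reflIf j E₃))ᶜ] p :=
        nhdsWithin_mono _ fun w hw => (notMem_of_notMem_closedContour hw j).2.1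
      have h2 := isBigO_mul_apply (fun a b => ((hS' j p hd a b).continuousAt.tendsto.mono_left
        nhdsWithin_le_nhds).isBigO_one ℝ) (fun a b => (h1 a b).mono hsub) a b
      simp only [one_mul] at h2
      refine h2.congr' ?_ EventuallyEq.rfl
      filter_upwards [self_mem_nhdsWithin, mem_nhdsWithin_of_mem_nhds (hinE j p hd)] with w h3 h4
      rw [h4 h3]
      rfl
    have houter : ∀ p, p = bar E₁ ∨ p = E₁ → ∀ a b,
        (fun z => Ψ z a b) =O[𝓝[(closedContour E₁ E₃ ε)ᶜ] p]
          fun z => ‖z - p‖ ^ (-(1 / 4) : ℝ) := by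
      intro p hp a b
      have hd : ∀ j, ρ₁ < ‖p - reflIf j E₃‖ := hfar p (by rcases hp with rfl | rfl <;> simp)
      have hsub : 𝓝[(closedContour E₁ E₃ ε)ᶜ] p ≤ 𝓝[(segment ℝ (bar E₁) E₁)ᶜ] p :=
        nhdsWithin_mono _ fun w hw hw' => hw (mem_closedContour.2 ⟨_, m11, hw'⟩)
      have h2 := isBigO_mul_apply (fun a b => ((hR' p hd a b).continuousAt.tendsto.mono_left
        nhdsWithin_le_nhds).isBigO_one ℝ) (fun a b => (isBigO_outer (κ := κ) (x := x) (t := t)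
          i1 hlt hp a b).mono hsub) a b
      simp only [one_mul] at h2
      refine h2.congr' ?_ EventuallyEq.rfl
      filter_upwards [self_mem_nhdsWithin, mem_nhdsWithin_of_mem_nhds (houtE p hd)] with w h3 h4
      rw [h4 h3]
    intro p hp
    simp only [endpoints, Set.mem_insert_iff, Set.mem_singleton_iff] at hp
    rcases hp with rfl | rfl | rfl | rfl | rfl | rfl
    · exact houter _ (Or.inr rfl)
    · exact houter _ (Or.inl rfl)
    · exact hinner false _ (Or.inl rfl)
    · exact hinner true _ (Or.inl rfl)
    · exact hinner false _ (Or.inr rfl)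
    · exact hinner true _ (Or.inr rfl)

end

/-! ### Convergence to the plane wave -/

lemma IsTwoPhaseValue.unique {E₁ E₃ : ℂ} {α β ε x t : ℝ} {q q' : ℂ}
    (h : IsTwoPhaseValue E₁ E₃ α β ε x t q) (h' : IsTwoPhaseValue E₁ E₃ α β ε x t q') :
    q = q' := by
  obtain ⟨Ψ, -, h2, h3⟩ := h
  obtain ⟨Ψ', h1', -, h3'⟩ := h'
  refine tendsto_nhds_unique h3 (h3'.congr' ?_)
  filter_upwards [isBounded_def.1 (isCompact_closedContour E₁ E₃ ε).isBounded] with z hz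
  rw [h2 Ψ' h1' hz]

lemma IsTwoPhaseValue.twoPhaseSolution_eq {E₁ E₃ : ℂ} {α β ε x t : ℝ} {q : ℂ}
    (h : IsTwoPhaseValue E₁ E₃ α β ε x t q) : twoPhaseSolution E₁ E₃ α β ε x t = q :=
  IsTwoPhaseValue.unique (Classical.epsilon_spec ⟨q, h⟩) h

/-- The `1/z` coefficient of `R * outer` is the sum of those of `R` and `outer`. The `(0, 1)`
coefficient of `R` is at most `2 * D`, one `D` for each disc, and the factor `-2` in the definition
of `q` turns this into `4 * D`. -/
theorem Admissible.exists_isTwoPhaseValue {E₁ E₃ : ℂ} {α β ε x t ρ₁ ρ₂ D : ℝ}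
    (A : Admissible E₁ E₃ ε) (h12 : ρ₁ < ρ₂) (hε : ε < ρ₁) (him : ρ₂ < E₃.im)
    (hre : E₃.re + ρ₂ < E₁.re) {R : ℂ → Mat} {S : Bool → ℂ → Mat}
    (hR : ∀ a b, DifferentiableOn ℂ (fun z => R z a b) {z | ∀ j, ρ₁ < ‖z - reflIf j E₃‖})
    (hS : ∀ j a b, DifferentiableOn ℂ (fun z => S j z a b) {z | ‖z - reflIf j E₃‖ < ρ₂})
    (hRS : ∀ j, ∀ z ∈ annulus (reflIf j E₃) ρ₁ ρ₂,
      R z = S j z * (1 + localError E₁ E₃ ε (β / (2 * Real.pi)) α x t j z))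
    (hD : ∀ z, (∀ j, ρ₁ < ‖z - reflIf j E₃‖) → ∀ a b,
      ‖R z a b - (1 : Mat) a b‖ ≤ D * ∑ j, ‖z - reflIf j E₃‖⁻¹) :
    ∃ q, IsTwoPhaseValue E₁ E₃ α β ε x t q ∧
      ‖q - planeWave E₁ (phaseConst E₁ (E2 E₃ ε) (β / (2 * Real.pi))) x t‖ ≤ 4 * D := by
  set κ := β / (2 * Real.pi) with hκ
  have hlt : (E2 E₃ ε).re < E₁.re := by rw [E2_re]; exact A.re
  obtain ⟨Ψ, hout, hin⟩ := exists_glue (c := fun j => reflIf j E₃) (Γ := closedContour E₁ E₃ ε)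
    (F := fun z => R z * outer E₁ (E2 E₃ ε) κ x t z)
    (G := fun j z => S j z * localInner E₁ E₃ ε κ α x t j z)
    (disc_separated A.im₁ him hre) fun j z hz hzΓ => by
      rw [hRS j z hz, localInner_eq hzΓ, Matrix.mul_assoc]
  have hres := fun a b => exists_tendsto_mul_of_norm_le (c := fun j => reflIf j E₃) (ρ := ρ₁)
    (D := D) (f := fun z => R z a b - (1 : Mat) a b) ((hR a b).sub_const _)
    fun z hz => hD z hz a b
  have hinf : ∀ a b, NearInf (fun z => R z a b) ((1 : Mat) a b) := fun a b =>
    nearInf_of_tendsto_mul (hres a b).choose_spec.2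
  have hsol := A.isRHSolution_of_parametrices h12 hε him hre hR hS hout hin hinf
  obtain ⟨r, hr, hr'⟩ := hres 0 1
  simp only [ne_eq, zero_ne_one, not_false_eq_true, Matrix.one_apply_ne, sub_zero] at hr'
  rw [Fintype.card_bool, Nat.cast_ofNat] at hr
  have hlim : Tendsto (fun z => -2 * (z * Ψ z 0 1)) (cobounded ℂ)
      (𝓝 (-2 * (E₁.im / 2 * Complex.exp (-2 * outerInf E₁ (E2 E₃ ε) κ x t) + r))) := by
    have h1 := (((hinf 0 0).tendsto.mul (tendsto_mul_outer (κ := κ) (x := x) (t := t) hlt)).add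
      (hr'.mul (nearInf_outer (κ := κ) (x := x) (t := t) hlt 1 1).tendsto)).const_mul (-2)
    simp only [Matrix.one_apply_eq, one_mul, mul_one] at h1
    refine h1.congr' ?_
    filter_upwards [isBounded_def.1 (isCompact_closedContour E₁ E₃ ε).isBounded,
      eventually_all.2 fun j => eventually_lt_norm_sub (reflIf j E₃) ρ₁] with z h2 h3
    rw [hout z h2 h3, Matrix.mul_apply, Fin.sum_univ_two]
    ring
  refine ⟨_, ⟨Ψ, hsol, fun Ψ' h' => A.eqOn hsol h', hlim⟩, ?_⟩
  rw [planeWave_phaseConst]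
  have : -2 * (E₁.im / 2 * Complex.exp (-2 * outerInf E₁ (E2 E₃ ε) κ x t) + r) -
      -(E₁.im * Complex.exp (-2 * outerInf E₁ (E2 E₃ ε) κ x t)) = -2 * r := by ring
  rw [this, norm_mul, norm_neg, Complex.norm_ofNat]
  linarith

lemma eventually_norm_localError_le {E₁ E₃ : ℂ} (hE₁ : 0 < E₁.im) {κ ρ₁ ρ₂ : ℝ} (α : ℝ)
    (hκ : |κ| < 1 / 2) (h1 : 0 < ρ₁) (h12 : ρ₁ < ρ₂) (him : ρ₂ < E₃.im)
    (hre : E₃.re + ρ₂ < E₁.re) {K : Set (ℝ × ℝ)} (hK : IsCompact K) {δ : ℝ} (hδ : 0 < δ)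
    (j : Bool) : ∀ᶠ ε : ℝ in 𝓝[>] 0, ∀ xt ∈ K, ∀ z ∈ annulus (reflIf j E₃) ρ₁ ρ₂, ∀ a b,
      ‖localError E₁ E₃ ε κ α xt.1 xt.2 j z a b‖ ≤ δ := by
  have hE₃ : 0 < E₃.im := (h1.trans h12).trans him
  have hlt : E₃.re + ρ₁ < E₁.re := by linarith
  obtain ⟨C, hC⟩ := exists_bound_frame (E₁ := E₁) (E₃ := E₃) (p := reflIf j E₁)
    (c := reflIf j E₃) (κ := signed j κ) (α := α) (κ₀ := κ) (ρ₁ := ρ₁) (ρ₂ := ρ₂) hE₁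
    (reflIf_re j E₁) hlt (by rwa [reflIf_re, reflIf_re]) (reflIf_im_mul_pos hE₁ hE₃ j)
    (fun z hz => disc_subset hE₁ him hre hz) hK
  have hκ' : |signed j κ| < 1 / 2 := by cases j <;> simpa [signed] using hκ
  -- The added `1` allows division also when `C = 0`.
  have hpos : (0 : ℝ) < 4 * C ^ 2 + 1 := by positivity
  have hab : (∀ ε : ℝ, arcStart j E₃ ε = reflIf j E₃ + (ε : ℝ) ∧ arcEnd j E₃ ε = reflIf j E₃) ∨
      ∀ ε : ℝ, arcStart j E₃ ε = reflIf j E₃ ∧ arcEnd j E₃ ε = reflIf j E₃ + (ε : ℝ) := by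
    cases j
    · exact Or.inl fun ε => ⟨rfl, rfl⟩
    · exact Or.inr fun ε => ⟨rfl, reflIf_E2 true E₃ ε⟩
  filter_upwards [eventually_norm_mismatch_le (p := reflIf j E₁) (c := reflIf j E₃)
    (by rw [reflIf_re, reflIf_re]; linarith) hκ' h1 hab (div_pos hδ hpos),
    Ioc_mem_nhdsGT h1] with ε hε hε1 xt hxt z hz a b
  rw [localError, reflIf_E2]
  refine (norm_parametrixError_le (hC ε ⟨hε1.1.le, hε1.2⟩ xt hxt z hz.2.le)
    (hε z hz.1.le) a b).trans ?_
  rw [← mul_div_assoc, div_le_iff₀ hpos]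
  nlinarith

theorem eventually_exists_isTwoPhaseValue {E₁ E₃ : ℂ} (hE₁ : 0 < E₁.im) (hE₃ : 0 < E₃.im)
    (hre : E₃.re < E₁.re) (α : ℝ) {β : ℝ} (hβ : β ∈ Set.Ioo (-Real.pi) Real.pi)
    {K : Set (ℝ × ℝ)} (hK : IsCompact K) {τ : ℝ} (hτ : 0 < τ) :
    ∀ᶠ ε : ℝ in 𝓝[>] 0, ∀ xt ∈ K, ∃ q, IsTwoPhaseValue E₁ E₃ α β ε xt.1 xt.2 q ∧
      ‖q - planeWave E₁ (phaseConst E₁ (E2 E₃ ε) (β / (2 * Real.pi))) xt.1 xt.2‖ ≤ τ := by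
  -- Discs of this radius stay inside their half-planes and to the left of the vertical arc, and in
  -- particular are disjoint.
  obtain ⟨ρ₂, h2, him, hre'⟩ : ∃ ρ₂ : ℝ, 0 < ρ₂ ∧ ρ₂ < E₃.im ∧ E₃.re + ρ₂ < E₁.re := by
    obtain ⟨r, h, h'⟩ := exists_between (lt_min hE₃ (sub_pos.2 hre))
    exact ⟨r, h, h'.trans_le (min_le_left _ _),
      by linarith [h'.trans_le (min_le_right E₃.im (E₁.re - E₃.re))]⟩
  obtain ⟨ρ₁, h1, h12⟩ := exists_between h2
  have hκ : |β / (2 * Real.pi)| < 1 / 2 := by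
    rw [abs_div, abs_of_pos Real.two_pi_pos, div_lt_iff₀ Real.two_pi_pos]
    linarith [abs_lt.2 hβ]
  obtain ⟨C, δ₀, hC, hδ₀, H⟩ := exists_small_norm_solution (fun j : Bool => reflIf j E₃) h1 h12
    (disc_separated hE₁ him hre')
  -- The final error is `4 * (C * δ)`, so `δ ≤ τ / (4 * C)` is what is needed.
  have hδ : 0 < min δ₀ (τ / (4 * C)) := lt_min hδ₀ (by positivity)
  filter_upwards [eventually_norm_localError_le hE₁ α hκ h1 h12 him hre' hK hδ false,
    eventually_norm_localError_le hE₁ α hκ h1 h12 him hre' hK hδ true,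
    Ioo_mem_nhdsGT h1] with ε e1 e2 hε xt hxt
  have A : Admissible E₁ E₃ ε := ⟨hE₁, hE₃, hε.1, by linarith [hε.2]⟩
  obtain ⟨R, S, hR, hS, hRS, hD⟩ := H _ (localError E₁ E₃ ε (β / (2 * Real.pi)) α xt.1 xt.2)
    hδ.le (min_le_left _ _) (fun j a b z hz => by
      obtain ⟨d1, d2⟩ := disc_subset hE₁ him hre' hz.2.le
      have hne : z ∉ segment ℝ (arcStart j E₃ ε) (arcEnd j E₃ ε) := fun h =>
        absurd ((A.dist_le_of_mem_arc h).trans_lt hε.2) (not_lt.2 hz.1.le)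
      have hne' : z ∉ segment ℝ (reflIf j (E2 E₃ ε)) (reflIf j E₃) := by
        rcases arc_eq (E₃ := E₃) (ε := ε) j with ⟨e1, e2⟩ | ⟨e1, e2⟩ <;> rw [e1, e2] at hne
        · exact hne
        · rwa [segment_symm]
      exact (differentiableAt_parametrixError (reflIf_re j E₁) (A.refl_E2_re_lt j)
        (A.refl_E2_im j) d1 d2 (A.refl_notMem j) hne hne' a b).differentiableWithinAt)
    (fun j a b z hz => by
      cases j
      exacts [e1 xt hxt z hz a b, e2 xt hxt z hz a b])
  obtain ⟨q, hq, hq'⟩ := A.exists_isTwoPhaseValue h12 hε.2 him hre' hR hS hRS hD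
  refine ⟨q, hq, hq'.trans ?_⟩
  calc 4 * (C * min δ₀ (τ / (4 * C))) ≤ 4 * (C * (τ / (4 * C))) := by
        gcongr; exact min_le_right _ _
    _ = τ := by field_simp

/-- The exponential is unimodular for real `x` and `t`, so convergence of the phase constant is
convergence of the waves, uniformly in `(x, t)`. -/
lemma norm_planeWave_sub_le (E₁ c c' : ℂ) (x t : ℝ) :
    ‖planeWave E₁ c x t - planeWave E₁ c' x t‖ ≤ |E₁.im| * ‖c - c'‖ := by
  have h : planeWave E₁ c x t - planeWave E₁ c' x t = -((E₁.im : ℂ) * (c - c') *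
      Complex.exp (((-(2 * E₁.re * x) + -2 * (2 * E₁.re ^ 2 - E₁.im ^ 2) * t : ℝ) : ℂ) *
      Complex.I)) := by
    have e : -(Complex.I * ((2 * E₁.re : ℝ) : ℂ) * (x : ℂ)) +
        Complex.I * ((-2 * (2 * E₁.re ^ 2 - E₁.im ^ 2) : ℝ) : ℂ) * (t : ℂ) =
        ((-(2 * E₁.re * x) + -2 * (2 * E₁.re ^ 2 - E₁.im ^ 2) * t : ℝ) : ℂ) * Complex.I := by
      push_cast
      ring
    rw [planeWave, planeWave, e]
    ring
  rw [h, norm_neg, norm_mul, Complex.norm_exp_ofReal_mul_I, norm_mul, Complex.norm_real, mul_one,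
    Real.norm_eq_abs]

end TwoPhase

/-! ### The convergence theorem. -/

theorem theorem2 (E₁ E₃ : ℂ) (hE₁ : 0 < E₁.im) (hE₃ : 0 < E₃.im) (hre : E₃.re < E₁.re)
    (α β : ℝ) (hβ : β ∈ Set.Ioo (-Real.pi) Real.pi) :
    ∃ c₂ : ℂ, ‖c₂‖ = 1 ∧ ∀ K : Set (ℝ × ℝ), IsCompact K →
      (∀ᶠ ε in 𝓝[>] (0 : ℝ), ∀ p ∈ K,
        TwoPhase.IsTwoPhaseValue E₁ E₃ α β ε p.1 p.2
          (TwoPhase.twoPhaseSolution E₁ E₃ α β ε p.1 p.2)) ∧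
      TendstoUniformlyOn
        (fun (ε : ℝ) (p : ℝ × ℝ) => TwoPhase.twoPhaseSolution E₁ E₃ α β ε p.1 p.2)
        (fun p : ℝ × ℝ => TwoPhase.planeWave E₁ c₂ p.1 p.2)
        (𝓝[>] (0 : ℝ)) K := by
  refine ⟨TwoPhase.phaseConst E₁ E₃ (β / (2 * Real.pi)), TwoPhase.norm_phaseConst hE₁ hre _,
    fun K hK => ⟨?_, ?_⟩⟩
  -- Only existence is needed here, so any tolerance will do.
  · filter_upwards [TwoPhase.eventually_exists_isTwoPhaseValue hE₁ hE₃ hre α hβ hK one_pos]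
      with ε hε p hp
    obtain ⟨q, hq, -⟩ := hε p hp
    rwa [hq.twoPhaseSolution_eq]
  · rw [Metric.tendstoUniformlyOn_iff]
    intro τ hτ
    have hc := (tendsto_iff_norm_sub_tendsto_zero.1
      (TwoPhase.tendsto_phaseConst hE₁ hre (β / (2 * Real.pi)))).const_mul |E₁.im|
    rw [mul_zero] at hc
    -- One half of `τ` covers the distance to the wave with phase taken at `E₂`, the other half the
    -- change of phase from `E₂` to `E₃`.
    filter_upwards [TwoPhase.eventually_exists_isTwoPhaseValue hE₁ hE₃ hre α hβ hK (half_pos hτ),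
      hc.eventually_lt_const (half_pos hτ)] with ε hε hε' p hp
    obtain ⟨q, hq, hq'⟩ := hε p hp
    have h1 := TwoPhase.norm_planeWave_sub_le E₁ (TwoPhase.phaseConst E₁ (E₃ + (ε : ℝ))
      (β / (2 * Real.pi))) (TwoPhase.phaseConst E₁ E₃ (β / (2 * Real.pi))) p.1 p.2
    rw [hq.twoPhaseSolution_eq, dist_comm, dist_eq_norm]
    calc _ ≤ _ := norm_sub_le_norm_sub_add_norm_sub _ (TwoPhase.planeWave E₁
          (TwoPhase.phaseConst E₁ (E₃ + (ε : ℝ)) (β / (2 * Real.pi))) p.1 p.2) _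
      _ < τ / 2 + τ / 2 := add_lt_add_of_le_of_lt hq' (h1.trans_lt hε')
      _ = τ := add_halves τ
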